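/- Let $k$ be a field and let $\mathcal C$ be a $k$-linear category with object set $\mathbb N$ such that all Hom-spaces are finite dimensional and $\mathcal C(j,i)=0$ whenever $i<j$ (type $A_\infty$). Let $D=\operatorname{Hom}_k(-,k)$. A $\mathcal C$-module is a $k$-linear functor $\mathcal C\to\operatorname{Mod}k$; they form the abelian category $\operatorname{Mod}\mathcal C$. For a family $\mathcal A$ of modules, $\operatorname{add}\mathcal A$ consists of the direct summands of finite direct sums of members of $\mathcal A$; put $\operatorname{proj}\mathcal C=\operatorname{add}\{\mathcal C(a,-)\}$. A module $M$ is finitely generated if there is an epimorphism $P\to M$ with $P\in\operatorname{proj}\mathcal C$, and finitely presented if moreover its kernel can be taken finitely generated. It is finite dimensional if only finitely many $M(i)$ are nonzero and all of them are finite dimensional. Write $\operatorname{fp}\mathcal C$ and $\operatorname{fd}\mathcal C$ for the corresponding full subcategories. Assume that $\operatorname{Mod}\mathcal C$ is locally Noetherian, i.e. submodules of finitely generated modules are finitely generated; then $\operatorname{fp}\mathcal C$ is abelian. In an abelian category $\mathcal A$, call $f\colon X\to Y$ projectively trivial if $\operatorname{Ext}^1_{\mathcal A}(f,Z)=0$ for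 all $Z$, and injectively trivial if $\operatorname{Ext}^1_{\mathcal A}(Z,f)=0$ for all $Z$. Let $\underline{\mathcal A}$ and $\overline{\mathcal A}$ be the quotients of $\mathcal A$ by the ideals of projectively, respectively injectively, trivial morphisms. Let $\mathcal A=\operatorname{fp}\mathcal C$. Let $\mathcal A_r$ be the full subcategory of those $X$ for which the functor $D\operatorname{Ext}^1_{\mathcal A}(X,-)$ on $\overline{\mathcal A}$ is representable, and $\mathcal A_l$ that of those $X$ for which the functor $D\operatorname{Ext}^1_{\mathcal A}(-,X)$ on $\underline{\mathcal A}$ is representable. Let $\underline{\mathcal A_r}\subseteq\underline{\mathcal A}$ and $\overline{\mathcal A_l}\subseteq\overline{\mathcal A}$ be the full subcategories on their objects. A projective cover is an epimorphism $f\colon P\to M$ with $P$ projective such that every endomorphism $g$ of $P$ with $fg=f$ is invertible. A minimal projective presentation of $M$ is an exact sequence $P_1\xrightarrow{f_1}P_0\xrightarrow{f_0}M\to0$ in which $f_0$ and $P_1\to\operatorname{Im}f_1$ are projective covers. Let $M^*$ be the $\mathcal C^{\mathrm{op}}$-module $a\mapsto\operatorname{Hom}(M,\mathcal C(a,-))$,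 and let $\operatorname{Tr}M=\operatorname{Cok}(f_1^*\colon P_0^*\to P_1^*)$. Let $(DM)(a)=D(M(a))$. The same definitions apply to $\mathcal C^{\mathrm{op}}$. **Theorem.** We have $$(\operatorname{fp}\mathcal C)_r=\operatorname{fp}\mathcal C,\qquad(\operatorname{fp}\mathcal C)_l=\operatorname{add}\bigl(\operatorname{fd}\mathcal C\cup\{\text{injective objects of }\operatorname{fp}\mathcal C\}\bigr).$$ Moreover, $D\operatorname{Tr}$ and $\operatorname{Tr}D$ induce the generalized Auslander–Reiten translation functors. That is, there are mutually quasi-inverse equivalences $$\tau\colon\underline{(\operatorname{fp}\mathcal C)_r}=\underline{\operatorname{fp}\mathcal C}\to\overline{(\operatorname{fp}\mathcal C)_l},\qquad\tau^-\colon\overline{(\operatorname{fp}\mathcal C)_l}\to\underline{(\operatorname{fp}\mathcal C)_r}$$ with the following properties. 1. Every $M\in\operatorname{fp}\mathcal C$ has a minimal projective presentation; for each such presentation $D\operatorname{Tr}M$ lies in $(\operatorname{fp}\mathcal C)_l$, and there is an isomorphism $\tau M\cong D\operatorname{Tr}M$ in $\overline{(\operatorname{fp}\mathcal C)_l}$.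 These isomorphisms are compatible with every morphism $f\colon M\to N$ in $\operatorname{fp}\mathcal C$ and every lift of $f$ to the presentations. 2. For every $N\in\operatorname{fd}\mathcal C$, the $\mathcal C^{\mathrm{op}}$-module $DN$ has a minimal projective presentation; for each such presentation $\operatorname{Tr}DN$ lies in $\operatorname{fp}\mathcal C$, and there is an isomorphism $\tau^-N\cong\operatorname{Tr}DN$ in $\underline{\operatorname{fp}\mathcal C}$. These isomorphisms are compatible with every morphism $f\colon N\to N'$ in $\operatorname{fd}\mathcal C$ and every lift of $Df$ to the presentations. 3. There are $k$-linear isomorphisms, natural in $X$ and $Y$, $$\operatorname{Hom}_{\overline{\operatorname{fp}\mathcal C}}(X,\tau Y)\cong D\operatorname{Ext}^1(Y,X)\qquad(X\in\operatorname{fp}\mathcal C,\ Y\in(\operatorname{fp}\mathcal C)_r),$$ $$\operatorname{Hom}_{\underline{\operatorname{fp}\mathcal C}}(\tau^-X,Y)\cong D\operatorname{Ext}^1(Y,X)\qquad(X\in(\operatorname{fp}\mathcal C)_l,\ Y\in\operatorname{fp}\mathcal C).$$ -/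

import Mathlib

open CategoryTheory CategoryTheory.Limits Opposite

universe u v

namespace GenAR

noncomputable section

/-! ### Stable categories of a linear abelian category and generalized Auslander-Reiten duality -/

section Abelian

variable (k : Type u) [Field k] {A : Type v} [Category.{u} A] [Abelian A] [Linear k A]

/-- The group `Ext¹(X, Y)` in the abelian category `A`. -/
abbrev Ext1 {A : Type v} [Category.{u} A] [Abelian A] (X Y : A) : Type (max u v) :=
  letI : HasExt.{max u v} A := HasExt.standard A
  Abelian.Ext.{max u v} X Y 1

/-- `Ext¹(f, Z) : Ext¹(Y, Z) → Ext¹(X, Z)`. -/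
def extPre {X Y : A} (f : X ⟶ Y) (Z : A) : Ext1 Y Z →ₗ[k] Ext1 X Z :=
  letI : HasExt.{max u v} A := HasExt.standard A
  Abelian.Ext.bilinearCompOfLinear k X Y Z 0 1 1 (zero_add 1) (Abelian.Ext.mk₀ f)

/-- `Ext¹(Z, f) : Ext¹(Z, X) → Ext¹(Z, Y)`. -/
def extPost (Z : A) {X Y : A} (f : X ⟶ Y) : Ext1 Z X →ₗ[k] Ext1 Z Y :=
  letI : HasExt.{max u v} A := HasExt.standard A
  Abelian.Ext.postcompOfLinear (Abelian.Ext.mk₀ f) k Z (add_zero 1)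

theorem extPre_comp {X Y W : A} (f : X ⟶ Y) (g : Y ⟶ W) (Z : A) :
    extPre k (f ≫ g) Z = extPre k f Z ∘ₗ extPre k g Z := by
  let : HasExt.{max u v} A := HasExt.standard A
  ext e
  simp [extPre]

theorem extPost_comp (Z : A) {X Y W : A} (f : X ⟶ Y) (g : Y ⟶ W) :
    extPost k Z (f ≫ g) = extPost k Z g ∘ₗ extPost k Z f := by
  let : HasExt.{max u v} A := HasExt.standard A
  ext e
  simp [extPost]

theorem extPre_add {X Y : A} (f g : X ⟶ Y) (Z : A) :
    extPre k (f + g) Z = extPre k f Z + extPre k g Z := by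
  let : HasExt.{max u v} A := HasExt.standard A
  ext e
  simp [extPre, Abelian.Ext.mk₀_add]

theorem extPost_add (Z : A) {X Y : A} (f g : X ⟶ Y) :
    extPost k Z (f + g) = extPost k Z f + extPost k Z g := by
  let : HasExt.{max u v} A := HasExt.standard A
  ext e
  simp [extPost, Abelian.Ext.mk₀_add]

theorem extPre_smul (c : k) {X Y : A} (f : X ⟶ Y) (Z : A) :
    extPre k (c • f) Z = c • extPre k f Z := by
  simp [extPre, Abelian.Ext.mk₀_smul]

theorem extPost_smul (Z : A) (c : k) {X Y : A} (f : X ⟶ Y) :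
    extPost k Z (c • f) = c • extPost k Z f := by
  simp [extPost, Abelian.Ext.mk₀_smul]

/-- The submodule of projectively trivial morphisms: `Ext¹(f, Z) = 0` for every `Z`. -/
def projTrivial (X Y : A) : Submodule k (X ⟶ Y) where
  carrier := {f | ∀ Z : A, extPre k f Z = 0}
  zero_mem' Z := by simpa using extPre_smul k (0 : k) (0 : X ⟶ Y) Z
  add_mem' hf hg Z := by rw [extPre_add, hf Z, hg Z, add_zero]
  smul_mem' c f hf Z := by rw [extPre_smul, hf Z, smul_zero]

/-- The submodule of injectively trivial morphisms: `Ext¹(Z, f) = 0` for every `Z`. -/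
def injTrivial (X Y : A) : Submodule k (X ⟶ Y) where
  carrier := {f | ∀ Z : A, extPost k Z f = 0}
  zero_mem' Z := by simpa using extPost_smul k Z (0 : k) (0 : X ⟶ Y)
  add_mem' hf hg Z := by rw [extPost_add, hf Z, hg Z, add_zero]
  smul_mem' c f hf Z := by rw [extPost_smul, hf Z, smul_zero]

theorem projTrivial_comp_left {X Y W : A} (f : X ⟶ Y) {g : Y ⟶ W} (hg : g ∈ projTrivial k Y W) :
    f ≫ g ∈ projTrivial k X W := fun Z => by rw [extPre_comp, hg Z, LinearMap.comp_zero]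

theorem projTrivial_comp_right {X Y W : A} {f : X ⟶ Y} (g : Y ⟶ W) (hf : f ∈ projTrivial k X Y) :
    f ≫ g ∈ projTrivial k X W := fun Z => by rw [extPre_comp, hf Z, LinearMap.zero_comp]

theorem injTrivial_comp_left {X Y W : A} (f : X ⟶ Y) {g : Y ⟶ W} (hg : g ∈ injTrivial k Y W) :
    f ≫ g ∈ injTrivial k X W := fun Z => by rw [extPost_comp, hg Z, LinearMap.zero_comp]

theorem injTrivial_comp_right {X Y W : A} {f : X ⟶ Y} (g : Y ⟶ W) (hf : f ∈ injTrivial k X Y) :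
    f ≫ g ∈ injTrivial k X W := fun Z => by rw [extPost_comp, hf Z, LinearMap.comp_zero]

variable (A)

/-- Two morphisms are identified in the projectively stable category. -/
def projRel : HomRel A := fun X Y f g => f - g ∈ projTrivial k X Y

/-- Two morphisms are identified in the injectively stable category. -/
def injRel : HomRel A := fun X Y f g => f - g ∈ injTrivial k X Y

instance : Congruence (projRel k A) where
  equivalence :=
    { refl := fun f => by simp [projRel]
      symm := fun {f g} h => by simpa [projRel] using neg_mem h
      trans := fun {f g h} h₁ h₂ => by simpa [projRel] using add_mem h₁ h₂ }
  comp_left f _ _ h := by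
    simpa [projRel, Preadditive.comp_sub] using projTrivial_comp_left k f h
  comp_right g h := by
    simpa [projRel, Preadditive.sub_comp] using projTrivial_comp_right k g h

instance : Congruence (injRel k A) where
  equivalence :=
    { refl := fun f => by simp [injRel]
      symm := fun {f g} h => by simpa [injRel] using neg_mem h
      trans := fun {f g h} h₁ h₂ => by simpa [injRel] using add_mem h₁ h₂ }
  comp_left f _ _ h := by
    simpa [injRel, Preadditive.comp_sub] using injTrivial_comp_left k f h
  comp_right g h := by
    simpa [injRel, Preadditive.sub_comp] using injTrivial_comp_right k g h

/-- The projectively stable category: morphisms modulo projectively trivial ones. -/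
abbrev ProjStable := Quotient (projRel k A)

/-- The injectively stable category: morphisms modulo injectively trivial ones. -/
abbrev InjStable := Quotient (injRel k A)

theorem projRel_add ⦃X Y : A⦄ (f₁ f₂ g₁ g₂ : X ⟶ Y) (hf : projRel k A f₁ f₂)
    (hg : projRel k A g₁ g₂) : projRel k A (f₁ + g₁) (f₂ + g₂) := by
  simpa [projRel, add_sub_add_comm] using add_mem hf hg

theorem injRel_add ⦃X Y : A⦄ (f₁ f₂ g₁ g₂ : X ⟶ Y) (hf : injRel k A f₁ f₂)
    (hg : injRel k A g₁ g₂) : injRel k A (f₁ + g₁) (f₂ + g₂) := by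
  simpa [injRel, add_sub_add_comm] using add_mem hf hg

theorem projRel_smul (c : k) ⦃X Y : A⦄ (f₁ f₂ : X ⟶ Y) (hf : projRel k A f₁ f₂) :
    projRel k A (c • f₁) (c • f₂) := by
  simpa [projRel, smul_sub] using Submodule.smul_mem _ c hf

theorem injRel_smul (c : k) ⦃X Y : A⦄ (f₁ f₂ : X ⟶ Y) (hf : injRel k A f₁ f₂) :
    injRel k A (c • f₁) (c • f₂) := by
  simpa [injRel, smul_sub] using Submodule.smul_mem _ c hf

instance : Preadditive (ProjStable k A) := Quotient.preadditive _ (projRel_add k A)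

instance : Preadditive (InjStable k A) := Quotient.preadditive _ (injRel_add k A)

instance : (Quotient.functor (projRel k A)).Additive := Quotient.functor_additive _ (projRel_add k A)

instance : (Quotient.functor (injRel k A)).Additive := Quotient.functor_additive _ (injRel_add k A)

instance : Linear k (ProjStable k A) := Quotient.linear k _ (projRel_smul k A)

instance : Linear k (InjStable k A) := Quotient.linear k _ (injRel_smul k A)

/-- The factor functor to the projectively stable category. -/
abbrev projQ : A ⥤ ProjStable k A := Quotient.functor (projRel k A)

/-- The factor functor to the injectively stable category. -/
abbrev injQ : A ⥤ InjStable k A := Quotient.functor (injRel k A)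

variable {A}

/-- A representation by `Y` of the functor `D Ext¹(X, -)` on the injectively stable category. -/
structure RightRepr (X Y : A) where
  equiv (Z : A) : ((injQ k A).obj Z ⟶ (injQ k A).obj Y) ≃ₗ[k] Module.Dual k (Ext1 X Z)
  naturality {Z' Z : A} (f : Z' ⟶ Z) (h : (injQ k A).obj Z ⟶ (injQ k A).obj Y) :
    equiv Z' ((injQ k A).map f ≫ h) = (extPost k X f).dualMap (equiv Z h)

/-- A representation by `Y` of the functor `D Ext¹(-, X)` on the projectively stable category. -/
structure LeftRepr (X Y : A) where
  equiv (Z : A) : ((projQ k A).obj Y ⟶ (projQ k A).obj Z) ≃ₗ[k] Module.Dual k (Ext1 Z X)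
  naturality {Z Z' : A} (f : Z ⟶ Z') (h : (projQ k A).obj Y ⟶ (projQ k A).obj Z) :
    equiv Z' (h ≫ (projQ k A).map f) = (extPre k f X).dualMap (equiv Z h)

variable (A)

/-- The objects `X` such that `D Ext¹(X, -)` is representable. -/
def rightAR : ObjectProperty A := fun X => ∃ Y : A, Nonempty (RightRepr k X Y)

/-- The objects `X` such that `D Ext¹(-, X)` is representable. -/
def leftAR : ObjectProperty A := fun X => ∃ Y : A, Nonempty (LeftRepr k X Y)

/-- The image of the category of objects in `rightAR` in the projectively stable category. -/
abbrev RStable := ObjectProperty.FullSubcategory fun X : ProjStable k A => rightAR k A X.as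

/-- The image of the category of objects in `leftAR` in the injectively stable category. -/
abbrev LStable := ObjectProperty.FullSubcategory fun X : InjStable k A => leftAR k A X.as

variable {A}

/-- An object of `rightAR`, seen in the stable category. -/
abbrev RStable.of (X : A) (hX : rightAR k A X) : RStable k A := ⟨(projQ k A).obj X, hX⟩

/-- The class of a morphism between objects of `rightAR`. -/
abbrev RStable.map {X Y : A} (hX : rightAR k A X) (hY : rightAR k A Y) (f : X ⟶ Y) :
    RStable.of k X hX ⟶ RStable.of k Y hY := ObjectProperty.homMk ((projQ k A).map f)

/-- An object of `leftAR`, seen in the stable category. -/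
abbrev LStable.of (X : A) (hX : leftAR k A X) : LStable k A := ⟨(injQ k A).obj X, hX⟩

/-- The class of a morphism between objects of `leftAR`. -/
abbrev LStable.map {X Y : A} (hX : leftAR k A X) (hY : leftAR k A Y) (f : X ⟶ Y) :
    LStable.of k X hX ⟶ LStable.of k Y hY := ObjectProperty.homMk ((injQ k A).map f)

/-- Data exhibiting `τ` as the generalized Auslander-Reiten translation:
isomorphisms `Hom(X, τ Y) ≃ D Ext¹(Y, X)`, the left hand side being taken in the injectively
stable category, natural in `X` and in `Y`, for `Y` in `rightAR`. -/
structure TauIso (τ : RStable k A ⥤ LStable k A) where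
  equiv (X Y : A) (hY : rightAR k A Y) :
    ((injQ k A).obj X ⟶ (τ.obj (RStable.of k Y hY)).obj) ≃ₗ[k] Module.Dual k (Ext1 Y X)
  naturality_left {X' X : A} (f : X' ⟶ X) (Y : A) (hY : rightAR k A Y)
    (h : (injQ k A).obj X ⟶ (τ.obj (RStable.of k Y hY)).obj) :
    equiv X' Y hY ((injQ k A).map f ≫ h) = (extPost k Y f).dualMap (equiv X Y hY h)
  naturality_right (X : A) {Y Y' : A} (hY : rightAR k A Y) (hY' : rightAR k A Y') (g : Y ⟶ Y')
    (h : (injQ k A).obj X ⟶ (τ.obj (RStable.of k Y hY)).obj) :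
    equiv X Y' hY' (h ≫ (τ.map (RStable.map k hY hY' g)).hom) =
      (extPre k g X).dualMap (equiv X Y hY h)

/-- Data exhibiting `τ'` as the generalized inverse Auslander-Reiten translation:
isomorphisms `Hom(τ' X, Y) ≃ D Ext¹(Y, X)`, the left hand side being taken in the projectively
stable category, natural in `X` and in `Y`, for `X` in `leftAR`. -/
structure TauInvIso (τ' : LStable k A ⥤ RStable k A) where
  equiv (X : A) (hX : leftAR k A X) (Y : A) :
    ((τ'.obj (LStable.of k X hX)).obj ⟶ (projQ k A).obj Y) ≃ₗ[k] Module.Dual k (Ext1 Y X)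
  naturality_left {X X' : A} (hX : leftAR k A X) (hX' : leftAR k A X') (f : X ⟶ X') (Y : A)
    (h : (τ'.obj (LStable.of k X' hX')).obj ⟶ (projQ k A).obj Y) :
    equiv X hX Y ((τ'.map (LStable.map k hX hX' f)).hom ≫ h) =
      (extPost k Y f).dualMap (equiv X' hX' Y h)
  naturality_right (X : A) (hX : leftAR k A X) {Y Y' : A} (g : Y ⟶ Y')
    (h : (τ'.obj (LStable.of k X hX)).obj ⟶ (projQ k A).obj Y) :
    equiv X hX Y' (h ≫ (projQ k A).map g) = (extPre k g X).dualMap (equiv X hX Y h)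

end Abelian

/-! ### Additive closures, projective covers and minimal projective presentations -/

section Presentations

variable {A : Type v} [Category.{u} A] [Abelian A]

attribute [local instance] Abelian.hasFiniteBiproducts

/-- The objects that are direct summands of finite direct sums of objects of `S`. -/
def addClosure (S : ObjectProperty A) : ObjectProperty A := fun M =>
  ∃ (J : Type) (_ : Finite J) (X : J → A), (∀ j, S (X j)) ∧ Nonempty (Retract M (⨁ X))

theorem addClosure_zero (S : ObjectProperty A) {Z : A} (hZ : IsZero Z) : addClosure S Z :=
  ⟨Empty, inferInstance, fun j => j.elim, fun j => j.elim, ⟨0, 0, hZ.eq_of_src _ _⟩⟩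

theorem addClosure_biprod (S : ObjectProperty A) {P Q : A} (hP : addClosure S P)
    (hQ : addClosure S Q) : addClosure S (P ⊞ Q) := by
  obtain ⟨J, _, X, hX, ⟨r⟩⟩ := hP
  obtain ⟨K, _, Y, hY, ⟨s⟩⟩ := hQ
  refine ⟨J ⊕ K, inferInstance, Sum.elim X Y, Sum.rec hX hY,
    ⟨biproduct.lift (Sum.rec (fun j => biprod.fst ≫ r.i ≫ biproduct.π X j)
        (fun j => biprod.snd ≫ s.i ≫ biproduct.π Y j)),
      biproduct.desc (Sum.rec (fun j => biproduct.ι X j ≫ r.r ≫ biprod.inl)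
        (fun j => biproduct.ι Y j ≫ s.r ≫ biprod.inr)), ?_⟩⟩
  have := Fintype.ofFinite J
  have := Fintype.ofFinite K
  have h₁ : ∑ j, (biprod.fst (X := P) (Y := Q) ≫ r.i ≫ biproduct.π X j) ≫
      biproduct.ι X j ≫ r.r ≫ biprod.inl (Y := Q) = biprod.fst ≫ biprod.inl := by
    have : ∀ j, (biprod.fst (X := P) (Y := Q) ≫ r.i ≫ biproduct.π X j) ≫
        biproduct.ι X j ≫ r.r ≫ biprod.inl (Y := Q) =
        (biprod.fst ≫ r.i) ≫ (biproduct.π X j ≫ biproduct.ι X j) ≫ r.r ≫ biprod.inl := by simp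
    simp only [this, ← Preadditive.sum_comp, ← Preadditive.comp_sum]
    simp
  have h₂ : ∑ j, (biprod.snd (X := P) (Y := Q) ≫ s.i ≫ biproduct.π Y j) ≫
      biproduct.ι Y j ≫ s.r ≫ biprod.inr (X := P) = biprod.snd ≫ biprod.inr := by
    have : ∀ j, (biprod.snd (X := P) (Y := Q) ≫ s.i ≫ biproduct.π Y j) ≫
        biproduct.ι Y j ≫ s.r ≫ biprod.inr (X := P) =
        (biprod.snd ≫ s.i) ≫ (biproduct.π Y j ≫ biproduct.ι Y j) ≫ s.r ≫ biprod.inr := by simp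
    simp only [this, ← Preadditive.sum_comp, ← Preadditive.comp_sum]
    simp
  rw [biproduct.lift_desc, Fintype.sum_sum_type]
  exact (congrArg₂ (· + ·) h₁ h₂).trans biprod.total

/-- A morphism `f` is right minimal if every endomorphism `g` of its source with `f ∘ g = f`
is an isomorphism. -/
def RightMinimal {P M : A} (f : P ⟶ M) : Prop := ∀ g : P ⟶ P, g ≫ f = f → IsIso g

/-- A projective cover is a right minimal epimorphism from a projective object. -/
structure IsProjectiveCover {P M : A} (f : P ⟶ M) : Prop where
  projective : Projective P
  epi : Epi f
  minimal : RightMinimal f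

/-- A minimal projective presentation `P₁ ⟶ P₀ ⟶ M ⟶ 0`: the sequence is exact, and `P₀ ⟶ M`
and `P₁ ⟶ im f₁` are projective covers. -/
structure MinPres (M : A) where
  P₁ : A
  P₀ : A
  f₁ : P₁ ⟶ P₀
  f₀ : P₀ ⟶ M
  w : f₁ ≫ f₀ = 0
  exact : (ShortComplex.mk f₁ f₀ w).Exact
  cover₀ : IsProjectiveCover f₀
  cover₁ : IsProjectiveCover (Abelian.factorThruImage f₁)

/-- A morphism of presentations over `f`. -/
structure PresHom {M N : A} (p : MinPres M) (q : MinPres N) (f : M ⟶ N) where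
  g₁ : p.P₁ ⟶ q.P₁
  g₀ : p.P₀ ⟶ q.P₀
  comm₁ : g₁ ≫ q.f₁ = p.f₁ ≫ g₀
  comm₀ : g₀ ≫ q.f₀ = p.f₀ ≫ f

end Presentations

/-! ### Modules over a linear category -/

section Modules

attribute [local instance] Abelian.hasFiniteBiproducts
open ZeroObject

variable (k : Type u) [Field k] (C : Type u) [SmallCategory C] [Preadditive C] [Linear k C]

instance linearOpposite : Linear k Cᵒᵖ where
  homModule _ _ :=
    { smul := fun r f => (r • f.unop).op
      one_smul := fun f => Quiver.Hom.unop_inj (one_smul k f.unop)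
      mul_smul := fun r s f => Quiver.Hom.unop_inj (mul_smul r s f.unop)
      smul_zero := fun r => Quiver.Hom.unop_inj (smul_zero r)
      smul_add := fun r f g => Quiver.Hom.unop_inj (smul_add r f.unop g.unop)
      add_smul := fun r s f => Quiver.Hom.unop_inj (add_smul r s f.unop)
      zero_smul := fun f => Quiver.Hom.unop_inj (zero_smul k f.unop) }
  smul_comp _ _ _ r f g := Quiver.Hom.unop_inj (Linear.comp_smul _ _ _ g.unop r f.unop)
  comp_smul _ _ _ f r g := Quiver.Hom.unop_inj (Linear.smul_comp _ _ _ r g.unop f.unop)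

/-- The `k`-linear functors from `C` to `k`-vector spaces. -/
def isLinear : ObjectProperty (C ⥤ ModuleCat.{u} k) := fun F => F.Additive ∧ F.Linear k

/-- The category `Mod C` of `C`-modules: `k`-linear functors from `C` to `k`-vector spaces. -/
abbrev Mod := (isLinear k C).FullSubcategory

instance : (isLinear k C).IsClosedUnderSubobjects where
  prop_of_mono {F G} i _ hG := by
    have := hG.1
    have := hG.2
    refine ⟨⟨fun {_ _ f g} => ?_⟩, ⟨fun f r => ?_⟩⟩
    · rw [← cancel_mono (i.app _)]
      simp [Preadditive.add_comp]
    · rw [← cancel_mono (i.app _)]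
      simp

instance : (isLinear k C).IsClosedUnderQuotients where
  prop_of_epi {F G} p _ hF := by
    have := hF.1
    have := hF.2
    refine ⟨⟨fun {_ _ f g} => ?_⟩, ⟨fun f r => ?_⟩⟩
    · rw [← cancel_epi (p.app _)]
      simp [Preadditive.comp_add, ← NatTrans.naturality]
    · rw [← cancel_epi (p.app _)]
      simp [← NatTrans.naturality]

instance : (isLinear k C).IsClosedUnderFiniteProducts where
  isClosedUnderLimitsOfShape J _ :=
    { limitsOfShape_le := by
        rintro F ⟨p⟩
        have hj : ∀ {X Y : C} (a b : F.obj X ⟶ F.obj Y),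
            (∀ j, a ≫ (p.π.app j).app Y = b ≫ (p.π.app j).app Y) → a = b := fun {_ Y} a b h =>
          (isLimitOfPreserves ((evaluation C (ModuleCat.{u} k)).obj Y) p.isLimit).hom_ext h
        refine ⟨⟨hj _ _ fun j => ?_⟩, ⟨fun f r => hj _ _ fun j => ?_⟩⟩
        · have := (p.prop_diag_obj j).1
          simp [Preadditive.add_comp, Functor.map_add]
        · have := (p.prop_diag_obj j).2
          simp [Functor.map_smul] }

instance : (isLinear k C).ContainsZero where
  exists_zero := by
    obtain ⟨Z, hZ⟩ := HasZeroObject.zero (C := C ⥤ ModuleCat.{u} k)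
    have h := (Functor.isZero_iff Z).1 hZ
    exact ⟨Z, hZ, ⟨(h _).eq_of_src _ _⟩, ⟨fun _ _ => (h _).eq_of_src _ _⟩⟩

variable {k C}

/-- The identification of `Mod (Cᵒᵖᵒᵖ)` with `Mod C`. -/
def unopop : Mod k Cᵒᵖᵒᵖ ⥤ Mod k C :=
  (isLinear k C).lift ((isLinear k Cᵒᵖᵒᵖ).ι ⋙ (Functor.whiskeringLeft _ _ _).obj (opOp C))
    fun M => by
      have := M.property.1
      have := M.property.2
      exact ⟨⟨fun {_ _ f g} => M.obj.map_add (f := f.op.op) (g := g.op.op)⟩, ⟨fun f r => M.obj.map_smul r f.op.op⟩⟩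

variable (k C)

/-- The representable modules `C(a, -)`, as a contravariant functor of `a`. -/
def repMod : Cᵒᵖ ⥤ Mod k C :=
  (isLinear k C).lift (linearCoyoneda k C) fun a =>
    ⟨inferInstance, ⟨fun f r => by
      ext (x : unop a ⟶ _)
      exact Linear.comp_smul _ _ _ x r f⟩⟩

/-- The contravariant functor `D`: the module `D M` is given by `a ↦ Hom_k(M(a), k)`. -/
def dual : (Mod k C)ᵒᵖ ⥤ Mod k Cᵒᵖ where
  obj M :=
    { obj :=
        { obj := fun a => ModuleCat.of k (Module.Dual k (M.unop.obj.obj a.unop))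
          map := fun f => ModuleCat.ofHom (M.unop.obj.map f.unop).hom.dualMap
          map_id := fun a => by ext; simp
          map_comp := fun f g => by ext; simp }
      property := by
        have := M.unop.property.1
        have := M.unop.property.2
        refine ⟨⟨by intros; ext; simp⟩, ⟨fun f r => ?_⟩⟩
        have h : M.unop.obj.map (r • f).unop = r • M.unop.obj.map f.unop :=
          M.unop.obj.map_smul r f.unop
        ext
        simp [h] }
  map g := ObjectProperty.homMk
    { app := fun a => ModuleCat.ofHom (g.unop.hom.app a.unop).hom.dualMap
      naturality := fun a b f => by
        ext φ x
        exact congrArg φ (NatTrans.naturality_apply g.unop.hom f.unop x).symm }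
  map_id M := by ext; simp
  map_comp f g := by ext; simp

/-- The contravariant functor `(-)^*`: the module `M^*` is given by `a ↦ Hom(M, C(a, -))`. -/
def star : (Mod k C)ᵒᵖ ⥤ Mod k Cᵒᵖ :=
  (isLinear k Cᵒᵖ).lift
    (linearCoyoneda k (Mod k C) ⋙ (Functor.whiskeringLeft _ _ _).obj (repMod k C)) fun M =>
    ⟨⟨fun {_ _ f g} => by
      ext (x : unop M ⟶ _)
      have h : (repMod k C).map (f + g) = (repMod k C).map f + (repMod k C).map g := by
        ext b y
        exact Preadditive.add_comp _ _ _ f.unop g.unop y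
      exact (congrArg (x ≫ ·) h).trans (Preadditive.comp_add _ _ _ x _ _)⟩,
    ⟨fun {_ _} f r => by
      ext (x : unop M ⟶ _)
      have h : (repMod k C).map (r • f) = r • (repMod k C).map f := by
        ext b y
        exact Linear.smul_comp _ _ _ r f.unop y
      exact (congrArg (x ≫ ·) h).trans (Linear.comp_smul _ _ _ x r _)⟩⟩

/-- The finitely generated projective modules: direct summands of finite direct sums of
representable modules. -/
def proj : ObjectProperty (Mod k C) :=
  addClosure (ObjectProperty.ofObj fun a : C => (repMod k C).obj (op a))

/-- The finitely generated modules. -/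
def fg : ObjectProperty (Mod k C) := fun M => ∃ (P : Mod k C) (f : P ⟶ M), proj k C P ∧ Epi f

/-- The finitely presented modules. -/
def fp : ObjectProperty (Mod k C) := fun M =>
  ∃ (P : Mod k C) (f : P ⟶ M), proj k C P ∧ Epi f ∧ fg k C (kernel f)

/-- The finite dimensional modules. -/
def fd : ObjectProperty (Mod k C) := fun M =>
  {a : C | Nontrivial (M.obj.obj a)}.Finite ∧ ∀ a : C, Module.Finite k (M.obj.obj a)

/-- `Mod C` is locally Noetherian: submodules of finitely generated modules are finitely
generated. -/
class LocallyNoetherian : Prop where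
  fg_of_mono {N M : Mod k C} (i : N ⟶ M) [Mono i] (hM : fg k C M) : fg k C N

/-- The category `fp C` of finitely presented modules. -/
abbrev FP := (fp k C).FullSubcategory

variable {k C}

theorem fg_of_epi {M N : Mod k C} (p : M ⟶ N) [Epi p] (hM : fg k C M) : fg k C N := by
  obtain ⟨P, f, hP, _⟩ := hM
  exact ⟨P, f ≫ p, hP, inferInstance⟩

theorem fg_of_fp {M : Mod k C} (hM : fp k C M) : fg k C M := by
  obtain ⟨P, f, hP, hf, -⟩ := hM
  exact ⟨P, f, hP, hf⟩

theorem fp_of_fg [LocallyNoetherian k C] {M : Mod k C} (hM : fg k C M) : fp k C M := by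
  obtain ⟨P, f, hP, hf⟩ := hM
  exact ⟨P, f, hP, hf, LocallyNoetherian.fg_of_mono (kernel.ι f) ⟨P, 𝟙 P, hP, inferInstance⟩⟩

instance [LocallyNoetherian k C] : (fp k C).IsClosedUnderSubobjects where
  prop_of_mono i _ h := fp_of_fg (LocallyNoetherian.fg_of_mono i (fg_of_fp h))

instance [LocallyNoetherian k C] : (fp k C).IsClosedUnderQuotients where
  prop_of_epi p _ h := fp_of_fg (fg_of_epi p (fg_of_fp h))

instance [LocallyNoetherian k C] : (fp k C).ContainsZero where
  exists_zero := ⟨0, isZero_zero _, fp_of_fg ⟨0, 𝟙 0, addClosure_zero _ (isZero_zero _), inferInstance⟩⟩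

instance [LocallyNoetherian k C] : (fp k C).IsClosedUnderFiniteProducts := by
  have : (fp k C).IsClosedUnderBinaryProducts :=
    { limitsOfShape_le := by
        rintro M ⟨p⟩
        obtain ⟨P, f, hP, _⟩ := fg_of_fp (p.prop_diag_obj ⟨.left⟩)
        obtain ⟨Q, g, hQ, _⟩ := fg_of_fp (p.prop_diag_obj ⟨.right⟩)
        have e := biprod.isoProd _ _ ≪≫ (HasLimit.isoOfNatIso (diagramIsoPair p.diag)).symm ≪≫
          (limit.isLimit _).conePointUniqueUpToIso p.isLimit
        exact fp_of_fg ⟨P ⊞ Q, biprod.map f g ≫ e.hom, addClosure_biprod _ hP hQ, inferInstance⟩ }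
  exact ObjectProperty.IsClosedUnderFiniteProducts.mk'

/-! ### The transpose and the Auslander-Reiten translations -/

/-- The transpose of `M`, computed by a minimal projective presentation: the cokernel of
`f₁^* : P₀^* ⟶ P₁^*`. -/
def tr {M : Mod k C} (p : MinPres M) : Mod k Cᵒᵖ := cokernel ((star k C).map p.f₁.op)

/-- The action of the transpose on a morphism of presentations. -/
def trMap {M N : Mod k C} {p : MinPres M} {q : MinPres N} {f : M ⟶ N} (g : PresHom p q f) :
    tr q ⟶ tr p :=
  cokernel.map _ _ ((star k C).map g.g₀.op) ((star k C).map g.g₁.op) (by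
    rw [← Functor.map_comp, ← Functor.map_comp, ← op_comp, ← op_comp, g.comm₁])

/-- The module `D Tr M`. -/
def dTr {M : Mod k C} (p : MinPres M) : Mod k C :=
  unopop.obj ((dual k Cᵒᵖ).obj (op (tr p)))

/-- The action of `D Tr` on a morphism of presentations. -/
def dTrMap {M N : Mod k C} {p : MinPres M} {q : MinPres N} {f : M ⟶ N} (g : PresHom p q f) :
    dTr p ⟶ dTr q :=
  unopop.map ((dual k Cᵒᵖ).map (trMap g).op)

/-- The module `Tr D N`. -/
def trD {N : Mod k C} (p : MinPres ((dual k C).obj (op N))) : Mod k C := unopop.obj (tr p)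

/-- The action of `Tr D` on a morphism `f : N ⟶ N'`, given a lift of `D f` to presentations. -/
def trDMap {N N' : Mod k C} {p : MinPres ((dual k C).obj (op N))}
    {q : MinPres ((dual k C).obj (op N'))} {f : N ⟶ N'}
    (g : PresHom q p ((dual k C).map f.op)) : trD p ⟶ trD q :=
  unopop.map (trMap g)

variable (k C)

/-- The subcategory `(fp C)_r`. -/
def fpR [LocallyNoetherian k C] : ObjectProperty (Mod k C) := fun M =>
  ∃ h : fp k C M, rightAR k (FP k C) ⟨M, h⟩

/-- The subcategory `(fp C)_l`. -/
def fpL [LocallyNoetherian k C] : ObjectProperty (Mod k C) := fun M =>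
  ∃ h : fp k C M, leftAR k (FP k C) ⟨M, h⟩

/-- The injective objects of the category `fp C`. -/
def fpInj : ObjectProperty (Mod k C) := fun M => ∃ h : fp k C M, Injective (⟨M, h⟩ : FP k C)

variable {k C}

/-- `D Tr` induces the functor `τ`: every finitely presented module has a minimal projective
presentation, the modules `D Tr M` lie in `(fp C)_l`, and `τ M ≅ D Tr M` in the stable category,
compatibly with all morphisms `f : M ⟶ N` and all their lifts to presentations. -/
structure InducedByDTr [LocallyNoetherian k C]
    (τ : RStable k (FP k C) ⥤ LStable k (FP k C)) where
  exists_pres (M : FP k C) : Nonempty (MinPres M.obj)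
  fp_dTr (M : FP k C) (p : MinPres M.obj) : fp k C (dTr p)
  leftAR_dTr (M : FP k C) (p : MinPres M.obj) : leftAR k (FP k C) ⟨dTr p, fp_dTr M p⟩
  iso (M : FP k C) (hM : rightAR k (FP k C) M) (p : MinPres M.obj) :
    τ.obj (RStable.of k M hM) ≅ LStable.of k ⟨dTr p, fp_dTr M p⟩ (leftAR_dTr M p)
  naturality {M N : FP k C} (hM : rightAR k (FP k C) M) (hN : rightAR k (FP k C) N)
    (p : MinPres M.obj) (q : MinPres N.obj) (f : M ⟶ N) (g : PresHom p q f.hom) :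
    τ.map (RStable.map k hM hN f) ≫ (iso N hN q).hom =
      (iso M hM p).hom ≫
        LStable.map k (leftAR_dTr M p) (leftAR_dTr N q) (ObjectProperty.homMk (dTrMap g))

/-- `Tr D` induces the functor `τ'`: finite dimensional modules `N` lie in `(fp C)_l`, the modules
`D N` have minimal projective presentations, the modules `Tr D N` lie in `(fp C)_r`, and
`τ' N ≅ Tr D N` in the stable category, compatibly with all morphisms `f : N ⟶ N'` and all lifts
of `D f` to presentations. -/
structure InducedByTrD [LocallyNoetherian k C]
    (τ' : LStable k (FP k C) ⥤ RStable k (FP k C)) where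
  exists_pres (N : Mod k C) (hN : fd k C N) : Nonempty (MinPres ((dual k C).obj (op N)))
  fp_of_fd (N : Mod k C) (hN : fd k C N) : fp k C N
  leftAR_of_fd (N : Mod k C) (hN : fd k C N) : leftAR k (FP k C) ⟨N, fp_of_fd N hN⟩
  fp_trD (N : Mod k C) (hN : fd k C N) (p : MinPres ((dual k C).obj (op N))) : fp k C (trD p)
  rightAR_trD (N : Mod k C) (hN : fd k C N) (p : MinPres ((dual k C).obj (op N))) :
    rightAR k (FP k C) ⟨trD p, fp_trD N hN p⟩
  iso (N : Mod k C) (hN : fd k C N) (p : MinPres ((dual k C).obj (op N))) :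
    τ'.obj (LStable.of k ⟨N, fp_of_fd N hN⟩ (leftAR_of_fd N hN)) ≅
      RStable.of k ⟨trD p, fp_trD N hN p⟩ (rightAR_trD N hN p)
  naturality {N N' : Mod k C} (hN : fd k C N) (hN' : fd k C N')
    (p : MinPres ((dual k C).obj (op N))) (q : MinPres ((dual k C).obj (op N')))
    (f : N ⟶ N') (g : PresHom q p ((dual k C).map f.op)) :
    τ'.map (LStable.map k (leftAR_of_fd N hN) (leftAR_of_fd N' hN') (ObjectProperty.homMk f)) ≫
        (iso N' hN' q).hom =
      (iso N hN p).hom ≫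
        RStable.map k (rightAR_trD N hN p) (rightAR_trD N' hN' q)
          (ObjectProperty.homMk (trDMap g))

end Modules
end

end GenAR

namespace GenAR

noncomputable section

/-! ### Connecting maps and extensions in degree one -/

section AbstractExt

variable (k : Type u) [Field k] {A : Type v} [Category.{u} A] [Abelian A] [Linear k A]

/-! The argument splits into a formal part, valid in a Hom-finite `k`-linear abelian category with
enough projectives, and a computation with modules.

Formal part. By Yoneda, a representation of `D Ext¹(Y, -)` by `X` is the same as a linear form `γ`
on `Ext¹(Y, X)` such that `h ↦ γ ∘ Ext¹(Y, h)` induces bijections from stable morphisms to forms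
(`IsRightDual`); `IsLeftDual` is the analogue for `D Ext¹(-, X)`. When all `Ext¹` are finite
dimensional the two conditions agree (`IsRightDual.isLeftDual`, `IsLeftDual.isRightDual`), so one
form makes `X` represent `D Ext¹(Y, -)` and `Y` represent `D Ext¹(-, X)`. If every `Y` has such a
form on `Ext¹(Y, T Y)`, then stable morphisms `Y ⟶ Z` modulo projectives and `T Y ⟶ T Z` modulo
injectives are both `D Ext¹(Z, T Y)`. This yields the equivalence `τ` and its duality isomorphisms.
A pair `(f, w)` adjoint for two forms (`FormCompat`) determines `w` stably from `f` and conversely,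
so every compatibility statement reduces to checking adjointness.

Computation. For a presentation `P₁ ⟶ P₀ ⟶ M` by finitely generated projectives, let `Z` be the
cokernel of `P₀^* ⟶ P₁^*` and `N = D Z`. A trace form on `Hom(P₁, N)` exhibits `Hom(X, N)` as the
kernel of `D Hom(P₁, X) ⟶ D Hom(P₀, X)` (`isNakayama_traceForm`). It descends to a right dual form
on `Ext¹(M, N)`, which is the Auslander-Reiten formula (`IsNakayama.isRightDual`). The same
computation applies with `N = D Tr M`, and with `N` finite dimensional and `M = Tr D N`.

Type `A_∞` enters because only finitely many objects map to a given one. Hence `P^*` is finite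
dimensional, so `D Tr M` is finite dimensional and therefore finitely presented; and finitely
generated modules over the opposite category are finite dimensional, so `D N` has a minimal
presentation there without any Noetherian hypothesis on that side.

For `(fp C)_l`, an object represented by `Y` is isomorphic to `D Tr Y` modulo injectively trivial
morphisms; Fitting's lemma turns this into an honest summand of `D Tr Y` plus an injective.
Conversely, a summand of a finite dimensional module plus an injective is a stable retract of the
former, and representability passes to stable retracts (`leftAR_of_stable_retract`). -/

theorem extPre_extPost {X Y Z W : A} (f : X ⟶ Y) (g : Z ⟶ W) (e : Ext1 Y Z) :
    extPre k f W (extPost k Y g e) = extPost k X g (extPre k f Z e) := by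
  let : HasExt.{max u v} A := HasExt.standard A
  simp [extPre, extPost]

theorem extPre_id (X Z : A) : extPre k (𝟙 X) Z = LinearMap.id := by
  let : HasExt.{max u v} A := HasExt.standard A
  ext e
  simp [extPre]

theorem extPost_id (Z X : A) : extPost k Z (𝟙 X) = LinearMap.id := by
  let : HasExt.{max u v} A := HasExt.standard A
  ext e
  simp [extPost]

theorem extPre_comp_apply {X Y W : A} (f : X ⟶ Y) (g : Y ⟶ W) (Z : A) (e : Ext1 W Z) :
    extPre k (f ≫ g) Z e = extPre k f Z (extPre k g Z e) := by
  rw [extPre_comp]; rfl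

theorem extPost_comp_apply (Z : A) {X Y W : A} (f : X ⟶ Y) (g : Y ⟶ W) (e : Ext1 Z X) :
    extPost k Z (f ≫ g) e = extPost k Z g (extPost k Z f e) := by
  rw [extPost_comp]; rfl

theorem extPre_sub {X Y : A} (f g : X ⟶ Y) (Z : A) :
    extPre k (f - g) Z = extPre k f Z - extPre k g Z := by
  rw [eq_sub_iff_add_eq, ← extPre_add, sub_add_cancel]

theorem extPost_sub (Z : A) {X Y : A} (f g : X ⟶ Y) :
    extPost k Z (f - g) = extPost k Z f - extPost k Z g := by
  rw [eq_sub_iff_add_eq, ← extPost_add, sub_add_cancel]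

/-- The connecting map `Hom(S.X₁, X) → Ext¹(S.X₃, X)` of a short exact sequence. -/
def conn {S : ShortComplex A} (hS : S.ShortExact) (X : A) : (S.X₁ ⟶ X) →ₗ[k] Ext1 S.X₃ X :=
  letI : HasExt.{max u v} A := HasExt.standard A
  (Abelian.Ext.bilinearCompOfLinear k S.X₃ S.X₁ X 1 0 1 (add_zero 1) hS.extClass) ∘ₗ
    (Abelian.Ext.linearEquiv₀ (R := k)).symm.toLinearMap

variable {k}

theorem conn_comp {S : ShortComplex A} (hS : S.ShortExact) {X Y : A} (f : S.X₁ ⟶ X) (g : X ⟶ Y) :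
    conn k hS Y (f ≫ g) = extPost k S.X₃ g (conn k hS X f) := by
  let : HasExt.{max u v} A := HasExt.standard A
  change hS.extClass.comp (Abelian.Ext.mk₀ (f ≫ g)) (add_zero 1) =
    (hS.extClass.comp (Abelian.Ext.mk₀ f) (add_zero 1)).comp (Abelian.Ext.mk₀ g) (add_zero 1)
  rw [← Abelian.Ext.mk₀_comp_mk₀, Abelian.Ext.comp_assoc_of_third_deg_zero]

theorem conn_naturality {S S' : ShortComplex A} (hS : S.ShortExact) (hS' : S'.ShortExact)
    (φ : S ⟶ S') {X : A} (f : S'.X₁ ⟶ X) :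
    extPre k φ.τ₃ X (conn k hS' X f) = conn k hS X (φ.τ₁ ≫ f) := by
  let : HasExt.{max u v} A := HasExt.standard A
  change (Abelian.Ext.mk₀ φ.τ₃).comp (hS'.extClass.comp (Abelian.Ext.mk₀ f) (add_zero 1))
    (zero_add 1) = hS.extClass.comp (Abelian.Ext.mk₀ (φ.τ₁ ≫ f)) (add_zero 1)
  rw [← Abelian.Ext.mk₀_comp_mk₀, ← Abelian.Ext.comp_assoc_of_third_deg_zero,
    ← Abelian.Ext.comp_assoc_of_third_deg_zero, ← ShortComplex.ShortExact.extClass_naturality]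

variable (k) in
theorem exists_of_conn_eq_zero {S : ShortComplex A} (hS : S.ShortExact) {X : A} {f : S.X₁ ⟶ X}
    (hf : conn k hS X f = 0) : ∃ g : S.X₂ ⟶ X, S.f ≫ g = f := by
  let : HasExt.{max u v} A := HasExt.standard A
  obtain ⟨g, hg⟩ := Abelian.Ext.contravariant_sequence_exact₁ hS X (Abelian.Ext.mk₀ f)
    (add_zero 1) hf
  obtain ⟨g, rfl⟩ := Abelian.Ext.homEquiv₀.symm.surjective g
  refine ⟨g, ?_⟩
  have : Abelian.Ext.mk₀ (S.f ≫ g) = Abelian.Ext.mk₀ f := by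
    rw [← hg]; exact (Abelian.Ext.mk₀_comp_mk₀ _ _).symm
  exact Abelian.Ext.homEquiv₀.symm.injective this

variable (k) in
theorem conn_f_comp {S : ShortComplex A} (hS : S.ShortExact) {X : A} (g : S.X₂ ⟶ X) :
    conn k hS X (S.f ≫ g) = 0 := by
  let : HasExt.{max u v} A := HasExt.standard A
  change hS.extClass.comp (Abelian.Ext.mk₀ (S.f ≫ g)) (add_zero 1) = 0
  rw [← Abelian.Ext.mk₀_comp_mk₀]
  exact hS.extClass_comp_assoc _

variable (k) in
theorem exists_conn_of_extPre_eq_zero {S : ShortComplex A} (hS : S.ShortExact) {X : A}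
    {ξ : Ext1 S.X₃ X} (h : extPre k S.g X ξ = 0) : ∃ f, conn k hS X f = ξ := by
  let : HasExt.{max u v} A := HasExt.standard A
  obtain ⟨g, hg⟩ := Abelian.Ext.contravariant_sequence_exact₃ hS X ξ h (add_zero 1)
  obtain ⟨g, rfl⟩ := Abelian.Ext.homEquiv₀.symm.surjective g
  exact ⟨g, hg⟩

theorem ext1_eq_zero_of_projective {P : A} [Projective P] {X : A} (ξ : Ext1 P X) : ξ = 0 := by
  let : HasExt.{max u v} A := HasExt.standard A
  exact Abelian.Ext.eq_zero_of_projective ξ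

theorem ext1_eq_zero_of_injective {I : A} [Injective I] {X : A} (ξ : Ext1 X I) : ξ = 0 := by
  let : HasExt.{max u v} A := HasExt.standard A
  exact Abelian.Ext.eq_zero_of_injective ξ

variable (k) in
theorem conn_surjective {S : ShortComplex A} (hS : S.ShortExact) [Projective S.X₂] {X : A} :
    Function.Surjective (conn k hS X) := fun _ =>
  exists_conn_of_extPre_eq_zero k hS (ext1_eq_zero_of_projective _)

variable (k) in
theorem conn_id_extPost {S : ShortComplex A} (hS : S.ShortExact) {X : A} (f : S.X₁ ⟶ X) :
    extPost k S.X₃ f (conn k hS S.X₁ (𝟙 _)) = conn k hS X f := by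
  rw [← conn_comp, Category.id_comp]

variable (k) in
theorem extPost_conn {S : ShortComplex A} (hS : S.ShortExact) :
    extPost k S.X₃ S.f (conn k hS S.X₁ (𝟙 _)) = 0 := by
  have := conn_f_comp k hS (𝟙 S.X₂)
  rwa [Category.comp_id, ← conn_id_extPost k hS] at this

variable (k) in
theorem extPre_conn {S : ShortComplex A} (hS : S.ShortExact) :
    extPre k S.g S.X₁ (conn k hS S.X₁ (𝟙 _)) = 0 := by
  let : HasExt.{max u v} A := HasExt.standard A
  change (Abelian.Ext.mk₀ S.g).comp (hS.extClass.comp (Abelian.Ext.mk₀ _) (add_zero 1)) (zero_add 1) = 0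
  simp

/-- Exactness of the covariant long exact sequence at `Ext¹(M, S.X₁)`, with the connecting map
written as pullback of the class of `S`, here `conn` of the identity. -/
theorem exists_of_extPost_eq_zero {S : ShortComplex A} (hS : S.ShortExact) {M : A}
    {η : Ext1 M S.X₁} (h : extPost k M S.f η = 0) :
    ∃ f : M ⟶ S.X₃, extPre k f S.X₁ (conn k hS S.X₁ (𝟙 _)) = η := by
  let : HasExt.{max u v} A := HasExt.standard A
  obtain ⟨g, hg⟩ := Abelian.Ext.covariant_sequence_exact₁ M hS η h (zero_add 1)
  obtain ⟨g, rfl⟩ := Abelian.Ext.homEquiv₀.symm.surjective g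
  refine ⟨g, hg ▸ ?_⟩
  change (Abelian.Ext.mk₀ g).comp (hS.extClass.comp (Abelian.Ext.mk₀ _) (add_zero 1)) (zero_add 1) =
    (Abelian.Ext.mk₀ g).comp hS.extClass (zero_add 1)
  simp

variable (k) in
/-- Every class in `Ext¹(Z, X)` comes from a short exact sequence. -/
theorem exists_extension [EnoughProjectives A] {Z X : A} (ξ : Ext1 Z X) :
    ∃ (E : A) (i : X ⟶ E) (p : E ⟶ Z) (w : i ≫ p = 0) (hS : (ShortComplex.mk i p w).ShortExact),
      conn k hS X (𝟙 X) = ξ := by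
  let P := Projective.over Z
  let π : P ⟶ Z := Projective.π Z
  let S : ShortComplex A := ShortComplex.mk (kernel.ι π) π (kernel.condition π)
  have hS : S.ShortExact :=
    { exact := ShortComplex.exact_of_f_is_kernel _ (kernelIsKernel π)
      mono_f := by dsimp [S]; infer_instance
      epi_g := by dsimp [S]; infer_instance }
  have : Projective S.X₂ := inferInstanceAs (Projective (Projective.over Z))
  -- The class is represented by a morphism `c` from the first syzygy of `Z`; the required extension
  -- is the pushout of the projective presentation along `c`.
  obtain ⟨c, hc⟩ := conn_surjective k hS ξ
  let c : kernel π ⟶ X := c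
  let p : pushout (kernel.ι π) c ⟶ Z := pushout.desc π 0 (by simp)
  have w : pushout.inr (kernel.ι π) c ≫ p = 0 := pushout.inr_desc _ _ _
  have hp : pushout.inl (kernel.ι π) c ≫ p = π := pushout.inl_desc _ _ _
  have hpe : Epi p := by
    have : Epi (pushout.inl (kernel.ι π) c ≫ p) := by rw [hp]; infer_instance
    exact epi_of_epi (pushout.inl (kernel.ι π) c) p
  have hS' : (ShortComplex.mk _ p w).ShortExact :=
    { exact := ShortComplex.exact_of_g_is_cokernel _ (CokernelCofork.IsColimit.ofπ' p w
        fun {T} t ht => by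
          have h1 : kernel.ι π ≫ pushout.inl (kernel.ι π) c ≫ t = 0 := by
            rw [pushout.condition_assoc, ht, comp_zero]
          refine ⟨hS.exact.desc (pushout.inl _ _ ≫ t) h1, ?_⟩
          apply pushout.hom_ext
          · rw [reassoc_of% hp]
            exact hS.exact.g_desc _ h1
          · rw [reassoc_of% w, zero_comp]; exact ht.symm)
      mono_f := by dsimp; infer_instance
      epi_g := hpe }
  refine ⟨_, _, p, w, hS', ?_⟩
  let φ : S ⟶ ShortComplex.mk _ p w :=
    { τ₁ := c, τ₂ := pushout.inl _ _, τ₃ := 𝟙 _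
      comm₁₂ := pushout.condition.symm
      comm₂₃ := by simp [hp, S] }
  have := conn_naturality (k := k) hS hS' φ (𝟙 X)
  rw [show φ.τ₃ = 𝟙 _ from rfl, extPre_id] at this
  rw [← hc]
  refine this.trans ?_
  congr 1
  exact Category.comp_id c

/-- The obstruction to extending a morphism along a monomorphism `f` lies in `Ext¹(cokernel f, X)`.
-/
theorem injective_of_ext1 {X : A} (h : ∀ (Z : A) (ξ : Ext1 Z X), ξ = 0) : Injective X where
  factors {B D} g f _ := by
    let S : ShortComplex A := ShortComplex.mk f (cokernel.π f) (cokernel.condition f)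
    have hS : S.ShortExact :=
      { exact := ShortComplex.exact_of_g_is_cokernel _ (cokernelIsCokernel f)
        mono_f := by dsimp [S]; infer_instance
        epi_g := by dsimp [S]; infer_instance }
    let : HasExt.{max u v} A := HasExt.standard A
    obtain ⟨q, hq⟩ := Abelian.Ext.contravariant_sequence_exact₁ hS X (Abelian.Ext.mk₀ g)
      (add_zero 1) (h _ _)
    obtain ⟨q, rfl⟩ := Abelian.Ext.homEquiv₀.symm.surjective q
    refine ⟨q, Abelian.Ext.homEquiv₀.symm.injective ?_⟩
    exact (Abelian.Ext.mk₀_comp_mk₀ _ _).symm.trans hq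

end AbstractExt

/-! ### Perfect forms on `Ext¹` and representability -/

section Duality

variable {k : Type u} [Field k] {A : Type v} [Category.{u} A] [Abelian A] [Linear k A]

/-- The form `γ` on `Ext¹(Y, X)` exhibits `X` as a representing object of `D Ext¹(Y, -)`. -/
def IsRightDual {X Y : A} (γ : Module.Dual k (Ext1 Y X)) : Prop :=
  ∀ W : A, (∀ h : W ⟶ X, γ ∘ₗ extPost k Y h = 0 → h ∈ injTrivial k W X) ∧
    ∀ φ : Module.Dual k (Ext1 Y W), ∃ h : W ⟶ X, γ ∘ₗ extPost k Y h = φ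

/-- The form `γ` on `Ext¹(Y, X)` exhibits `Y` as a representing object of `D Ext¹(-, X)`. -/
def IsLeftDual {X Y : A} (γ : Module.Dual k (Ext1 Y X)) : Prop :=
  ∀ Z : A, (∀ f : Y ⟶ Z, γ ∘ₗ extPre k f X = 0 → f ∈ projTrivial k Y Z) ∧
    ∀ φ : Module.Dual k (Ext1 Z X), ∃ f : Y ⟶ Z, γ ∘ₗ extPre k f X = φ

/-- Over a field the range of the transpose is the annihilator of the kernel. This is the device by
which forms are descended to quotients and extended from subspaces below. -/
theorem exists_dual_comp_eq {V W : Type*} [AddCommGroup V] [Module k V] [AddCommGroup W]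
    [Module k W] (f : V →ₗ[k] W) (φ : Module.Dual k V)
    (h : ∀ x, f x = 0 → φ x = 0) : ∃ ψ : Module.Dual k W, ψ ∘ₗ f = φ := by
  have hφ : φ ∈ LinearMap.range f.dualMap := by
    rw [LinearMap.range_dualMap_eq_dualAnnihilator_ker]
    exact (Submodule.mem_dualAnnihilator φ).2 h
  exact hφ

/-- A linear family of forms on a finite dimensional space that separates points is everything. -/
theorem exists_eq_of_separates {V H : Type*} [AddCommGroup V] [Module k V] [Module.Finite k V]
    [AddCommGroup H] [Module k H] (L : H →ₗ[k] Module.Dual k V)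
    (h : ∀ v, (∀ x, L x v = 0) → v = 0) : Function.Surjective L := by
  have h0 : (LinearMap.range L).dualCoannihilator = ⊥ := by
    refine (Submodule.eq_bot_iff _).2 fun v hv => h v fun x => ?_
    exact (Submodule.mem_dualCoannihilator v).1 hv _ ⟨x, rfl⟩
  rw [← LinearMap.range_eq_top, ← Subspace.dualCoannihilator_dualAnnihilator_eq
    (W := LinearMap.range L), h0, Submodule.dualAnnihilator_bot]

/-- Linear forms separate points, and every form on `Ext¹(Y, W)` comes from some `g : W ⟶ X`. -/
theorem IsRightDual.ext1_eq_zero {X Y : A} {γ : Module.Dual k (Ext1 Y X)} (hγ : IsRightDual γ)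
    {W : A} {η : Ext1 Y W} (h : ∀ g : W ⟶ X, γ (extPost k Y g η) = 0) : η = 0 := by
  rw [← Module.forall_dual_apply_eq_zero_iff k]
  intro φ
  obtain ⟨g, rfl⟩ := (hγ W).2 φ
  exact h g

theorem IsLeftDual.ext1_eq_zero {X Y : A} {γ : Module.Dual k (Ext1 Y X)} (hγ : IsLeftDual γ)
    {Z : A} {η : Ext1 Z X} (h : ∀ g : Y ⟶ Z, γ (extPre k g X η) = 0) : η = 0 := by
  rw [← Module.forall_dual_apply_eq_zero_iff k]
  intro φ
  obtain ⟨g, rfl⟩ := (hγ Z).2 φ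
  exact h g

/-- The linear map `Hom(W, X) → D Ext¹(Y, W)` induced by a form on `Ext¹(Y, X)`. -/
def rightMap {X Y : A} (γ : Module.Dual k (Ext1 Y X)) (W : A) :
    (W ⟶ X) →ₗ[k] Module.Dual k (Ext1 Y W) where
  toFun h := γ ∘ₗ extPost k Y h
  map_add' f g := by rw [extPost_add, LinearMap.comp_add]
  map_smul' c f := by rw [extPost_smul, LinearMap.comp_smul]; rfl

/-- The linear map `Hom(Y, Z) → D Ext¹(Z, X)` induced by a form on `Ext¹(Y, X)`. -/
def leftMap {X Y : A} (γ : Module.Dual k (Ext1 Y X)) (Z : A) :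
    (Y ⟶ Z) →ₗ[k] Module.Dual k (Ext1 Z X) where
  toFun f := γ ∘ₗ extPre k f X
  map_add' f g := by rw [extPre_add, LinearMap.comp_add]
  map_smul' c f := by rw [extPre_smul, LinearMap.comp_smul]; rfl

/-- Injectivity holds because `Ext¹(f, -)` and `Ext¹(-, g)` commute and `γ` detects classes. For
surjectivity, finite dimensionality reduces the claim to showing that a class `ξ` in `Ext¹(Z, X)` is
zero if `γ` kills all its pullbacks along `Y ⟶ Z`. -/
theorem IsRightDual.isLeftDual [EnoughProjectives A]
    (hfin : ∀ X Y : A, Module.Finite k (Ext1 X Y)) {X Y : A} {γ : Module.Dual k (Ext1 Y X)}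
    (hγ : IsRightDual γ) : IsLeftDual γ := fun Z => by
  refine ⟨fun f hf W => LinearMap.ext fun η => hγ.ext1_eq_zero fun g => ?_, ?_⟩
  · rw [← extPre_extPost]
    exact LinearMap.congr_fun hf _
  · refine exists_eq_of_separates (leftMap γ Z) fun ξ hξ => ?_
    obtain ⟨E, i, p, w, hS, rfl⟩ := exists_extension k ξ
    -- The kernel of `Ext¹(Y, i)` consists of the pullbacks of `ξ`, so `γ` factors through `Ext¹(Y,
    -- i)`. The resulting form is given by some `r : E ⟶ X`, which splits `i` up to an injectively
    -- trivial morphism; as `Ext¹(Z, i)` kills `ξ`, this forces `ξ = 0`.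
    obtain ⟨ψ, hψ⟩ := exists_dual_comp_eq (extPost k Y i) γ fun η hη => by
      obtain ⟨f, rfl⟩ := exists_of_extPost_eq_zero hS hη
      exact hξ f
    obtain ⟨r, rfl⟩ := (hγ E).2 ψ
    have hr : 𝟙 X - i ≫ r ∈ injTrivial k X X := (hγ X).1 _ (by
      rw [extPost_sub, LinearMap.comp_sub, extPost_comp, ← LinearMap.comp_assoc, hψ, extPost_id,
        LinearMap.comp_id, sub_self])
    have := LinearMap.congr_fun (hr Z) (conn k hS X (𝟙 X))
    rw [extPost_sub, extPost_id, LinearMap.sub_apply, extPost_comp_apply] at this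
    have h0 := extPost_conn k hS
    dsimp at h0 this
    rw [h0, map_zero, sub_zero] at this
    exact this

/-- The dual argument: if `γ` kills all pushouts of an extension along `W ⟶ X`, then it factors
through `Ext¹(p, X)`, and `p` is split up to a projectively trivial morphism. -/
theorem IsLeftDual.isRightDual [EnoughProjectives A]
    (hfin : ∀ X Y : A, Module.Finite k (Ext1 X Y)) {X Y : A} {γ : Module.Dual k (Ext1 Y X)}
    (hγ : IsLeftDual γ) : IsRightDual γ := fun W => by
  refine ⟨fun h hh Z => LinearMap.ext fun η => hγ.ext1_eq_zero fun g => ?_, ?_⟩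
  · rw [extPre_extPost]
    exact LinearMap.congr_fun hh _
  · refine exists_eq_of_separates (rightMap γ W) fun ξ hξ => ?_
    obtain ⟨E, i, p, w, hS, rfl⟩ := exists_extension k ξ
    obtain ⟨ψ, hψ⟩ := exists_dual_comp_eq (extPre k p X) γ fun η hη => by
      obtain ⟨f, rfl⟩ := exists_conn_of_extPre_eq_zero k hS hη
      rw [← conn_id_extPost]
      exact hξ f
    obtain ⟨r, rfl⟩ := (hγ E).2 ψ
    have hr : 𝟙 Y - r ≫ p ∈ projTrivial k Y Y := (hγ Y).1 _ (by
      rw [extPre_sub, LinearMap.comp_sub, extPre_comp, ← LinearMap.comp_assoc, hψ, extPre_id,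
        LinearMap.comp_id, sub_self])
    have := LinearMap.congr_fun (hr W) (conn k hS W (𝟙 W))
    rw [extPre_sub, extPre_id, LinearMap.sub_apply, extPre_comp_apply] at this
    have h0 := extPre_conn k hS
    dsimp at h0 this
    rw [h0, map_zero, sub_zero] at this
    exact this

/-- The linear equivalence given by a right dual form. -/
def IsRightDual.equiv {X Y : A} {γ : Module.Dual k (Ext1 Y X)} (hγ : IsRightDual γ) (W : A) :
    ((injQ k A).obj W ⟶ (injQ k A).obj X) ≃ₗ[k] Module.Dual k (Ext1 Y W) :=
  have key : ∀ f g : W ⟶ X, (injQ k A).map f = (injQ k A).map g ↔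
      rightMap γ W f = rightMap γ W g := fun f g => by
    rw [Quotient.functor_map_eq_iff, ← sub_eq_zero (a := rightMap γ W f), ← map_sub]
    refine ⟨fun h => ?_, (hγ W).1 _⟩
    change γ ∘ₗ extPost k Y (f - g) = 0
    rw [h Y, LinearMap.comp_zero]
  LinearEquiv.ofBijective
    { toFun := fun q => rightMap γ W ((injQ k A).preimage q)
      map_add' := fun p q => by
        rw [← map_add, ← key]
        simp [Functor.map_add]
      map_smul' := fun c q => by
        rw [RingHom.id_apply, ← map_smul, ← key]
        simp [Functor.map_smul] }
    ⟨fun p q h => by simpa using (key _ _).2 h, fun φ => by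
      obtain ⟨h, rfl⟩ := (hγ W).2 φ
      exact ⟨(injQ k A).map h, (key _ _).1 (by simp)⟩⟩

theorem IsRightDual.equiv_map {X Y : A} {γ : Module.Dual k (Ext1 Y X)} (hγ : IsRightDual γ)
    {W : A} (h : W ⟶ X) : hγ.equiv W ((injQ k A).map h) = γ ∘ₗ extPost k Y h := by
  have h1 : (injQ k A).map ((injQ k A).preimage ((injQ k A).map h)) = (injQ k A).map h := by simp
  rw [Quotient.functor_map_eq_iff] at h1
  have h2 : γ ∘ₗ extPost k Y (_ - h) = γ ∘ₗ 0 := congrArg (γ ∘ₗ ·) (h1 Y)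
  rw [extPost_sub, LinearMap.comp_zero, LinearMap.comp_sub, sub_eq_zero] at h2
  exact h2

/-- The linear equivalence given by a left dual form. -/
def IsLeftDual.equiv {X Y : A} {γ : Module.Dual k (Ext1 Y X)} (hγ : IsLeftDual γ) (Z : A) :
    ((projQ k A).obj Y ⟶ (projQ k A).obj Z) ≃ₗ[k] Module.Dual k (Ext1 Z X) :=
  have key : ∀ f g : Y ⟶ Z, (projQ k A).map f = (projQ k A).map g ↔
      leftMap γ Z f = leftMap γ Z g := fun f g => by
    rw [Quotient.functor_map_eq_iff, ← sub_eq_zero (a := leftMap γ Z f), ← map_sub]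
    refine ⟨fun h => ?_, (hγ Z).1 _⟩
    change γ ∘ₗ extPre k (f - g) X = 0
    rw [h X, LinearMap.comp_zero]
  LinearEquiv.ofBijective
    { toFun := fun q => leftMap γ Z ((projQ k A).preimage q)
      map_add' := fun p q => by
        rw [← map_add, ← key]
        simp [Functor.map_add]
      map_smul' := fun c q => by
        rw [RingHom.id_apply, ← map_smul, ← key]
        simp [Functor.map_smul] }
    ⟨fun p q h => by simpa using (key _ _).2 h, fun φ => by
      obtain ⟨h, rfl⟩ := (hγ Z).2 φ
      exact ⟨(projQ k A).map h, (key _ _).1 (by simp)⟩⟩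

theorem IsLeftDual.equiv_map {X Y : A} {γ : Module.Dual k (Ext1 Y X)} (hγ : IsLeftDual γ)
    {Z : A} (f : Y ⟶ Z) : hγ.equiv Z ((projQ k A).map f) = γ ∘ₗ extPre k f X := by
  have h1 : (projQ k A).map ((projQ k A).preimage ((projQ k A).map f)) = (projQ k A).map f := by
    simp
  rw [Quotient.functor_map_eq_iff] at h1
  have h2 : γ ∘ₗ extPre k (_ - f) X = γ ∘ₗ 0 := congrArg (γ ∘ₗ ·) (h1 X)
  rw [extPre_sub, LinearMap.comp_zero, LinearMap.comp_sub, sub_eq_zero] at h2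
  exact h2

/-- Yoneda's lemma: the form is the image of the identity of `X` under the representation. -/
theorem exists_isRightDual_iff {X Y : A} :
    Nonempty (RightRepr k Y X) ↔ ∃ γ : Module.Dual k (Ext1 Y X), IsRightDual γ := by
  constructor
  · rintro ⟨r⟩
    have h : ∀ {W : A} (f : W ⟶ X), r.equiv W ((injQ k A).map f) =
        r.equiv X (𝟙 _) ∘ₗ extPost k Y f := fun f => by
      have := r.naturality f (𝟙 _)
      rwa [Category.comp_id] at this
    refine ⟨r.equiv X (𝟙 _), fun W => ⟨fun f hf => ?_, fun φ => ?_⟩⟩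
    · rw [← h, LinearEquiv.map_eq_zero_iff, ← Functor.map_zero, Quotient.functor_map_eq_iff] at hf
      simpa [injRel] using hf
    · obtain ⟨q, rfl⟩ := (r.equiv W).surjective φ
      obtain ⟨f, rfl⟩ := (injQ k A).map_surjective q
      exact ⟨f, (h f).symm⟩
  · rintro ⟨γ, hγ⟩
    refine ⟨⟨hγ.equiv, fun {W' W} f q => ?_⟩⟩
    obtain ⟨h, rfl⟩ := (injQ k A).map_surjective q
    rw [← Functor.map_comp, hγ.equiv_map, hγ.equiv_map, extPost_comp]
    rfl

theorem exists_isLeftDual_iff {X Y : A} :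
    Nonempty (LeftRepr k X Y) ↔ ∃ γ : Module.Dual k (Ext1 Y X), IsLeftDual γ := by
  constructor
  · rintro ⟨r⟩
    have h : ∀ {Z : A} (f : Y ⟶ Z), r.equiv Z ((projQ k A).map f) =
        r.equiv Y (𝟙 _) ∘ₗ extPre k f X := fun f => by
      have := r.naturality f (𝟙 _)
      rwa [Category.id_comp] at this
    refine ⟨r.equiv Y (𝟙 _), fun W => ⟨fun f hf => ?_, fun φ => ?_⟩⟩
    · rw [← h, LinearEquiv.map_eq_zero_iff, ← Functor.map_zero, Quotient.functor_map_eq_iff] at hf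
      simpa [projRel] using hf
    · obtain ⟨q, rfl⟩ := (r.equiv W).surjective φ
      obtain ⟨f, rfl⟩ := (projQ k A).map_surjective q
      exact ⟨f, (h f).symm⟩
  · rintro ⟨γ, hγ⟩
    refine ⟨⟨hγ.equiv, fun {W' W} f q => ?_⟩⟩
    obtain ⟨h, rfl⟩ := (projQ k A).map_surjective q
    rw [← Functor.map_comp, hγ.equiv_map, hγ.equiv_map, extPre_comp]
    rfl

theorem IsRightDual.rightAR {X Y : A} {γ : Module.Dual k (Ext1 Y X)} (hγ : IsRightDual γ) :
    rightAR k A Y := ⟨X, exists_isRightDual_iff.2 ⟨γ, hγ⟩⟩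

theorem IsLeftDual.leftAR {X Y : A} {γ : Module.Dual k (Ext1 Y X)} (hγ : IsLeftDual γ) :
    leftAR k A X := ⟨Y, exists_isLeftDual_iff.2 ⟨γ, hγ⟩⟩

end Duality

/-! ### The translation functor attached to a family of perfect forms -/

section Translation

variable {k : Type u} [Field k] {A : Type v} [Category.{u} A] [Abelian A] [Linear k A]

/-- The morphisms `f` and `w` are adjoint with respect to the forms `γ` and `γ'`. -/
def FormCompat {X Y X' Y' : A} (γ : Module.Dual k (Ext1 Y X)) (γ' : Module.Dual k (Ext1 Y' X'))
    (f : Y ⟶ Y') (w : X ⟶ X') : Prop :=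
  γ ∘ₗ extPre k f X = γ' ∘ₗ extPost k Y' w

theorem FormCompat.id {X Y : A} (γ : Module.Dual k (Ext1 Y X)) : FormCompat γ γ (𝟙 Y) (𝟙 X) := by
  rw [FormCompat, extPre_id, extPost_id]

theorem FormCompat.comp {X Y X' Y' X'' Y'' : A} {γ : Module.Dual k (Ext1 Y X)}
    {γ' : Module.Dual k (Ext1 Y' X')} {γ'' : Module.Dual k (Ext1 Y'' X'')}
    {f : Y ⟶ Y'} {w : X ⟶ X'} {f' : Y' ⟶ Y''} {w' : X' ⟶ X''}
    (h : FormCompat γ γ' f w) (h' : FormCompat γ' γ'' f' w') :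
    FormCompat γ γ'' (f ≫ f') (w ≫ w') := by
  refine LinearMap.ext fun ξ => ?_
  have h1 := LinearMap.congr_fun h (extPre k f' X ξ)
  have h2 := LinearMap.congr_fun h' (extPost k Y'' w ξ)
  simp only [LinearMap.comp_apply, extPre_comp_apply, extPost_comp_apply] at h1 h2 ⊢
  rw [h1, ← extPre_extPost, h2]

/-- Surjectivity of the duality map gives adjoints; its injectivity makes them unique in the stable
category (`FormCompat.injQ_map_eq`). Functoriality and naturality of `τ` are deduced from these two
facts. -/
theorem IsRightDual.exists_compat {X Y X' Y' : A} (γ : Module.Dual k (Ext1 Y X))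
    {γ' : Module.Dual k (Ext1 Y' X')} (hγ' : IsRightDual γ') (f : Y ⟶ Y') :
    ∃ w : X ⟶ X', FormCompat γ γ' f w := by
  obtain ⟨w, hw⟩ := (hγ' X).2 (γ ∘ₗ extPre k f X)
  exact ⟨w, hw.symm⟩

theorem IsLeftDual.exists_compat {X Y X' Y' : A} {γ : Module.Dual k (Ext1 Y X)}
    (γ' : Module.Dual k (Ext1 Y' X')) (hγ : IsLeftDual γ) (w : X ⟶ X') :
    ∃ f : Y ⟶ Y', FormCompat γ γ' f w := (hγ Y').2 (γ' ∘ₗ extPost k Y' w)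

theorem FormCompat.injQ_map_eq {X Y X' Y' : A} {γ : Module.Dual k (Ext1 Y X)}
    {γ' : Module.Dual k (Ext1 Y' X')} (hγ' : IsRightDual γ') {f : Y ⟶ Y'} {w w' : X ⟶ X'}
    (h : FormCompat γ γ' f w) (h' : FormCompat γ γ' f w') :
    (injQ k A).map w = (injQ k A).map w' := by
  apply (hγ'.equiv X).injective
  rw [hγ'.equiv_map, hγ'.equiv_map, ← h, ← h']

theorem FormCompat.projQ_map_eq {X Y X' Y' : A} {γ : Module.Dual k (Ext1 Y X)}
    {γ' : Module.Dual k (Ext1 Y' X')} (hγ : IsLeftDual γ) {f f' : Y ⟶ Y'} {w : X ⟶ X'}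
    (h : FormCompat γ γ' f w) (h' : FormCompat γ γ' f' w) :
    (projQ k A).map f = (projQ k A).map f' := by
  apply (hγ.equiv Y').injective
  rw [hγ.equiv_map, hγ.equiv_map, h, h']

theorem IsRightDual.equiv_map_comp {X Y : A} {γ : Module.Dual k (Ext1 Y X)} (hγ : IsRightDual γ)
    {W W' : A} (f : W' ⟶ W) (q : (injQ k A).obj W ⟶ (injQ k A).obj X) :
    hγ.equiv W' ((injQ k A).map f ≫ q) = (extPost k Y f).dualMap (hγ.equiv W q) := by
  obtain ⟨h, rfl⟩ := (injQ k A).map_surjective q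
  rw [← Functor.map_comp, hγ.equiv_map, hγ.equiv_map, extPost_comp]
  rfl

/-- The source of naturality in `Y` of `Hom(X, τ Y) ≃ D Ext¹(Y, X)`: composing with the adjoint of
`f` on one side is the transpose of `Ext¹(f, W)` on the other. -/
theorem FormCompat.equiv_comp_map {X Y X' Y' : A} {γ : Module.Dual k (Ext1 Y X)}
    {γ' : Module.Dual k (Ext1 Y' X')} {f : Y ⟶ Y'} {w : X ⟶ X'} (h : FormCompat γ γ' f w)
    (hγ : IsRightDual γ) (hγ' : IsRightDual γ') {W : A}
    (q : (injQ k A).obj W ⟶ (injQ k A).obj X) :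
    hγ'.equiv W (q ≫ (injQ k A).map w) = (extPre k f W).dualMap (hγ.equiv W q) := by
  obtain ⟨g, rfl⟩ := (injQ k A).map_surjective q
  rw [← Functor.map_comp, hγ.equiv_map, hγ'.equiv_map, extPost_comp, ← LinearMap.comp_assoc, ← h]
  ext ξ
  change γ _ = γ _
  rw [extPre_extPost]

/-- Two right dual forms over the same object have isomorphic representing objects. -/
theorem IsRightDual.exists_iso {X X' Y : A} {γ : Module.Dual k (Ext1 Y X)} (hγ : IsRightDual γ)
    {γ' : Module.Dual k (Ext1 Y X')} (hγ' : IsRightDual γ') :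
    ∃ (w : X ⟶ X') (w' : X' ⟶ X), FormCompat γ γ' (𝟙 Y) w ∧ FormCompat γ' γ (𝟙 Y) w' ∧
      (injQ k A).map (w ≫ w') = 𝟙 _ ∧ (injQ k A).map (w' ≫ w) = 𝟙 _ := by
  obtain ⟨w, hw⟩ := IsRightDual.exists_compat γ hγ' (𝟙 Y)
  obtain ⟨w', hw'⟩ := IsRightDual.exists_compat γ' hγ (𝟙 Y)
  have h1 := hw.comp hw'
  have h2 := hw'.comp hw
  rw [Category.comp_id] at h1 h2
  refine ⟨w, w', hw, hw', ?_, ?_⟩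
  · rw [h1.injQ_map_eq hγ (FormCompat.id γ), CategoryTheory.Functor.map_id]
  · rw [h2.injQ_map_eq hγ' (FormCompat.id γ'), CategoryTheory.Functor.map_id]

section Inverse

variable (e : RStable k A ≌ LStable k A) {Y : A} (hY : rightAR k A Y)

/-- The map `Hom(τ⁻ X, Y) → Hom(X, τ Y)` for an equivalence `τ`. -/
def invHom (X : LStable k A) (q : (e.inverse.obj X).obj ⟶ (projQ k A).obj Y) :
    X.obj ⟶ (e.functor.obj (RStable.of k Y hY)).obj :=
  (e.counitIso.inv.app X ≫
    e.functor.map (ObjectProperty.homMk q : e.inverse.obj X ⟶ RStable.of k Y hY)).hom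

theorem invHom_naturality_left {X X' : LStable k A} (f : X ⟶ X')
    (q : (e.inverse.obj X').obj ⟶ (projQ k A).obj Y) :
    invHom e hY X ((e.inverse.map f).hom ≫ q) = f.hom ≫ invHom e hY X' q := by
  have h := e.counitIso.inv.naturality f
  refine congrArg (·.hom) (?_ : _ = f ≫ e.counitIso.inv.app X' ≫
    e.functor.map (ObjectProperty.homMk q : e.inverse.obj X' ⟶ RStable.of k Y hY))
  rw [← Category.assoc]
  refine Eq.trans ?_ (congrArg (· ≫ _) h).symm
  refine Eq.trans ?_ (Category.assoc _ _ _).symm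
  exact congrArg (_ ≫ ·) (e.functor.map_comp (e.inverse.map f)
    (ObjectProperty.homMk q : e.inverse.obj X' ⟶ RStable.of k Y hY))

theorem invHom_naturality_right {X : LStable k A} {Y' : A} (hY' : rightAR k A Y') (g : Y ⟶ Y')
    (q : (e.inverse.obj X).obj ⟶ (projQ k A).obj Y) :
    invHom e hY' X (q ≫ (projQ k A).map g) =
      invHom e hY X q ≫ (e.functor.map (RStable.map k hY hY' g)).hom := by
  refine congrArg (·.hom) (?_ : _ = (e.counitIso.inv.app X ≫ e.functor.map
    (ObjectProperty.homMk q : e.inverse.obj X ⟶ RStable.of k Y hY)) ≫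
      e.functor.map (RStable.map k hY hY' g))
  refine Eq.trans ?_ (Category.assoc _ _ _).symm
  exact congrArg (_ ≫ ·) (e.functor.map_comp
    (ObjectProperty.homMk q : e.inverse.obj X ⟶ RStable.of k Y hY) (RStable.map k hY hY' g))

theorem invHom_bijective (X : LStable k A) : Function.Bijective (invHom e hY X) := by
  constructor
  · intro p q h
    have h1 := ObjectProperty.hom_ext _ h
    rw [cancel_epi] at h1
    exact congrArg (·.hom) (e.functor.map_injective h1)
  · intro q
    obtain ⟨r, hr⟩ := e.functor.map_surjective (X := e.inverse.obj X) (Y := RStable.of k Y hY)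
      (e.counitIso.hom.app X ≫ ObjectProperty.homMk q)
    refine ⟨r.hom, congrArg (·.hom) (?_ : e.counitIso.inv.app X ≫ e.functor.map r =
      ObjectProperty.homMk q)⟩
    rw [hr]
    exact (e.counitIso.app X).inv_hom_id_assoc _

variable [e.functor.Additive] [e.functor.Linear k]

/-- The linear equivalence `Hom(τ⁻ X, Y) ≃ Hom(X, τ Y)` for an equivalence `τ`. -/
def invEquiv (X : LStable k A) : ((e.inverse.obj X).obj ⟶ (projQ k A).obj Y) ≃ₗ[k]
    (X.obj ⟶ (e.functor.obj (RStable.of k Y hY)).obj) :=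
  LinearEquiv.ofBijective
    { toFun := invHom e hY X
      map_add' := fun p q => congrArg (·.hom) ((congrArg (e.counitIso.inv.app X ≫ ·)
        (e.functor.map_add (f := (ObjectProperty.homMk p : e.inverse.obj X ⟶ RStable.of k Y hY))
          (g := ObjectProperty.homMk q))).trans (Preadditive.comp_add _ _ _ _ _ _))
      map_smul' := fun c q => congrArg (·.hom) ((congrArg (e.counitIso.inv.app X ≫ ·)
        (e.functor.map_smul c
          (ObjectProperty.homMk q : e.inverse.obj X ⟶ RStable.of k Y hY))).trans
          (Linear.comp_smul _ _ _ _ _ _)) }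
    (invHom_bijective e hY X)

/-- The duality isomorphisms for `τ⁻` obtained from those for `τ`. -/
def TauIso.inverse (t : TauIso k e.functor) (h : ∀ Y, rightAR k A Y) :
    TauInvIso k e.inverse where
  equiv X hX Y := (invEquiv e (h Y) (LStable.of k X hX)).trans (t.equiv X Y (h Y))
  naturality_left hX hX' f Y q :=
    (congrArg (t.equiv _ Y (h Y)) (invHom_naturality_left e (h Y) (LStable.map k hX hX' f) q)).trans
      (t.naturality_left f Y (h Y) _)
  naturality_right X _ Y Y' g q :=
    (congrArg (t.equiv X Y' (h Y')) (invHom_naturality_right e (h Y) (h Y') g q)).trans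
      (t.naturality_right X (h Y) (h Y') g _)

end Inverse

/-- A choice, for every object `Y`, of a perfect form on `Ext¹(Y, T Y)`. -/
structure Serre (k : Type u) [Field k] (A : Type v) [Category.{u} A] [Abelian A] [Linear k A] where
  T : A → A
  γ (Y : A) : Module.Dual k (Ext1 Y (T Y))
  right (Y : A) : IsRightDual (γ Y)
  left (Y : A) : IsLeftDual (γ Y)
  right_of_left {X Y : A} {γ : Module.Dual k (Ext1 Y X)} : IsLeftDual γ → IsRightDual γ

variable (s : Serre k A)

namespace Serre

/-- The bijection on stable morphisms underlying the translation. -/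
def mapEquiv (Y Z : A) : ((projQ k A).obj Y ⟶ (projQ k A).obj Z) ≃ₗ[k]
    ((injQ k A).obj (s.T Y) ⟶ (injQ k A).obj (s.T Z)) :=
  -- Both sides are identified with `D Ext¹(Z, T Y)`: the first through the left dual form of `Y`,
  -- the second through the right dual form of `Z`.
  ((s.left Y).equiv Z).trans ((s.right Z).equiv (s.T Y)).symm

theorem mapEquiv_eq_iff {Y Z : A} (f : Y ⟶ Z) (w : s.T Y ⟶ s.T Z) :
    s.mapEquiv Y Z ((projQ k A).map f) = (injQ k A).map w ↔ FormCompat (s.γ Y) (s.γ Z) f w := by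
  rw [mapEquiv, LinearEquiv.trans_apply, LinearEquiv.symm_apply_eq, (s.left Y).equiv_map,
    (s.right Z).equiv_map, FormCompat]

theorem exists_mapEquiv {Y Z : A} (q : (projQ k A).obj Y ⟶ (projQ k A).obj Z) :
    ∃ (f : Y ⟶ Z) (w : s.T Y ⟶ s.T Z), (projQ k A).map f = q ∧
      s.mapEquiv Y Z q = (injQ k A).map w ∧ FormCompat (s.γ Y) (s.γ Z) f w := by
  obtain ⟨f, rfl⟩ := (projQ k A).map_surjective q
  obtain ⟨w, hw⟩ := (injQ k A).map_surjective (s.mapEquiv Y Z ((projQ k A).map f))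
  exact ⟨f, w, rfl, hw.symm, (s.mapEquiv_eq_iff f w).1 hw.symm⟩

/-- The generalized Auslander-Reiten translation. -/
def tau : RStable k A ⥤ LStable k A where
  obj Y := ⟨(injQ k A).obj (s.T Y.obj.as), (s.left _).leftAR⟩
  map {Y Z} q := ObjectProperty.homMk (s.mapEquiv Y.obj.as Z.obj.as q.hom)
  map_id Y := by
    apply ObjectProperty.hom_ext
    change s.mapEquiv Y.obj.as Y.obj.as (𝟙 ((projQ k A).obj _)) = 𝟙 ((injQ k A).obj _)
    rw [← CategoryTheory.Functor.map_id, ← CategoryTheory.Functor.map_id, s.mapEquiv_eq_iff]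
    exact FormCompat.id _
  map_comp {X Y Z} p q := by
    apply ObjectProperty.hom_ext
    change s.mapEquiv X.obj.as Z.obj.as (p.hom ≫ q.hom) =
      s.mapEquiv X.obj.as Y.obj.as p.hom ≫ s.mapEquiv Y.obj.as Z.obj.as q.hom
    obtain ⟨f, w, hf, hw, h⟩ := s.exists_mapEquiv p.hom
    obtain ⟨f', w', hf', hw', h'⟩ := s.exists_mapEquiv q.hom
    rw [hw, hw', ← Functor.map_comp]
    have : p.hom ≫ q.hom = (projQ k A).map (f ≫ f') := by
      rw [Functor.map_comp, hf, hf']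
    rw [this, s.mapEquiv_eq_iff]
    exact h.comp h'

instance : s.tau.Faithful where
  map_injective {Y Z} p q h := by
    apply ObjectProperty.hom_ext
    apply (s.mapEquiv Y.obj.as Z.obj.as).injective
    exact congrArg (·.hom) h

instance : s.tau.Full where
  map_surjective {Y Z} q :=
    ⟨ObjectProperty.homMk ((s.mapEquiv Y.obj.as Z.obj.as).symm q.hom),
      ObjectProperty.hom_ext _ ((s.mapEquiv Y.obj.as Z.obj.as).apply_symm_apply q.hom)⟩

/-- The isomorphism `τ Y ≅ X` given by a perfect form on `Ext¹(Y, X)`. -/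
theorem exists_tauIso {X Y : A} (hY : rightAR k A Y) (hX : leftAR k A X)
    {γ : Module.Dual k (Ext1 Y X)} (hγ : IsRightDual γ) :
    ∃ (e : s.tau.obj (RStable.of k Y hY) ≅ LStable.of k X hX) (w : s.T Y ⟶ X),
      e.hom.hom = (injQ k A).map w ∧ FormCompat (s.γ Y) γ (𝟙 Y) w := by
  obtain ⟨w, w', h, h', h1, h2⟩ := (s.right Y).exists_iso hγ
  refine ⟨⟨ObjectProperty.homMk ((injQ k A).map w), ObjectProperty.homMk ((injQ k A).map w'),
    ObjectProperty.hom_ext _ ?_, ObjectProperty.hom_ext _ ?_⟩, w, rfl, h⟩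
  · exact ((injQ k A).map_comp _ _).symm.trans h1
  · exact ((injQ k A).map_comp _ _).symm.trans h2

/-- If `Y` represents `D Ext¹(-, X)`, the form is also right dual, so `X` and `T Y` both represent
`D Ext¹(Y, -)`. -/
instance : s.tau.EssSurj where
  mem_essImage X := by
    obtain ⟨Y, hY⟩ := X.property
    obtain ⟨γ, hγ⟩ := exists_isLeftDual_iff.1 hY
    have hγ' := s.right_of_left hγ
    obtain ⟨e, -⟩ := s.exists_tauIso hγ'.rightAR X.property hγ'
    exact ⟨_, ⟨e⟩⟩

instance : s.tau.IsEquivalence where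

/-- The chosen isomorphism `τ Y ≅ X` given by a perfect form on `Ext¹(Y, X)`. -/
def tauIso {X Y : A} (hY : rightAR k A Y) (hX : leftAR k A X)
    {γ : Module.Dual k (Ext1 Y X)} (hγ : IsRightDual γ) :
    s.tau.obj (RStable.of k Y hY) ≅ LStable.of k X hX :=
  (s.exists_tauIso hY hX hγ).choose

/-- Both composites are represented by morphisms `T Y ⟶ X'` adjoint to `f` with respect to the same
two forms, so they agree stably. -/
theorem tauIso_naturality {X Y X' Y' : A} (hY : rightAR k A Y) (hX : leftAR k A X)
    (hY' : rightAR k A Y') (hX' : leftAR k A X')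
    {γ : Module.Dual k (Ext1 Y X)} (hγ : IsRightDual γ)
    {γ' : Module.Dual k (Ext1 Y' X')} (hγ' : IsRightDual γ')
    {f : Y ⟶ Y'} {w : X ⟶ X'} (h : FormCompat γ γ' f w) :
    s.tau.map (RStable.map k hY hY' f) ≫ (s.tauIso hY' hX' hγ').hom =
      (s.tauIso hY hX hγ).hom ≫ LStable.map k hX hX' w := by
  obtain ⟨p, hp, hp'⟩ := (s.exists_tauIso hY hX hγ).choose_spec
  obtain ⟨q, hq, hq'⟩ := (s.exists_tauIso hY' hX' hγ').choose_spec
  obtain ⟨g, hg⟩ := IsRightDual.exists_compat (s.γ Y) (s.right Y') f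
  apply ObjectProperty.hom_ext
  have h1 : (s.tau.map (RStable.map k hY hY' f)).hom = (injQ k A).map g := by
    exact (s.mapEquiv_eq_iff f g).2 hg
  change (s.tau.map (RStable.map k hY hY' f)).hom ≫ (s.tauIso hY' hX' hγ').hom.hom =
    (s.tauIso hY hX hγ).hom.hom ≫ (injQ k A).map w
  unfold tauIso
  rw [h1, hp, hq]
  refine ((injQ k A).map_comp _ _).symm.trans (Eq.trans ?_ ((injQ k A).map_comp _ _))
  have h2 := hg.comp hq'
  have h3 := hp'.comp h
  rw [Category.comp_id] at h2
  rw [Category.id_comp] at h3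
  exact h2.injQ_map_eq hγ' h3

/-- The duality isomorphisms for `τ`. -/
def isoTau : TauIso k s.tau where
  equiv X Y _ := (s.right Y).equiv X
  naturality_left {X' X} f Y hY q := by
    exact (s.right Y).equiv_map_comp f q
  naturality_right X {Y Y'} hY hY' g q := by
    obtain ⟨w, hw⟩ := IsRightDual.exists_compat (s.γ Y) (s.right Y') g
    have h1 : (s.tau.map (RStable.map k hY hY' g)).hom = (injQ k A).map w := by
      exact (s.mapEquiv_eq_iff g w).2 hw
    rw [h1]
    exact hw.equiv_comp_map (s.right Y) (s.right _) q

/-- The equivalence `τ`. -/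
def tauEquivalence : RStable k A ≌ LStable k A := s.tau.asEquivalence

theorem rightAR (s : Serre k A) (Y : A) : GenAR.rightAR k A Y := (s.right Y).rightAR

instance : s.tauEquivalence.functor.Additive where
  map_add {X Y p q} := ObjectProperty.hom_ext _ (map_add (s.mapEquiv X.obj.as Y.obj.as) p.hom q.hom)

instance : s.tauEquivalence.functor.Linear k where
  map_smul {X Y} p c :=
    ObjectProperty.hom_ext _ (map_smul (s.mapEquiv X.obj.as Y.obj.as) c p.hom)

/-- The isomorphism `τ⁻ X ≅ Y` given by a perfect form on `Ext¹(Y, X)`. -/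
def tauInvIso {X Y : A} (hY : GenAR.rightAR k A Y) (hX : leftAR k A X)
    {γ : Module.Dual k (Ext1 Y X)} (hγ : IsRightDual γ) :
    s.tauEquivalence.inverse.obj (LStable.of k X hX) ≅ RStable.of k Y hY :=
  s.tauEquivalence.inverse.mapIso (s.tauIso hY hX hγ).symm ≪≫
    (s.tauEquivalence.unitIso.app (RStable.of k Y hY)).symm

theorem tauInvIso_naturality {X Y X' Y' : A} (hY : GenAR.rightAR k A Y) (hX : leftAR k A X)
    (hY' : GenAR.rightAR k A Y') (hX' : leftAR k A X')
    {γ : Module.Dual k (Ext1 Y X)} (hγ : IsRightDual γ)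
    {γ' : Module.Dual k (Ext1 Y' X')} (hγ' : IsRightDual γ')
    {f : Y ⟶ Y'} {w : X ⟶ X'} (h : FormCompat γ γ' f w) :
    s.tauEquivalence.inverse.map (LStable.map k hX hX' w) ≫ (s.tauInvIso hY' hX' hγ').hom =
      (s.tauInvIso hY hX hγ).hom ≫ RStable.map k hY hY' f := by
  have h1 : LStable.map k hX hX' w ≫ (s.tauIso hY' hX' hγ').inv =
      (s.tauIso hY hX hγ).inv ≫ s.tau.map (RStable.map k hY hY' f) := by
    rw [Iso.comp_inv_eq, Category.assoc, Iso.eq_inv_comp]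
    exact (s.tauIso_naturality hY hX hY' hX' hγ hγ' h).symm
  have h2 := s.tauEquivalence.unitIso.inv.naturality (RStable.map k hY hY' f)
  have h3 := congrArg s.tauEquivalence.inverse.map h1
  rw [Functor.map_comp, Functor.map_comp] at h3
  change s.tauEquivalence.inverse.map (LStable.map k hX hX' w) ≫
      s.tauEquivalence.inverse.map (s.tauIso hY' hX' hγ').inv ≫
        s.tauEquivalence.unitIso.inv.app (RStable.of k Y' hY') =
    (s.tauEquivalence.inverse.map (s.tauIso hY hX hγ).inv ≫
      s.tauEquivalence.unitIso.inv.app (RStable.of k Y hY)) ≫ RStable.map k hY hY' f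
  refine (Category.assoc _ _ _).symm.trans ((congrArg (· ≫ _) h3).trans ?_)
  refine (Category.assoc _ _ _).trans (Eq.trans ?_ (Category.assoc _ _ _).symm)
  exact congrArg (_ ≫ ·) h2

end Serre

end Translation

/-! ### The Auslander-Reiten formula from a Nakayama form -/

section Formula

variable {k : Type u} [Field k] {A : Type v} [Category.{u} A] [Abelian A] [Linear k A]

/-- A form `θ` on `Hom(P, N)` that exhibits `N` as a representing object of the functor
`X ↦ Ker(D Hom(P, X) → D Hom(P', X))` given by a morphism `f : P ⟶ P'`. -/
structure IsNakayama {P P' N : A} (f : P ⟶ P') (θ : Module.Dual k (P ⟶ N)) : Prop where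
  vanish (g : P' ⟶ N) : θ (f ≫ g) = 0
  exists_lift {X : A} (l : Module.Dual k (P ⟶ X)) (hl : ∀ g : P' ⟶ X, l (f ≫ g) = 0) :
    ∃ h : X ⟶ N, ∀ p : P ⟶ X, θ (p ≫ h) = l p
  hom_ext {X : A} {h h' : X ⟶ N} (H : ∀ p : P ⟶ X, θ (p ≫ h) = θ (p ≫ h')) : h = h'

variable {P P' N M : A} {f : P ⟶ P'} {θ : Module.Dual k (P ⟶ N)} {p : P' ⟶ M}

/-- A morphism `K ⟶ N` with zero connecting image extends along `j`; its composite with `π` then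
factors through `f`, where `θ` vanishes. So `g ↦ θ (π ≫ g)` descends to `Ext¹(M, N)`. -/
theorem exists_nakayamaForm (hθ : IsNakayama f θ) [Projective P'] {K : A} {π : P ⟶ K} {j : K ⟶ P'}
    (hf : π ≫ j = f) {w : j ≫ p = 0} (hS : (ShortComplex.mk j p w).ShortExact) :
    ∃ γ : Module.Dual k (Ext1 M N), ∀ g : K ⟶ N, γ (conn k hS N g) = θ (π ≫ g) := by
  have : Projective (ShortComplex.mk j p w).X₂ := ‹_›
  obtain ⟨γ, hγ⟩ := exists_dual_comp_eq (conn k hS N) (θ ∘ₗ Linear.leftComp k N π) fun g hg => by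
    obtain ⟨g, rfl⟩ := exists_of_conn_eq_zero k hS hg
    change θ (π ≫ j ≫ g) = 0
    rw [reassoc_of% hf, hθ.vanish]
  exact ⟨γ, fun g => LinearMap.congr_fun hγ g⟩

/-- The Auslander-Reiten formula. -/
theorem IsNakayama.isRightDual [EnoughProjectives A] (hθ : IsNakayama f θ) [Projective P']
    {K : A} {π : P ⟶ K} [Epi π] {j : K ⟶ P'} (hf : π ≫ j = f) {w : j ≫ p = 0}
    (hS : (ShortComplex.mk j p w).ShortExact) {γ : Module.Dual k (Ext1 M N)}
    (hγ : ∀ g : K ⟶ N, γ (conn k hS N g) = θ (π ≫ g)) : IsRightDual γ := fun W => by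
  have : Projective (ShortComplex.mk j p w).X₂ := ‹_›
  have key : ∀ (h : W ⟶ N) (g : K ⟶ W), γ (extPost k M h (conn k hS W g)) = θ (π ≫ g ≫ h) := by
    intro h g
    rw [← hγ]
    exact congrArg γ (conn_comp hS g h).symm
  refine ⟨fun h hh Z => LinearMap.ext fun ξ => ?_, fun φ => ?_⟩
  · obtain ⟨E, i, q, w', hS', rfl⟩ := exists_extension k ξ
    have : Mono i := hS'.mono_f
    -- The form `g ↦ θ (g ≫ h)` must be transported to `Hom(P, E)` modulo morphisms factoring
    -- through `f`. If `g ≫ i` factors through `f`, then `g` kills `kernel π` and so factors through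
    -- `π`; the hypothesis on `h` then gives `θ (g ≫ h) = 0`.
    obtain ⟨ψ, hψ⟩ := exists_dual_comp_eq
        ((Submodule.mkQ (LinearMap.range (Linear.leftComp k E f))) ∘ₗ Linear.rightComp k P i)
        (θ ∘ₗ Linear.rightComp k P h) fun g hg => by
      obtain ⟨x, hx⟩ := (Submodule.Quotient.mk_eq_zero _).1 hg
      change f ≫ x = g ≫ i at hx
      have hg' : kernel.ι π ≫ g = 0 := by
        rw [← cancel_mono i, Category.assoc, ← hx, ← hf, Category.assoc, kernel.condition_assoc,
          zero_comp, zero_comp]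
      have hd := Abelian.comp_epiDesc π g hg'
      change θ (g ≫ h) = 0
      rw [← hd, Category.assoc, ← key]
      exact LinearMap.congr_fun hh _
    obtain ⟨h', hh'⟩ := hθ.exists_lift (ψ ∘ₗ Submodule.mkQ _) fun g => by
      have : (Submodule.mkQ (LinearMap.range (Linear.leftComp k E f))) (f ≫ g) = 0 :=
        (Submodule.Quotient.mk_eq_zero _).2 ⟨g, rfl⟩
      rw [LinearMap.comp_apply, this, map_zero]
    have hi : i ≫ h' = h := hθ.hom_ext fun g => by
      have := hh' (g ≫ i)
      rw [Category.assoc] at this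
      exact this.trans (LinearMap.congr_fun hψ g)
    rw [← hi, extPost_comp_apply]
    have h0 := extPost_conn k hS'
    dsimp at h0
    rw [h0, map_zero, LinearMap.zero_apply]
  -- Since `π` is epi, `Hom(K, W)` embeds in `Hom(P, W)`, and the pullback of `φ` along the
  -- connecting map extends there. The extension vanishes on `f ≫ g` because `j ≫ g` has zero
  -- connecting image.
  · obtain ⟨l, hl⟩ := exists_dual_comp_eq (Linear.leftComp k W π) (φ ∘ₗ conn k hS W) fun g hg => by
      have h0 : π ≫ g = 0 := hg
      have h1 : g = 0 := (cancel_epi π).1 (h0.trans comp_zero.symm)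
      subst h1
      exact map_zero _
    obtain ⟨h, hh⟩ := hθ.exists_lift l fun g => by
      have := LinearMap.congr_fun hl (j ≫ g)
      change l (π ≫ j ≫ g) = φ (conn k hS W (j ≫ g)) at this
      have h0 := conn_f_comp k hS g
      dsimp at h0
      rw [← hf, Category.assoc, this, h0, map_zero]
    refine ⟨h, LinearMap.ext fun η => ?_⟩
    obtain ⟨g, rfl⟩ := conn_surjective k hS η
    refine (key h g).trans ?_
    have := hh (π ≫ g)
    rw [Category.assoc] at this
    exact this.trans (LinearMap.congr_fun hl g)

variable (k) in
/-- A projective presentation of `M` together with a form exhibiting `N` as the kernel of the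
induced morphism of Nakayama functors. -/
structure NakayamaData (M N : A) where
  P₁ : A
  P₀ : A
  f₁ : P₁ ⟶ P₀
  f₀ : P₀ ⟶ M
  w : f₁ ≫ f₀ = 0
  exact : (ShortComplex.mk f₁ f₀ w).Exact
  epi : Epi f₀
  projective : Projective P₀
  θ : Module.Dual k (P₁ ⟶ N)
  nakayama : IsNakayama f₁ θ

namespace NakayamaData

variable {M N M' N' : A} (d : NakayamaData k M N) (d' : NakayamaData k M' N')

theorem shortExact :
    (ShortComplex.mk (kernel.ι d.f₀) d.f₀ (kernel.condition d.f₀)).ShortExact where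
  exact := ShortComplex.exact_of_f_is_kernel _ (kernelIsKernel d.f₀)
  mono_f := by dsimp; infer_instance
  epi_g := d.epi

/-- The projection onto the first syzygy. -/
def π : d.P₁ ⟶ kernel d.f₀ := kernel.lift d.f₀ d.f₁ d.w

theorem π_ι : d.π ≫ kernel.ι d.f₀ = d.f₁ := kernel.lift_ι _ _ _

instance : Epi d.π := d.exact.epi_kernelLift

theorem exists_form : ∃ γ : Module.Dual k (Ext1 M N),
    ∀ g : kernel d.f₀ ⟶ N, γ (conn k d.shortExact N g) = d.θ (d.π ≫ g) :=
  have := d.projective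
  exists_nakayamaForm d.nakayama d.π_ι d.shortExact

/-- The form on `Ext¹(M, N)`. -/
def γ : Module.Dual k (Ext1 M N) := d.exists_form.choose

theorem γ_conn (g : kernel d.f₀ ⟶ N) : d.γ (conn k d.shortExact N g) = d.θ (d.π ≫ g) :=
  d.exists_form.choose_spec g

theorem isRightDual [EnoughProjectives A] : IsRightDual d.γ :=
  have := d.projective
  d.nakayama.isRightDual d.π_ι d.shortExact d.γ_conn

variable {d d'}

/-- The lift of `f` induces a morphism of syzygy sequences. Since every class in `Ext¹(M', N)` comes
from the syzygy of `M'`, naturality of the connecting maps reduces adjointness to the identity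
between `d.θ` and `d'.θ`. -/
theorem compat {f : M ⟶ M'} {g₀ : d.P₀ ⟶ d'.P₀} {g₁ : d.P₁ ⟶ d'.P₁} {w : N ⟶ N'}
    (h₀ : g₀ ≫ d'.f₀ = d.f₀ ≫ f) (h₁ : g₁ ≫ d'.f₁ = d.f₁ ≫ g₀)
    (h : ∀ x : d'.P₁ ⟶ N, d.θ (g₁ ≫ x) = d'.θ (x ≫ w)) : FormCompat d.γ d'.γ f w := by
  let φ : ShortComplex.mk (kernel.ι d.f₀) d.f₀ (kernel.condition d.f₀) ⟶
      ShortComplex.mk (kernel.ι d'.f₀) d'.f₀ (kernel.condition d'.f₀) :=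
    { τ₁ := kernel.map _ _ g₀ f h₀.symm, τ₂ := g₀, τ₃ := f
      comm₁₂ := by simp
      comm₂₃ := h₀ }
  have hφ : d.π ≫ φ.τ₁ = g₁ ≫ d'.π := by
    rw [← cancel_mono (kernel.ι d'.f₀)]
    dsimp only [φ]
    rw [Category.assoc, Category.assoc, kernel.lift_ι, reassoc_of% d.π_ι, d'.π_ι, h₁]
  refine LinearMap.ext fun ξ => ?_
  have : Projective (ShortComplex.mk (kernel.ι d'.f₀) d'.f₀ (kernel.condition d'.f₀)).X₂ :=
    d'.projective
  obtain ⟨x, rfl⟩ := conn_surjective k d'.shortExact ξ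
  have e1 := conn_naturality (k := k) d.shortExact d'.shortExact φ x
  have e2 := conn_comp (k := k) d'.shortExact x w
  dsimp at x
  change d.γ (extPre k φ.τ₃ N _) = d'.γ _
  rw [e1]
  refine (d.γ_conn (φ.τ₁ ≫ x)).trans (Eq.trans ?_ (congrArg d'.γ e2))
  refine Eq.trans ?_ (d'.γ_conn (x ≫ w)).symm
  rw [reassoc_of% hφ, h, Category.assoc]

end NakayamaData

end Formula

/-! ### Fitting idempotents, projective covers and stable summands -/

section Fitting

variable {k : Type u} [Field k]

/-- The Fitting idempotent of an element of a finite dimensional algebra. -/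
theorem exists_fitting_idempotent (k : Type*) [Field k] {R : Type*} [Ring R] [Algebra k R]
    [Module.Finite k R] (t : R) :
    ∃ (n : ℕ) (e y : R), 0 < n ∧ e = t ^ n * y ∧ t ^ n * e = t ^ n ∧ e * e = e := by
  -- For large `n`, `R` is the direct sum of the kernel and range of multiplication by `t ^ n`; `e`
  -- is the component of `1` in the range. Taking `n` positive ensures that `e` is a multiple of
  -- `t`.
  obtain ⟨n, hn, h0⟩ := ((LinearMap.mulLeft k t).eventually_isCompl_ker_pow_range_pow.and
    (Filter.eventually_gt_atTop 0)).exists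
  rw [LinearMap.pow_mulLeft] at hn
  have h1 : (1 : R) ∈ LinearMap.ker (LinearMap.mulLeft k (t ^ n)) ⊔
      LinearMap.range (LinearMap.mulLeft k (t ^ n)) := by rw [hn.sup_eq_top]; trivial
  obtain ⟨a, ha, e, ⟨y, hy⟩, hae⟩ := Submodule.mem_sup.1 h1
  have ha' : t ^ n * a = 0 := ha
  have hy' : t ^ n * y = e := hy
  have hte : t ^ n * e = t ^ n := by
    rw [← sub_eq_zero, ← neg_eq_zero, neg_sub]
    calc t ^ n - t ^ n * e = t ^ n * ((a + e) - e) := by rw [hae, mul_sub, mul_one]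
      _ = 0 := by rw [add_sub_cancel_right, ha']
  refine ⟨n, e, y, h0, hy'.symm, hte, ?_⟩
  -- With `a = 1 - e` in the kernel, `a * e = e - e * e` lies in both summands, hence vanishes.
  have h2 : a * e ∈ LinearMap.ker (LinearMap.mulLeft k (t ^ n)) ⊓
      LinearMap.range (LinearMap.mulLeft k (t ^ n)) := by
    refine ⟨?_, ⟨y - y * e, ?_⟩⟩
    · change t ^ n * (a * e) = 0
      rw [← mul_assoc, ha', zero_mul]
    · change t ^ n * (y - y * e) = a * e
      rw [mul_sub, ← mul_assoc, hy', eq_sub_iff_add_eq.2 hae, sub_mul, one_mul]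
  rw [hn.inf_eq_bot] at h2
  have h3 : a * e = 0 := h2
  calc e * e = (a + e) * e := by rw [add_mul, h3, zero_add]
    _ = e := by rw [hae, one_mul]

theorem isUnit_of_mul_eq_one_of_finite (k : Type*) [Field k] {R : Type*} [Ring R] [Algebra k R]
    [Module.Finite k R] {t z : R} (h : t * z = 1) : IsUnit t := by
  have hs : Function.Surjective (LinearMap.mulLeft k t) := fun x => ⟨z * x, by
    change t * (z * x) = x
    rw [← mul_assoc, h, one_mul]⟩
  have hi := LinearMap.injective_iff_surjective.2 hs
  refine ⟨⟨t, z, h, hi ?_⟩, rfl⟩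
  change t * (z * t) = t * 1
  rw [← mul_assoc, h, one_mul, mul_one]

variable {A : Type v} [Category.{u} A] [Abelian A] [Linear k A]

/-- The powers of an endomorphism. -/
def endPow {A : Type v} [Category.{u} A] {X : A} (t : X ⟶ X) (n : ℕ) : X ⟶ X := (End.of t ^ n : End X)

theorem endPow_zero {A : Type v} [Category.{u} A] {X : A} (t : X ⟶ X) : endPow t 0 = 𝟙 X := pow_zero (End.of t)

theorem endPow_succ {A : Type v} [Category.{u} A] {X : A} (t : X ⟶ X) (n : ℕ) : endPow t (n + 1) = t ≫ endPow t n :=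
  pow_succ (End.of t) n

/-- The witness is the geometric sum of the powers of `t` below `n`. -/
theorem exists_one_sub_comp {X : A} (t : X ⟶ X) (n : ℕ) :
    ∃ s : X ⟶ X, (𝟙 X - t) ≫ s = 𝟙 X - endPow t n := by
  induction n with
  | zero => exact ⟨0, by rw [endPow_zero, sub_self, comp_zero]⟩
  | succ n ih =>
    obtain ⟨s, hs⟩ := ih
    refine ⟨s + endPow t n, ?_⟩
    rw [Preadditive.comp_add, hs, Preadditive.sub_comp, Category.id_comp, endPow_succ]
    abel

/-- The Fitting idempotent of an endomorphism. -/
theorem exists_fitting (k : Type u) [Field k] [Linear k A] {X : A} [Module.Finite k (X ⟶ X)]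
    (t : X ⟶ X) : ∃ (n : ℕ) (e y : X ⟶ X), e = y ≫ endPow t (n + 1) ∧
      e ≫ endPow t (n + 1) = endPow t (n + 1) ∧ e ≫ e = e := by
  have : Module.Finite k (End X) := ‹_›
  obtain ⟨n, e, y, h0, h⟩ := exists_fitting_idempotent k (End.of t)
  obtain ⟨m, rfl⟩ := Nat.exists_eq_succ_of_ne_zero h0.ne'
  exact ⟨m, e, y, h⟩

/-- Choose `P ⟶ M` with `dim End P` minimal. If `g ≫ f = f`, the Fitting idempotent `e` of `g` also
satisfies `e ≫ f = f`, so its image still covers `M`. Minimality makes the embedding of its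
endomorphisms into `End P` bijective, which forces `e = 𝟙 P`; then `g` is invertible. -/
theorem exists_projectiveCover (k : Type u) [Field k] [Linear k A] (S : ObjectProperty A)
    (hS : ∀ {P Q : A}, Retract P Q → S Q → S P) (hfin : ∀ P, S P → Module.Finite k (P ⟶ P))
    (hproj : ∀ P, S P → Projective P) {M : A} (hM : ∃ (P : A) (f : P ⟶ M), S P ∧ Epi f) :
    ∃ (P : A) (f : P ⟶ M), S P ∧ IsProjectiveCover f := by
  classical
  have hM' : ∃ (n : ℕ) (P : A) (f : P ⟶ M), S P ∧ Epi f ∧ Module.finrank k (P ⟶ P) = n := by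
    obtain ⟨P, f, h1, h2⟩ := hM
    exact ⟨_, P, f, h1, h2, rfl⟩
  obtain ⟨P, f, hP, hf, hn⟩ := Nat.find_spec hM'
  refine ⟨P, f, hP, hproj P hP, hf, fun g hg => ?_⟩
  have := hfin P hP
  obtain ⟨n, e, y, hy, hte, hee⟩ := exists_fitting k g
  have hpow : ∀ n : ℕ, endPow g n ≫ f = f := by
    intro n
    induction n with
    | zero => rw [endPow_zero, Category.id_comp]
    | succ n ih => rw [endPow_succ, Category.assoc, ih, hg]
  have hef : e ≫ f = f := by
    rw [← hpow (n + 1), reassoc_of% hte]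
  obtain ⟨P', i, q, hiq, hqi⟩ := IsIdempotentComplete.idempotents_split P e hee
  have hP' : S P' := hS ⟨i, q, hiq⟩ hP
  have hepi : Epi (i ≫ f) := by
    have : Epi (q ≫ i ≫ f) := by rw [reassoc_of% hqi, hef]; infer_instance
    exact epi_of_epi q (i ≫ f)
  have hle := Nat.find_min' hM' ⟨P', i ≫ f, hP', hepi, rfl⟩
  rw [← hn] at hle
  let L : (P' ⟶ P') →ₗ[k] (P ⟶ P) := Linear.leftComp k P q ∘ₗ Linear.rightComp k P' i
  have hL : Function.Injective L := fun a b hab => by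
    change q ≫ a ≫ i = q ≫ b ≫ i at hab
    have := congrArg (i ≫ · ≫ q) hab
    simpa [hiq, reassoc_of% hiq] using this
  have := hfin P' hP'
  obtain ⟨x, hx⟩ := (LinearMap.injective_iff_surjective_of_finrank_eq_finrank
    (le_antisymm (LinearMap.finrank_le_finrank_of_injective hL) hle)).1 hL (𝟙 P)
  change q ≫ x ≫ i = 𝟙 P at hx
  have he1 : e = 𝟙 P := by
    calc e = (q ≫ x ≫ i) ≫ e := by rw [hx, Category.id_comp]
      _ = q ≫ x ≫ (i ≫ q) ≫ i := by rw [← hqi]; simp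
      _ = 𝟙 P := by rw [hiq, Category.id_comp, hx]
  have : Module.Finite k (End P) := hfin P hP
  have hu : IsUnit (End.of g) := isUnit_of_mul_eq_one_of_finite k
    (z := End.of g ^ n * End.of y) (by
      rw [← mul_assoc, ← pow_succ']
      exact hy.symm.trans he1)
  exact (isUnit_iff_isIso g).1 hu

/-- Let `t = 𝟙 X - a ≫ b` with Fitting idempotent `e`. As a multiple of `t`, `e` is injectively
trivial, so its image `I` has no extensions by it and is injective. On the complement `t` is
nilpotent, so `a ≫ b = 𝟙 X - t` is invertible there. Thus `X` is a summand of `F` plus `I`. -/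
theorem exists_summand_of_injTrivial {X F : A} [Module.Finite k (X ⟶ X)] {a : X ⟶ F} {b : F ⟶ X}
    (h : 𝟙 X - a ≫ b ∈ injTrivial k X X) :
    ∃ (I : A) (a' : X ⟶ F) (b' : F ⟶ X) (c : X ⟶ I) (d : I ⟶ X), Injective I ∧
      a' ≫ b' + c ≫ d = 𝟙 X := by
  obtain ⟨n, e, y, hy, hte, hee⟩ := exists_fitting k (𝟙 X - a ≫ b)
  obtain ⟨I, d, c, hdc, hcd⟩ := IsIdempotentComplete.idempotents_split X e hee
  set t : X ⟶ X := 𝟙 X - a ≫ b with ht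
  have hI : Injective I := injective_of_ext1 fun Z ξ => by
    have he : e ∈ injTrivial k X X := by
      rw [hy, endPow_succ]
      exact injTrivial_comp_left k y (injTrivial_comp_right k _ h)
    have h1 : ξ = extPost k Z (d ≫ e ≫ c) ξ := by
      rw [← hcd, Category.assoc, hdc, Category.comp_id, hdc, extPost_id, LinearMap.id_apply]
    rw [h1, injTrivial_comp_left k d (injTrivial_comp_right k c he) Z, LinearMap.zero_apply]
  obtain ⟨s, hs⟩ := exists_one_sub_comp t (n + 1)
  rw [ht, sub_sub_cancel, ← ht] at hs
  refine ⟨I, (𝟙 X - e) ≫ a, b ≫ s ≫ (𝟙 X - e), c, d, hI, ?_⟩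
  have h2 : (𝟙 X - e) ≫ (𝟙 X - endPow t (n + 1)) = 𝟙 X - e := by
    rw [Preadditive.sub_comp, Preadditive.comp_sub, Preadditive.comp_sub, Category.comp_id,
      Category.comp_id, hte, Category.id_comp]
    abel
  have h3 : (𝟙 X - e) ≫ (𝟙 X - e) = 𝟙 X - e := by
    rw [Preadditive.sub_comp, Preadditive.comp_sub, Preadditive.comp_sub, Category.id_comp,
      Category.comp_id, Category.id_comp, hee]
    abel
  calc ((𝟙 X - e) ≫ a) ≫ b ≫ s ≫ (𝟙 X - e) + c ≫ d
      = (𝟙 X - e) ≫ ((a ≫ b) ≫ s) ≫ (𝟙 X - e) + c ≫ d := by simp only [Category.assoc]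
    _ = 𝟙 X := by rw [hs, reassoc_of% h2, h3, hcd, sub_add_cancel]

/-- The stable idempotent `r ≫ i` of `X` has an adjoint `ε` on the representing object `Y`,
idempotent in the projectively stable category. The Fitting idempotent of `ε` is an honest
idempotent with the same stable class, and its image represents `D Ext¹(-, M)`. -/
theorem leftAR_of_stable_retract {X M : A} (hfin : ∀ Y : A, Module.Finite k (Y ⟶ Y))
    (hX : leftAR k A X) {i : M ⟶ X} {r : X ⟶ M} (hir : 𝟙 M - i ≫ r ∈ injTrivial k M M) :
    leftAR k A M := by
  obtain ⟨Y, hY⟩ := hX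
  obtain ⟨γ, hγ⟩ := exists_isLeftDual_iff.1 hY
  obtain ⟨ε, hε⟩ := IsLeftDual.exists_compat γ hγ (r ≫ i)
  have hpost : ∀ Z, extPost k Z (i ≫ r) = LinearMap.id := fun Z => by
    have := hir Z
    rw [extPost_sub, extPost_id, sub_eq_zero] at this
    exact this.symm
  have hεε : FormCompat γ γ (ε ≫ ε) (r ≫ i) := by
    refine (hε.comp hε).trans ?_
    congr 1
    refine LinearMap.ext fun ξ => ?_
    have := LinearMap.congr_fun (hpost Y) (extPost k Y r ξ)
    simp only [extPost_comp_apply, LinearMap.id_apply] at this ⊢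
    rw [this]
  have hidem : (projQ k A).map ε ≫ (projQ k A).map ε = (projQ k A).map ε := by
    rw [← Functor.map_comp]
    exact hεε.projQ_map_eq hγ hε
  have := hfin Y
  obtain ⟨n, e, y, hy, hte, hee⟩ := exists_fitting k ε
  have hpow : ∀ m : ℕ, (projQ k A).map (endPow ε (m + 1)) = (projQ k A).map ε := by
    intro m
    induction m with
    | zero => rw [endPow_succ, endPow_zero, Category.comp_id]
    | succ m ih => rw [endPow_succ, Functor.map_comp, ih, hidem]
  have he : (projQ k A).map e = (projQ k A).map ε := by
    have h1 : (projQ k A).map e ≫ (projQ k A).map ε = (projQ k A).map e := by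
      rw [hy, Functor.map_comp, hpow, Category.assoc, hidem]
    have h2 : (projQ k A).map e ≫ (projQ k A).map ε = (projQ k A).map ε := by
      rw [← hpow n, ← Functor.map_comp, hte]
    rw [← h1, h2]
  have hcompat : FormCompat γ γ e (r ≫ i) := by
    have h1 := congrArg (hγ.equiv Y) he
    rw [hγ.equiv_map, hγ.equiv_map] at h1
    exact h1.trans hε
  obtain ⟨Y', s, q, hsq, hqs⟩ := IsIdempotentComplete.idempotents_split Y e hee
  -- The form on `Ext¹(Y', M)` is `γ` after transport to `Ext¹(Y, X)` along the projection `q : Y ⟶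
  -- Y'` and `i : M ⟶ X`.
  refine IsLeftDual.leftAR (Y := Y') (γ := γ ∘ₗ extPre k q X ∘ₗ extPost k Y' i) fun Z => ⟨?_, ?_⟩
  · intro f hf
    have h1 : q ≫ f ∈ projTrivial k Y Z := (hγ Z).1 _ (LinearMap.ext fun ξ => by
      have h2 := LinearMap.congr_fun hf (extPost k Z r ξ)
      have h3 := LinearMap.congr_fun hcompat (extPre k (q ≫ f) X ξ)
      simp only [LinearMap.comp_apply, LinearMap.zero_apply] at h2 h3 ⊢
      rw [← extPre_comp_apply, ← hqs, Category.assoc, reassoc_of% hsq] at h3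
      rw [h3, ← h2]
      simp only [extPre_comp_apply, extPost_comp_apply, extPre_extPost])
    have h2 := projTrivial_comp_left k s h1
    rwa [reassoc_of% hsq] at h2
  · intro φ
    obtain ⟨g, hg⟩ := (hγ Z).2 (φ ∘ₗ extPost k Z r)
    refine ⟨s ≫ g, LinearMap.ext fun ζ => ?_⟩
    have h1 := LinearMap.congr_fun hg (extPost k Z (i ≫ r ≫ i) ζ)
    have h3 := LinearMap.congr_fun hcompat (extPre k g X (extPost k Z i ζ))
    have h4 : ∀ ζ, extPost k Z r (extPost k Z i ζ) = ζ := fun ζ => by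
      rw [← extPost_comp_apply, hpost]; rfl
    simp only [LinearMap.comp_apply] at h1 h3 ⊢
    rw [← extPre_comp_apply, ← hqs, Category.assoc] at h3
    simp only [extPre_comp_apply, extPost_comp_apply, ← extPre_extPost, h4] at h1 h3 ⊢
    rw [h3, h1]

end Fitting

/-! ### Elements of modules and the Yoneda lemma -/

section ModuleElements

variable {k : Type u} [Field k] {C : Type u} [SmallCategory C] [Preadditive C] [Linear k C]

theorem Mod.hom_ext {M N : Mod k C} {f g : M ⟶ N}
    (h : ∀ (a : C) (x : M.obj.obj a), f.hom.app a x = g.hom.app a x) : f = g := by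
  ext a x
  exact h a x

theorem Mod.naturality {M N : Mod k C} (f : M ⟶ N) {a b : C} (g : a ⟶ b) (x : M.obj.obj a) :
    f.hom.app b (M.obj.map g x) = N.obj.map g (f.hom.app a x) :=
  NatTrans.naturality_apply f.hom g x

theorem Mod.map_comp_apply (M : Mod k C) {a b c : C} (f : a ⟶ b) (g : b ⟶ c) (x : M.obj.obj a) :
    M.obj.map (f ≫ g) x = M.obj.map g (M.obj.map f x) := by
  rw [Functor.map_comp]; rfl

theorem Mod.map_id_apply (M : Mod k C) {a : C} (x : M.obj.obj a) : M.obj.map (𝟙 a) x = x := by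
  rw [CategoryTheory.Functor.map_id]; rfl

theorem Mod.map_add_apply (M : Mod k C) {a b : C} (f g : a ⟶ b) (x : M.obj.obj a) :
    M.obj.map (f + g) x = M.obj.map f x + M.obj.map g x := by
  have := M.property.1
  rw [Functor.map_add]; rfl

theorem Mod.map_smul_apply (M : Mod k C) {a b : C} (c : k) (f : a ⟶ b) (x : M.obj.obj a) :
    M.obj.map (c • f) x = c • M.obj.map f x := by
  have := M.property.2
  rw [Functor.map_smul]; rfl

theorem Mod.map_zero_apply (M : Mod k C) {a b : C} (x : M.obj.obj a) :
    M.obj.map (0 : a ⟶ b) x = 0 := by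
  have := M.property.1
  rw [Functor.map_zero]; rfl

/-- The value of a morphism at an element. -/
def appAt {M : Mod k C} (N : Mod k C) {a : C} (x : M.obj.obj a) : (M ⟶ N) →ₗ[k] N.obj.obj a where
  toFun f := f.hom.app a x
  map_add' _ _ := rfl
  map_smul' _ _ := rfl

theorem Mod.sum_app {M N : Mod k C} {J : Type*} (s : Finset J) (f : J → (M ⟶ N)) {a : C}
    (x : M.obj.obj a) : (∑ j ∈ s, f j).hom.app a x = ∑ j ∈ s, (f j).hom.app a x :=
  map_sum (appAt N x) f s

/-- The morphism from a representable module given by an element. -/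
def elt {M : Mod k C} {a : C} (x : M.obj.obj a) : (repMod k C).obj (op a) ⟶ M :=
  ObjectProperty.homMk
    { app := fun b => ModuleCat.ofHom
        { toFun := fun g : a ⟶ b => M.obj.map g x
          map_add' := fun f g => Mod.map_add_apply M f g x
          map_smul' := fun c g => Mod.map_smul_apply M c g x }
      naturality := fun b c f => by
        ext (g : a ⟶ b)
        exact Mod.map_comp_apply M g f x }

theorem elt_comp {M N : Mod k C} {a : C} (x : M.obj.obj a) (f : M ⟶ N) :
    elt x ≫ f = elt (f.hom.app a x) :=
  Mod.hom_ext fun _ g => Mod.naturality f g x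

theorem eq_elt {M : Mod k C} {a : C} (f : (repMod k C).obj (op a) ⟶ M) :
    f = elt (M := M) (f.hom.app a (𝟙 a : a ⟶ a)) := Mod.hom_ext fun b (g : a ⟶ b) =>
  (congrArg (f.hom.app b) (Category.id_comp g).symm).trans (Mod.naturality f g (𝟙 a : a ⟶ a))

theorem elt_injective {M : Mod k C} {a : C} {x y : M.obj.obj a} (h : elt x = elt y) : x = y := by
  have : M.obj.map (𝟙 a) x = M.obj.map (𝟙 a) y :=
    congrArg (fun f : (repMod k C).obj (op a) ⟶ M => f.hom.app a (𝟙 a : a ⟶ a)) h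
  simpa [Mod.map_id_apply] using this

theorem Mod.surjective_of_epi {M N : Mod k C} (f : M ⟶ N) [Epi f] (a : C) :
    Function.Surjective (f.hom.app a) := by
  have := (isLinear k C).preservesEpimorphisms_ι_of_isNormalMonoCategory
  have h : Epi ((isLinear k C).ι.map f) := inferInstance
  have h2 := (NatTrans.epi_iff_epi_app _).1 h a
  exact (ModuleCat.epi_iff_surjective _).1 h2

theorem Mod.epi_of_surjective {M N : Mod k C} {f : M ⟶ N}
    (h : ∀ a, Function.Surjective (f.hom.app a)) : Epi f where
  left_cancellation g g' hg := Mod.hom_ext fun a y => by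
    obtain ⟨x, rfl⟩ := h a y
    exact congrArg (fun q : M ⟶ _ => q.hom.app a x) hg

theorem Mod.injective_of_mono {M N : Mod k C} (f : M ⟶ N) [Mono f] (a : C) :
    Function.Injective (f.hom.app a) := fun x y h => by
  apply elt_injective
  rw [← cancel_mono f, elt_comp, elt_comp, h]

theorem Mod.exact_of_pointwise {M N K : Mod k C} {f : M ⟶ N} {g : N ⟶ K} (w : f ≫ g = 0)
    (h : ∀ (a : C) (y : N.obj.obj a), g.hom.app a y = 0 → ∃ x, f.hom.app a x = y) :
    (ShortComplex.mk f g w).Exact := by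
  rw [ShortComplex.exact_iff_epi_kernel_lift]
  refine Mod.epi_of_surjective fun a (y : (kernel g).obj.obj a) => ?_
  have hy : g.hom.app a ((kernel.ι g).hom.app a y) = 0 :=
    congrArg (fun q : kernel g ⟶ K => q.hom.app a y) (kernel.condition g)
  obtain ⟨x, hx⟩ := h a _ hy
  refine ⟨x, Mod.injective_of_mono (kernel.ι g) a ?_⟩
  refine Eq.trans ?_ hx
  exact congrArg (fun q : M ⟶ N => q.hom.app a x) (kernel.lift_ι g f w)

instance (a : C) : Projective ((repMod k C).obj (op a)) where
  factors {M N} f e _ := by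
    obtain ⟨x, hx⟩ := Mod.surjective_of_epi e a (f.hom.app a (𝟙 a : a ⟶ a))
    refine ⟨elt x, ?_⟩
    rw [elt_comp, hx]
    exact (eq_elt f).symm

theorem Mod.exists_of_exact {M N K : Mod k C} {f : M ⟶ N} {g : N ⟶ K} {w : f ≫ g = 0}
    (h : (ShortComplex.mk f g w).Exact) (a : C) (y : N.obj.obj a) (hy : g.hom.app a y = 0) :
    ∃ x, f.hom.app a x = y := by
  have h1 : elt y ≫ g = 0 := by
    rw [elt_comp, hy]
    exact Mod.hom_ext fun b q => map_zero (K.obj.map q).hom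
  have h2 := h.liftFromProjective_comp (elt y) h1
  generalize h.liftFromProjective (elt y) h1 = q at h2
  refine ⟨q.hom.app a (𝟙 a : a ⟶ a), ?_⟩
  have h3 : (q ≫ f).hom.app a (𝟙 a : a ⟶ a) = (elt y).hom.app a (𝟙 a : a ⟶ a) :=
    congrArg (fun q : _ ⟶ N => q.hom.app a (𝟙 a : a ⟶ a)) h2
  exact h3.trans (Mod.map_id_apply N y)

end ModuleElements

/-! ### Generators, dual bases and minimal projective presentations -/

section Generation

attribute [local instance] Abelian.hasFiniteBiproducts

variable {k : Type u} [Field k] {C : Type u} [SmallCategory C] [Preadditive C] [Linear k C]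

theorem proj_of_retract {P Q : Mod k C} (r : Retract P Q) (hQ : proj k C Q) : proj k C P := by
  obtain ⟨J, hJ, X, hX, ⟨s⟩⟩ := hQ
  exact ⟨J, hJ, X, hX, ⟨r.trans s⟩⟩

/-- A projective module is a summand of a finite sum of representables exactly when it has a finite
dual basis. -/
theorem proj_iff {P : Mod k C} : proj k C P ↔ ∃ (J : Type) (_ : Fintype J) (pt : J → C)
    (x : ∀ j, P.obj.obj (pt j)) (φ : ∀ j, P ⟶ (repMod k C).obj (op (pt j))),
    ∑ j, φ j ≫ elt (x j) = 𝟙 P := by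
  constructor
  · rintro ⟨J, hJ, X, hX, ⟨r⟩⟩
    have := Fintype.ofFinite J
    choose pt hpt using fun j => (ObjectProperty.ofObj_iff _ _).1 (hX j)
    obtain rfl : (fun j => (repMod k C).obj (op (pt j))) = X := funext hpt
    refine ⟨J, this, pt, fun j => (biproduct.ι _ j ≫ r.r).hom.app (pt j) (𝟙 (pt j) : pt j ⟶ pt j),
      fun j => r.i ≫ biproduct.π _ j, ?_⟩
    have h1 : ∀ j, elt (M := P)
        ((biproduct.ι (fun j => (repMod k C).obj (op (pt j))) j ≫ r.r).hom.app (pt j)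
          (𝟙 (pt j) : pt j ⟶ pt j)) = biproduct.ι _ j ≫ r.r := fun j => (eq_elt _).symm
    simp only [h1]
    rw [← r.retract]
    calc _ = r.i ≫ (∑ j, biproduct.π (fun j => (repMod k C).obj (op (pt j))) j ≫
          biproduct.ι (fun j => (repMod k C).obj (op (pt j))) j) ≫ r.r := by
            simp only [Preadditive.comp_sum, Preadditive.sum_comp, Category.assoc]
      _ = _ := by rw [biproduct.total, Category.id_comp]
  · rintro ⟨J, hJ, pt, x, φ, h⟩
    refine ⟨J, inferInstance, fun j => (repMod k C).obj (op (pt j)),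
      fun j => (ObjectProperty.ofObj_iff _ _).2 ⟨pt j, rfl⟩,
      ⟨⟨biproduct.lift φ, biproduct.desc fun j => elt (x j), ?_⟩⟩⟩
    rw [biproduct.lift_desc, h]

theorem projective_of_proj {P : Mod k C} (hP : proj k C P) : Projective P where
  factors {M N} f e _ := by
    obtain ⟨J, _, pt, x, φ, h⟩ := proj_iff.1 hP
    choose y hy using fun j => Mod.surjective_of_epi e (pt j) (f.hom.app _ (x j))
    refine ⟨∑ j, φ j ≫ elt (y j), ?_⟩
    rw [Preadditive.sum_comp]
    simp only [Category.assoc, elt_comp, hy]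
    simp only [← elt_comp]
    simp only [← Category.assoc]
    rw [← Preadditive.sum_comp, h, Category.id_comp]

/-- A finite family of elements generates the module. -/
theorem fg_iff {M : Mod k C} : fg k C M ↔ ∃ (J : Type) (_ : Fintype J) (pt : J → C)
    (x : ∀ j, M.obj.obj (pt j)), ∀ (b : C) (y : M.obj.obj b), ∃ g : ∀ j, pt j ⟶ b,
      ∑ j, M.obj.map (g j) (x j) = y := by
  constructor
  · rintro ⟨P, f, hP, hf⟩
    obtain ⟨J, hJ, pt, x, φ, h⟩ := proj_iff.1 hP
    refine ⟨J, hJ, pt, fun j => f.hom.app _ (x j), fun b y => ?_⟩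
    obtain ⟨z, rfl⟩ := Mod.surjective_of_epi f b y
    refine ⟨fun j => (φ j).hom.app b z, ?_⟩
    have h1 : (∑ j, φ j ≫ elt (x j)).hom.app b z = z := by rw [h]; rfl
    rw [Mod.sum_app] at h1
    conv_rhs => rw [← h1]
    rw [map_sum]
    exact Finset.sum_congr rfl fun j _ => (Mod.naturality f _ _).symm
  · rintro ⟨J, hJ, pt, x, h⟩
    have hP : proj k C (⨁ fun j => (repMod k C).obj (op (pt j))) :=
      ⟨J, inferInstance, _, fun j => (ObjectProperty.ofObj_iff _ _).2 ⟨pt j, rfl⟩, ⟨Retract.refl _⟩⟩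
    refine ⟨_, biproduct.desc fun j => elt (x j), hP, Mod.epi_of_surjective fun b y => ?_⟩
    obtain ⟨g, rfl⟩ := h b y
    refine ⟨∑ j, (biproduct.ι (fun j => (repMod k C).obj (op (pt j))) j).hom.app b (g j), ?_⟩
    rw [map_sum]
    refine Finset.sum_congr rfl fun j _ => ?_
    exact congrArg (fun q : (repMod k C).obj (op (pt j)) ⟶ M => q.hom.app b (g j))
      (biproduct.ι_desc (fun j => elt (x j)) j)

theorem fg_of_proj {P : Mod k C} (hP : proj k C P) : fg k C P := ⟨P, 𝟙 P, hP, inferInstance⟩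

theorem finite_app_of_fg (hfin : ∀ a b : C, Module.Finite k (a ⟶ b)) {M : Mod k C}
    (hM : fg k C M) (b : C) : Module.Finite k (M.obj.obj b) := by
  obtain ⟨J, _, pt, x, h⟩ := fg_iff.1 hM
  let L : (∀ j, pt j ⟶ b) →ₗ[k] M.obj.obj b :=
    ∑ j, ((elt (x j)).hom.app b).hom ∘ₗ LinearMap.proj (R := k) (φ := fun j => pt j ⟶ b) j
  refine Module.Finite.of_surjective L fun y => ?_
  obtain ⟨g, rfl⟩ := h b y
  refine ⟨g, ?_⟩
  rw [LinearMap.sum_apply]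
  rfl

theorem finite_hom {M N : Mod k C} (hM : fg k C M) (hN : ∀ b, Module.Finite k (N.obj.obj b)) :
    Module.Finite k (M ⟶ N) := by
  obtain ⟨J, _, pt, x, h⟩ := fg_iff.1 hM
  refine Module.Finite.of_injective (LinearMap.pi fun j => appAt N (x j)) fun f g hfg => ?_
  refine Mod.hom_ext fun b y => ?_
  obtain ⟨q, rfl⟩ := h b y
  rw [map_sum, map_sum]
  refine Finset.sum_congr rfl fun j _ => ?_
  rw [Mod.naturality, Mod.naturality]
  exact congrArg _ (congrFun hfg j)

/-- Lift the cover and an epimorphism from `Q` through each other. The composite endomorphism of `P`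
lies over `M`, so minimality makes it invertible and `P` is a retract of `Q`. -/
theorem proj_of_isProjectiveCover {P M : Mod k C} {f : P ⟶ M} (hf : IsProjectiveCover f)
    (hM : fg k C M) : proj k C P := by
  obtain ⟨Q, g, hQ, _⟩ := hM
  have := projective_of_proj hQ
  have := hf.projective
  have := hf.epi
  have h := hf.minimal (Projective.factorThru f g ≫ Projective.factorThru g f) (by simp)
  exact proj_of_retract ⟨Projective.factorThru f g, Projective.factorThru g f ≫
    inv (Projective.factorThru f g ≫ Projective.factorThru g f), by simp [← Category.assoc]⟩ hQ

/-- Finite generation of kernels is a hypothesis because it has different sources in the two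
applications: the Noetherian condition for `C`, finite dimensionality for `Cᵒᵖ`. -/
theorem exists_minPres (hfin : ∀ a b : C, Module.Finite k (a ⟶ b)) {M : Mod k C} (hM : fg k C M)
    (hker : ∀ (P : Mod k C) (f : P ⟶ M), proj k C P → fg k C (kernel f)) :
    Nonempty (MinPres M) := by
  have key : ∀ {M : Mod k C}, fg k C M →
      ∃ (P : Mod k C) (f : P ⟶ M), proj k C P ∧ IsProjectiveCover f := fun {M} hM =>
    exists_projectiveCover k (proj k C) proj_of_retract
      (fun P hP => finite_hom (fg_of_proj hP) (finite_app_of_fg hfin (fg_of_proj hP)))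
      (fun P hP => projective_of_proj hP) hM
  obtain ⟨P₀, f₀, hP₀, h₀⟩ := key hM
  obtain ⟨P₁, π, hP₁, h₁⟩ := key (hker P₀ f₀ hP₀)
  have := h₁.epi
  have w : (π ≫ kernel.ι f₀) ≫ f₀ = 0 := by simp
  refine ⟨⟨P₁, P₀, π ≫ kernel.ι f₀, f₀, w, ?_, h₀, ?_⟩⟩
  · rw [ShortComplex.exact_iff_epi_kernel_lift]
    have : kernel.lift f₀ (π ≫ kernel.ι f₀) w = π := by
      rw [← cancel_mono (kernel.ι f₀), kernel.lift_ι]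
    dsimp only
    rw [this]
    infer_instance
  · refine ⟨h₁.projective, inferInstance, fun g hg => h₁.minimal g ?_⟩
    rw [← cancel_mono (kernel.ι f₀), Category.assoc,
      ← Abelian.image.fac (π ≫ kernel.ι f₀), reassoc_of% hg]

end Generation

/-! ### Finite dimensional modules and the role of type `A_∞` -/

section FiniteDimensional

variable {k : Type u} [Field k] {C : Type u} [SmallCategory C] [Preadditive C] [Linear k C]

theorem fd_of_mono {M N : Mod k C} (f : M ⟶ N) [Mono f] (hN : fd k C N) : fd k C M := by
  refine ⟨hN.1.subset fun a ha => ?_, fun a => ?_⟩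
  · have : Nontrivial (M.obj.obj a) := ha
    exact (Mod.injective_of_mono f a).nontrivial
  · have := hN.2 a
    exact Module.Finite.of_injective (f.hom.app a).hom (Mod.injective_of_mono f a)

theorem fd_of_epi {M N : Mod k C} (f : M ⟶ N) [Epi f] (hM : fd k C M) : fd k C N := by
  refine ⟨hM.1.subset fun a ha => ?_, fun a => ?_⟩
  · have : Nontrivial (N.obj.obj a) := ha
    exact (Mod.surjective_of_epi f a).nontrivial
  · have := hM.2 a
    exact Module.Finite.of_surjective (f.hom.app a).hom (Mod.surjective_of_epi f a)

/-- Bases of the finitely many nonzero values generate, already using multiples of identity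
morphisms. -/
theorem fg_of_fd {M : Mod k C} (hM : fd k C M) : fg k C M := by
  have := hM.2
  have := hM.1.fintype
  let S := {a : C | Nontrivial (M.obj.obj a)}
  let J := Σ a : S, Fin (Module.finrank k (M.obj.obj a.1))
  have : Finite J := inferInstance
  obtain ⟨n, ⟨e⟩⟩ := Finite.exists_equiv_fin J
  let bas : ∀ a : C, Module.Basis (Fin (Module.finrank k (M.obj.obj a))) k (M.obj.obj a) :=
    fun a => Module.finBasis k _
  refine fg_iff.2 ⟨Fin n, inferInstance, fun j => (e.symm j).1.1, fun j => bas _ (e.symm j).2,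
    fun b y => ?_⟩
  classical
  by_cases hb : b ∈ S
  · let g : ∀ j : J, j.1.1 ⟶ b := fun j =>
      if h : j.1 = ⟨b, hb⟩ then
        (bas j.1.1).repr (M.obj.map (eqToHom (congrArg Subtype.val h).symm) y) j.2 •
          eqToHom (congrArg Subtype.val h) else 0
    refine ⟨fun j => g (e.symm j), ?_⟩
    rw [e.symm.sum_comp (fun j : J => M.obj.map (g j) (bas j.1.1 j.2)), Fintype.sum_sigma,
      Finset.sum_eq_single ⟨b, hb⟩]
    · conv_rhs => rw [← (bas b).sum_repr y]
      refine Finset.sum_congr rfl fun i _ => ?_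
      simp [g, Mod.map_smul_apply]
    · intro a _ ha
      refine Finset.sum_eq_zero fun i _ => ?_
      simp [g, ha, Mod.map_zero_apply]
    · simp
  · have : Subsingleton (M.obj.obj b) := not_nontrivial_iff_subsingleton.1 hb
    exact ⟨fun _ => 0, Subsingleton.elim _ _⟩

theorem fd_dual {M : Mod k C} (hM : fd k C M) : fd k Cᵒᵖ ((dual k C).obj (op M)) := by
  refine ⟨(hM.1.image op).subset fun a ha => ?_, fun a => ?_⟩
  · have h : Nontrivial (Module.Dual k (M.obj.obj a.unop)) := ha
    refine ⟨a.unop, ?_, rfl⟩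
    by_contra hn
    have : Subsingleton (M.obj.obj a.unop) := not_nontrivial_iff_subsingleton.1 hn
    exact not_subsingleton_iff_nontrivial.2 h inferInstance
  · have := hM.2 a.unop
    exact inferInstanceAs (Module.Finite k (Module.Dual k (M.obj.obj a.unop)))

theorem fd_unopop {M : Mod k Cᵒᵖᵒᵖ} (hM : fd k Cᵒᵖᵒᵖ M) : fd k C (unopop.obj M) :=
  ⟨(hM.1.image fun a => a.unop.unop).subset fun a ha => ⟨op (op a), ha, rfl⟩,
    fun a => hM.2 (op (op a))⟩

theorem finite_setOf_le {C : Type*} (e : C ≃ ℕ) {J : Type*} [Finite J] (pt : J → C) :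
    {a : C | ∃ j, e a ≤ e (pt j)}.Finite := by
  have : {a : C | ∃ j, e a ≤ e (pt j)} = ⋃ j, e ⁻¹' Set.Iic (e (pt j)) := by ext; simp
  rw [this]
  exact Set.finite_iUnion fun j => (Set.finite_Iic _).preimage e.injective.injOn

theorem finite_hom_op (hfin : ∀ a b : C, Module.Finite k (a ⟶ b)) (a b : Cᵒᵖ) :
    Module.Finite k (a ⟶ b) :=
  have := hfin b.unop a.unop
  Module.Finite.of_surjective
    ({ toFun := fun f => f.op, map_add' := fun _ _ => rfl, map_smul' := fun _ _ => rfl } :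
      (b.unop ⟶ a.unop) →ₗ[k] (a ⟶ b))
    fun f => ⟨f.unop, rfl⟩

/-- The representable `C(-, a)` lives only on objects not exceeding `a` in the order transported
from `ℕ`, of which there are finitely many. -/
theorem fd_of_fg_op (e : C ≃ ℕ) (hA : ∀ a b : C, e a < e b → ∀ f : b ⟶ a, f = 0)
    (hfin : ∀ a b : C, Module.Finite k (a ⟶ b)) {M : Mod k Cᵒᵖ}
    (hM : fg k Cᵒᵖ M) : fd k Cᵒᵖ M := by
  refine ⟨?_, finite_app_of_fg (finite_hom_op hfin) hM⟩
  · obtain ⟨J, _, pt, x, h⟩ := fg_iff.1 hM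
    refine ((finite_setOf_le e fun j => (pt j).unop).image op).subset fun a ha => ?_
    refine ⟨a.unop, ?_, rfl⟩
    by_contra hn
    simp only [Set.mem_ofPred_eq, not_exists, not_le] at hn
    have : Nontrivial (M.obj.obj a) := ha
    obtain ⟨y, hy⟩ := exists_ne (0 : M.obj.obj a)
    obtain ⟨g, rfl⟩ := h a y
    refine hy (Finset.sum_eq_zero fun j _ => ?_)
    have : g j = 0 := Quiver.Hom.unop_inj (hA _ _ (hn j) (g j).unop)
    rw [this, Mod.map_zero_apply]

/-- A morphism `P ⟶ C(a, -)` is determined by its values on the generators of `P`, which lie in the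
spaces `C(a, pt j)`. These all vanish once `a` exceeds every `pt j`. -/
theorem fd_star (e : C ≃ ℕ) (hA : ∀ a b : C, e a < e b → ∀ f : b ⟶ a, f = 0)
    (hfin : ∀ a b : C, Module.Finite k (a ⟶ b))
    {P : Mod k C} (hP : proj k C P) : fd k Cᵒᵖ ((star k C).obj (op P)) := by
  refine ⟨?_, fun b => ?_⟩
  · obtain ⟨J, _, pt, x, h⟩ := fg_iff.1 (fg_of_proj hP)
    refine ((finite_setOf_le e pt).image op).subset fun a ha => ?_
    refine ⟨a.unop, ?_, rfl⟩
    by_contra hn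
    simp only [Set.mem_ofPred_eq, not_exists, not_le] at hn
    have : Nontrivial (P ⟶ (repMod k C).obj a) := ha
    obtain ⟨f, hf⟩ := exists_ne (0 : P ⟶ (repMod k C).obj a)
    refine hf (Mod.hom_ext fun b y => ?_)
    obtain ⟨g, rfl⟩ := h b y
    rw [map_sum]
    refine Finset.sum_eq_zero fun j _ => ?_
    have : f.hom.app (pt j) (x j) = 0 := hA _ _ (hn j) (f.hom.app (pt j) (x j) : a.unop ⟶ pt j)
    rw [Mod.naturality, this, map_zero]
  · exact finite_hom (fg_of_proj hP) fun a => hfin b.unop a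

end FiniteDimensional

/-! ### Dual pairs of projectives, perfect pairings and trace forms -/

section DualPairs

variable {k : Type u} [Field k] {C : Type u} [SmallCategory C] [Preadditive C] [Linear k C]

/-- A morphism `B : Q ⟶ P^*` together with finite dual bases of `P` and `Q`. -/
structure DualPair (P : Mod k C) (Q : Mod k Cᵒᵖ) where
  B : Q ⟶ (star k C).obj (op P)
  J : Type
  fintype : Fintype J
  pt : J → C
  x (j : J) : P.obj.obj (pt j)
  φ (j : J) : Q.obj.obj (op (pt j))
  sum_x {b : C} (y : P.obj.obj b) :
    ∑ j, P.obj.map ((B.hom.app (op (pt j)) (φ j) : P ⟶ (repMod k C).obj (op (pt j))).hom.app b y :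
      pt j ⟶ b) (x j) = y
  sum_φ {a : C} (ψ : Q.obj.obj (op a)) :
    ∑ j, Q.obj.map ((B.hom.app (op a) ψ : P ⟶ (repMod k C).obj (op a)).hom.app (pt j) (x j) :
      a ⟶ pt j).op (φ j) = ψ

namespace DualPair

attribute [instance] DualPair.fintype

variable {P P' : Mod k C} {Q Q' : Mod k Cᵒᵖ} (D : DualPair P Q) (D' : DualPair P' Q')

def pair {a b : C} (φ : Q.obj.obj (op a)) (y : P.obj.obj b) : a ⟶ b :=
  (D.B.hom.app (op a) φ : P ⟶ (repMod k C).obj (op a)).hom.app b y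

theorem sum_pair_x {b : C} (y : P.obj.obj b) :
    ∑ j, P.obj.map (D.pair (D.φ j) y) (D.x j) = y := D.sum_x y

theorem sum_pair_φ {a : C} (ψ : Q.obj.obj (op a)) :
    ∑ j, Q.obj.map (D.pair ψ (D.x j)).op (D.φ j) = ψ := D.sum_φ ψ

/-- The morphism `P ⟶ X` given by elements of `Q(a)` and `X(a)`. -/
def hom {a : C} {X : Mod k C} (φ : Q.obj.obj (op a)) (x : X.obj.obj a) : P ⟶ X :=
  (D.B.hom.app (op a) φ : P ⟶ (repMod k C).obj (op a)) ≫ elt x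

theorem hom_app {a : C} {X : Mod k C} (φ : Q.obj.obj (op a)) (x : X.obj.obj a) {b : C}
    (y : P.obj.obj b) : (D.hom φ x).hom.app b y = X.obj.map (D.pair φ y) x := rfl

theorem hom_add_left {a : C} {X : Mod k C} (φ ψ : Q.obj.obj (op a)) (x : X.obj.obj a) :
    D.hom (φ + ψ) x = D.hom φ x + D.hom ψ x := by
  unfold hom
  rw [map_add]
  exact Preadditive.add_comp _ _ _ _ _ _

theorem hom_smul_left {a : C} {X : Mod k C} (c : k) (φ : Q.obj.obj (op a)) (x : X.obj.obj a) :
    D.hom (c • φ) x = c • D.hom φ x := by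
  unfold hom
  rw [map_smul]
  exact Linear.smul_comp _ _ _ _ _ _

theorem hom_add_right {a : C} {X : Mod k C} (φ : Q.obj.obj (op a)) (x y : X.obj.obj a) :
    D.hom φ (x + y) = D.hom φ x + D.hom φ y :=
  Mod.hom_ext fun _ z => map_add (X.obj.map (D.pair φ z)).hom x y

theorem hom_smul_right {a : C} {X : Mod k C} (c : k) (φ : Q.obj.obj (op a)) (x : X.obj.obj a) :
    D.hom φ (c • x) = c • D.hom φ x :=
  Mod.hom_ext fun _ z => map_smul (X.obj.map (D.pair φ z)).hom c x

theorem hom_map {a b : C} {X : Mod k C} (φ : Q.obj.obj (op b)) (f : a ⟶ b) (x : X.obj.obj a) :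
    D.hom φ (X.obj.map f x) = D.hom (Q.obj.map f.op φ) x := by
  refine Mod.hom_ext fun c y => ?_
  rw [hom_app, hom_app, ← Mod.map_comp_apply]
  refine congrArg (fun g : a ⟶ c => X.obj.map g x) ?_
  exact congrArg (fun q : P ⟶ (repMod k C).obj (op a) => q.hom.app c y)
    (Mod.naturality D.B f.op φ).symm

theorem sum_hom {X : Mod k C} (p : P ⟶ X) :
    ∑ j, D.hom (D.φ j) (p.hom.app _ (D.x j)) = p := by
  refine Mod.hom_ext fun b y => ?_
  rw [Mod.sum_app]
  conv_rhs => rw [← D.sum_pair_x y, map_sum]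
  refine Finset.sum_congr rfl fun j _ => ?_
  rw [hom_app, Mod.naturality]

/-- The morphisms `f : P ⟶ P'` and `f' : Q' ⟶ Q` are adjoint for the pairings. -/
def Adjoint (f : P ⟶ P') (f' : Q' ⟶ Q) : Prop :=
  f' ≫ D.B = D'.B ≫ (star k C).map f.op

variable {D D'}

theorem Adjoint.pair_eq {f : P ⟶ P'} {f' : Q' ⟶ Q} (h : Adjoint D D' f f') {a b : C}
    (ψ : Q'.obj.obj (op a)) (y : P.obj.obj b) :
    D.pair (f'.hom.app (op a) ψ) y = D'.pair ψ (f.hom.app b y) :=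
  congrArg (fun q : Q' ⟶ (star k C).obj (op P) =>
    (q.hom.app (op a) ψ : P ⟶ (repMod k C).obj (op a)).hom.app b y) h

theorem Adjoint.hom_eq {f : P ⟶ P'} {f' : Q' ⟶ Q} (h : Adjoint D D' f f') {a : C} {X : Mod k C}
    (ψ : Q'.obj.obj (op a)) (x : X.obj.obj a) :
    D.hom (f'.hom.app (op a) ψ) x = f ≫ D'.hom ψ x :=
  Mod.hom_ext fun b y => by
    rw [hom_app, h.pair_eq]
    rfl

end DualPair

/-- A balanced pairing between a module `N` and a module `Z` over the opposite category that
identifies `N` with `D Z`. -/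
structure PerfectPairing (N : Mod k C) (Z : Mod k Cᵒᵖ) where
  toDual (a : C) : N.obj.obj a →ₗ[k] Module.Dual k (Z.obj.obj (op a))
  balanced {a b : C} (f : a ⟶ b) (x : N.obj.obj a) (z : Z.obj.obj (op b)) :
    toDual b (N.obj.map f x) z = toDual a x (Z.obj.map f.op z)
  bijective (a : C) : Function.Bijective (toDual a)

variable {P P' N : Mod k C} {Q Q' Z : Mod k Cᵒᵖ}

/-- The trace form on `Hom(P, N)`. -/
def traceForm (D : DualPair P Q) (β : PerfectPairing N Z) (ζ : Q ⟶ Z) : Module.Dual k (P ⟶ N) where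
  -- Morphisms `P ⟶ N` are sums of `D.hom φ n`, as in `Q ⊗ N`; on such a morphism this form takes
  -- the value of `β` at `n` and `ζ φ`.
  toFun h := ∑ j, β.toDual _ (h.hom.app _ (D.x j)) (ζ.hom.app _ (D.φ j))
  map_add' f g := by
    rw [← Finset.sum_add_distrib]
    refine Finset.sum_congr rfl fun j _ => ?_
    change β.toDual _ (f.hom.app _ (D.x j) + g.hom.app _ (D.x j)) _ = _
    rw [map_add]
    rfl
  map_smul' c f := by
    rw [RingHom.id_apply, Finset.smul_sum]
    refine Finset.sum_congr rfl fun j _ => ?_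
    change β.toDual _ (c • f.hom.app _ (D.x j)) _ = _
    rw [map_smul]
    rfl

theorem traceForm_apply (D : DualPair P Q) (β : PerfectPairing N Z) (ζ : Q ⟶ Z) (h : P ⟶ N) :
    traceForm D β ζ h = ∑ j, β.toDual _ (h.hom.app _ (D.x j)) (ζ.hom.app _ (D.φ j)) := rfl

/-- Cyclicity of the trace: expand `f (x j)` in the dual basis of `P'`, move the coefficients across
the balanced pairing, exchange the sums, and resum over the dual basis of `Q`. -/
theorem traceForm_comp {D : DualPair P Q} {D' : DualPair P' Q'} {f : P ⟶ P'} {f' : Q' ⟶ Q}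
    (hf : DualPair.Adjoint D D' f f') (β : PerfectPairing N Z) (ζ : Q ⟶ Z) (h : P' ⟶ N) :
    traceForm D β ζ (f ≫ h) = traceForm D' β (f' ≫ ζ) h := by
  have e1 : ∀ j, β.toDual (D.pt j) ((f ≫ h).hom.app _ (D.x j)) (ζ.hom.app _ (D.φ j)) =
      ∑ i, β.toDual _ (h.hom.app _ (D'.x i))
        (ζ.hom.app _ (Q.obj.map (D.pair (f'.hom.app _ (D'.φ i)) (D.x j)).op (D.φ j))) := by
    intro j
    have : (f ≫ h).hom.app _ (D.x j) =
        ∑ i, N.obj.map (D'.pair (D'.φ i) (f.hom.app _ (D.x j))) (h.hom.app _ (D'.x i)) := by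
      change h.hom.app _ (f.hom.app _ (D.x j)) = _
      conv_lhs => rw [← D'.sum_pair_x (f.hom.app _ (D.x j)), map_sum]
      exact Finset.sum_congr rfl fun i _ => Mod.naturality h _ _
    rw [this, map_sum, LinearMap.sum_apply]
    refine Finset.sum_congr rfl fun i _ => ?_
    rw [β.balanced, ← hf.pair_eq, Mod.naturality]
  rw [traceForm_apply, traceForm_apply, Finset.sum_congr rfl fun j _ => e1 j, Finset.sum_comm]
  refine Finset.sum_congr rfl fun i _ => ?_
  rw [← map_sum, ← map_sum, D.sum_pair_φ]
  rfl

theorem traceForm_map {N' : Mod k C} {Z' : Mod k Cᵒᵖ} (D : DualPair P Q) {β : PerfectPairing N Z}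
    {β' : PerfectPairing N' Z'} {w : N ⟶ N'} {u : Z' ⟶ Z}
    (h : ∀ (a : C) (x : N.obj.obj a) (z : Z'.obj.obj (op a)),
      β'.toDual a (w.hom.app a x) z = β.toDual a x (u.hom.app (op a) z))
    (ζ : Q ⟶ Z') (p : P ⟶ N) : traceForm D β' ζ (p ≫ w) = traceForm D β (ζ ≫ u) p :=
  Finset.sum_congr rfl fun _ _ => h _ _ _

theorem traceForm_zero (D : DualPair P Q) (β : PerfectPairing N Z) (h : P ⟶ N) :
    traceForm D β 0 h = 0 := Finset.sum_eq_zero fun _ _ => map_zero (β.toDual _ _)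

/-- The trace form exhibits `N` as the kernel of the morphism of Nakayama functors. -/
theorem isNakayama_traceForm {P₁ P₀ N : Mod k C} {Q₁ Q₀ Z : Mod k Cᵒᵖ} {D₁ : DualPair P₁ Q₁}
    {D₀ : DualPair P₀ Q₀} {f : P₁ ⟶ P₀} {f' : Q₀ ⟶ Q₁} (hf : DualPair.Adjoint D₁ D₀ f f')
    (β : PerfectPairing N Z) {ζ : Q₁ ⟶ Z} {w : f' ≫ ζ = 0} (hζ : (ShortComplex.mk f' ζ w).Exact)
    [Epi ζ] : IsNakayama f (traceForm D₁ β ζ) where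
  vanish g := by rw [traceForm_comp hf, w, traceForm_zero]
  exists_lift {X} l hl := by
    -- The form `l` is a balanced bilinear form on `Q₁` and `X`, that is, a morphism `Q₁ ⟶ D X`.
    -- Vanishing of `l` on morphisms through `f` says that it factors through the cokernel `Z`;
    -- transposing `Z ⟶ D X` and using `N ≅ D Z` gives `X ⟶ N`.
    let t : Q₁ ⟶ (dual k C).obj (op X) := ObjectProperty.homMk
      { app := fun a => ModuleCat.ofHom
          (LinearMap.mk₂ k (fun (φ : Q₁.obj.obj a) (x : X.obj.obj a.unop) =>
              l (D₁.hom (a := a.unop) φ x))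
            (fun φ ψ x => by rw [D₁.hom_add_left, map_add])
            (fun c φ x => by rw [D₁.hom_smul_left, map_smul])
            (fun φ x y => by rw [D₁.hom_add_right, map_add])
            (fun c φ x => by rw [D₁.hom_smul_right, map_smul]))
        naturality := fun a b g => by
          refine ModuleCat.hom_ext (LinearMap.ext fun φ => LinearMap.ext
            fun (x : X.obj.obj b.unop) => ?_)
          exact congrArg l (D₁.hom_map (a := b.unop) (b := a.unop) φ g.unop x).symm }
    have ht : f' ≫ t = 0 := Mod.hom_ext fun a ψ => LinearMap.ext fun (x : X.obj.obj a.unop) => by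
      change l (D₁.hom (a := a.unop) (f'.hom.app a ψ) x) = 0
      rw [hf.hom_eq (a := a.unop), hl]
    let u : Z ⟶ (dual k C).obj (op X) := hζ.desc t ht
    have hu : ζ ≫ u = t := hζ.g_desc t ht
    let E : ∀ a, N.obj.obj a ≃ₗ[k] Module.Dual k (Z.obj.obj (op a)) := fun a =>
      LinearEquiv.ofBijective (β.toDual a) (β.bijective a)
    have hE : ∀ a y, E a y = β.toDual a y := fun _ _ => rfl
    let u' : ∀ a : C, Z.obj.obj (op a) →ₗ[k] X.obj.obj a →ₗ[k] k := fun a => (u.hom.app (op a)).hom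
    let h : X ⟶ N := ObjectProperty.homMk
      { app := fun a => ModuleCat.ofHom ((E a).symm.toLinearMap ∘ₗ (u' a).flip)
        naturality := fun a b g => by
          ext x
          refine (E b).injective (LinearMap.ext fun z => ?_)
          change E b ((E b).symm ((u' b).flip (X.obj.map g x))) z =
            E b (N.obj.map g ((E a).symm ((u' a).flip x))) z
          rw [LinearEquiv.apply_symm_apply, hE, β.balanced, ← hE, LinearEquiv.apply_symm_apply]
          exact LinearMap.congr_fun (Mod.naturality u g.op z).symm x }
    have hh : ∀ a (x : X.obj.obj a) z, β.toDual a (h.hom.app a x) z = u' a z x := fun a x z =>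
      LinearMap.congr_fun ((E a).apply_symm_apply ((u' a).flip x)) z
    refine ⟨h, fun p => ?_⟩
    conv_rhs => rw [← D₁.sum_hom p, map_sum]
    refine Finset.sum_congr rfl fun j _ => ?_
    refine (hh _ _ _).trans ?_
    exact LinearMap.congr_fun (congrArg (fun q : Q₁ ⟶ _ => q.hom.app _ (D₁.φ j)) hu) _
  hom_ext {X h h'} H := by
    -- On elementary morphisms the trace form evaluates `β` at `h x` and `ζ φ`. Since `ζ` is onto
    -- and `β` is perfect, these values determine `h`.
    have key : ∀ (h : X ⟶ N) (a : C) (φ : Q₁.obj.obj (op a)) (x : X.obj.obj a),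
        traceForm D₁ β ζ (D₁.hom φ x ≫ h) = β.toDual a (h.hom.app a x) (ζ.hom.app _ φ) := by
      intro h a φ x
      conv_rhs => rw [← D₁.sum_pair_φ φ, map_sum, map_sum]
      refine Finset.sum_congr rfl fun j _ => ?_
      rw [Mod.naturality, ← β.balanced, ← Mod.naturality]
      rfl
    refine Mod.hom_ext fun a x => (β.bijective a).1 (LinearMap.ext fun z => ?_)
    obtain ⟨φ, rfl⟩ := Mod.surjective_of_epi ζ (op a) z
    rw [← key, ← key, H]

theorem sum_comp_elt {J : Type} [Fintype J] {pt : J → C} {x : ∀ j, P.obj.obj (pt j)}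
    {φ : ∀ j, P ⟶ (repMod k C).obj (op (pt j))} (h : ∑ j, φ j ≫ elt (x j) = 𝟙 P) {X : Mod k C}
    (ψ : P ⟶ X) : ∑ j, φ j ≫ elt (ψ.hom.app _ (x j)) = ψ := by
  simp only [← elt_comp]
  simp only [← Category.assoc]
  rw [← Preadditive.sum_comp, h, Category.id_comp]

/-- The dual pair `(P, P^*)` of a finitely generated projective module. -/
def starPair {P : Mod k C} (hP : proj k C P) : DualPair P ((star k C).obj (op P)) :=
  have h := proj_iff.1 hP
  { B := 𝟙 _
    J := h.choose
    fintype := h.choose_spec.choose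
    pt := h.choose_spec.choose_spec.choose
    x := h.choose_spec.choose_spec.choose_spec.choose
    φ := h.choose_spec.choose_spec.choose_spec.choose_spec.choose
    sum_x := fun {b} y => by
      let := h.choose_spec.choose
      have h1 := h.choose_spec.choose_spec.choose_spec.choose_spec.choose_spec
      have h2 := congrArg (fun q : P ⟶ P => q.hom.app b y) h1
      rw [Mod.sum_app] at h2
      exact h2
    sum_φ := fun {a} ψ => by
      let := h.choose_spec.choose
      have h1 := h.choose_spec.choose_spec.choose_spec.choose_spec.choose_spec
      exact sum_comp_elt h1 (ψ : P ⟶ (repMod k C).obj (op a)) }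

/-- The dual pair `(Q^*, Q)` of a finitely generated projective module over the opposite
category. -/
def starPairOp {Q : Mod k Cᵒᵖ} (hQ : proj k Cᵒᵖ Q) :
    DualPair (unopop.obj ((star k Cᵒᵖ).obj (op Q))) Q :=
  let D := starPair hQ
  { B := ObjectProperty.homMk
      { app := fun a => ModuleCat.ofHom
          { toFun := fun φ => (ObjectProperty.homMk
              { app := fun b => ModuleCat.ofHom
                  { toFun := fun (y : Q ⟶ (repMod k Cᵒᵖ).obj (op (op b))) =>
                      (y.hom.app a φ : op b ⟶ a).unop
                    map_add' := fun _ _ => rfl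
                    map_smul' := fun _ _ => rfl }
                naturality := fun b c f => rfl } :
              unopop.obj ((star k Cᵒᵖ).obj (op Q)) ⟶ (repMod k C).obj a)
            map_add' := fun φ ψ => Mod.hom_ext fun b (y : Q ⟶ (repMod k Cᵒᵖ).obj (op (op b))) =>
              congrArg Quiver.Hom.unop (map_add (y.hom.app a).hom φ ψ)
            map_smul' := fun c φ => Mod.hom_ext fun b (y : Q ⟶ (repMod k Cᵒᵖ).obj (op (op b))) =>
              congrArg Quiver.Hom.unop (map_smul (y.hom.app a).hom c φ) }
        naturality := fun a b f => by
          ext φ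
          refine Mod.hom_ext fun c (y : Q ⟶ (repMod k Cᵒᵖ).obj (op (op c))) => ?_
          exact congrArg Quiver.Hom.unop (Mod.naturality y f φ) }
    J := D.J
    fintype := D.fintype
    pt := fun j => (D.pt j).unop
    -- The pair for `Q` is read backwards: the two dual bases exchange roles, which avoids passing
    -- through a double dual.
    x := fun j => D.φ j
    φ := fun j => D.x j
    sum_x := fun {b} y => D.sum_φ (a := op b) y
    sum_φ := fun {a} ψ => D.sum_x (b := op a) ψ }

theorem proj_of_dualPair (D : DualPair P Q) : proj k C P :=
  proj_iff.2 ⟨D.J, D.fintype, D.pt, D.x, fun j => D.B.hom.app _ (D.φ j), D.sum_hom (𝟙 P)⟩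

/-- The tautological pairing between `D Z` and `Z`. -/
def dualPairing (Z : Mod k Cᵒᵖ) : PerfectPairing (unopop.obj ((dual k Cᵒᵖ).obj (op Z))) Z where
  toDual _ := LinearMap.id
  balanced _ _ _ := rfl
  bijective _ := Function.bijective_id

/-- The evaluation pairing between a pointwise finite dimensional module and its dual. -/
def evalPairing (N : Mod k C) (hN : ∀ a, Module.Finite k (N.obj.obj a)) :
    PerfectPairing N ((dual k C).obj (op N)) where
  toDual a := Module.Dual.eval k (N.obj.obj a)
  balanced _ _ _ := rfl
  bijective a :=
    have := hN a
    Module.bijective_dual_eval k (N.obj.obj a)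

end DualPairs

/-! ### Finiteness of Hom-spaces and the exact sequence defining the transpose -/

section

variable {k : Type u} [Field k] {C : Type u} [SmallCategory C] [Preadditive C] [Linear k C]

theorem FP.epi_of_epi {M N : FP k C} {f : M ⟶ N} (h : Epi f.hom) : Epi f :=
  (fp k C).ι.epi_of_epi_map h

theorem FP.finite_hom (hfin : ∀ a b : C, Module.Finite k (a ⟶ b)) (M N : FP k C) :
    Module.Finite k (M ⟶ N) := by
  have := GenAR.finite_hom (fg_of_fp M.property) (finite_app_of_fg hfin (fg_of_fp N.property))
  exact Module.Finite.of_injective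
    ({ toFun := fun f => f.hom, map_add' := fun _ _ => rfl, map_smul' := fun _ _ => rfl } :
      (M ⟶ N) →ₗ[k] (M.obj ⟶ N.obj)) fun f g h => ObjectProperty.hom_ext _ h

theorem exact_cokernel {M N : Mod k C} (f : M ⟶ N) :
    (ShortComplex.mk f (cokernel.π f) (cokernel.condition f)).Exact :=
  ShortComplex.exact_of_g_is_cokernel _ (cokernelIsCokernel f)

theorem epi_cokernel {M N : Mod k C} (f : M ⟶ N) : Epi (cokernel.π f) := inferInstance

theorem MinPres.proj_P₀ {M : Mod k C} (p : MinPres M) (hM : fg k C M) : proj k C p.P₀ :=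
  proj_of_isProjectiveCover p.cover₀ hM

theorem fg_dual {N : Mod k C} (hN : fd k C N) : fg k Cᵒᵖ ((dual k C).obj (op N)) := fg_of_fd (fd_dual hN)

/-- `Cᵒᵖ` is not assumed locally Noetherian; the image of `p.f₁` is finitely generated because it
sits in the finite dimensional module `p.P₀`. -/
theorem proj_P₁_dual (e : C ≃ ℕ) (hA : ∀ a b : C, e a < e b → ∀ f : b ⟶ a, f = 0)
    (hfin : ∀ a b : C, Module.Finite k (a ⟶ b)) {M : Mod k Cᵒᵖ} (p : MinPres M)
    (hM : fg k Cᵒᵖ M) : proj k Cᵒᵖ p.P₁ :=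
  proj_of_isProjectiveCover p.cover₁ (fg_of_fd (fd_of_mono (Abelian.image.ι p.f₁)
    (fd_of_fg_op e hA hfin (fg_of_proj (p.proj_P₀ hM)))))

section Transpose

attribute [local irreducible] star

/-- The projection onto the transpose. -/
def trπ {M : Mod k C} (p : MinPres M) : (star k C).obj (op p.P₁) ⟶ tr p :=
  cokernel.π ((star k C).map p.f₁.op)

theorem epi_trπ {M : Mod k C} (p : MinPres M) : Epi (trπ p) :=
  epi_cokernel _

theorem trπ_condition {M : Mod k C} (p : MinPres M) : (star k C).map p.f₁.op ≫ trπ p = 0 :=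
  cokernel.condition _

theorem exact_trπ {M : Mod k C} (p : MinPres M) :
    (ShortComplex.mk ((star k C).map p.f₁.op) (trπ p) (trπ_condition p)).Exact :=
  exact_cokernel _

theorem trπ_trMap {M N : Mod k C} {p : MinPres M} {q : MinPres N} {f : M ⟶ N}
    (g : PresHom p q f) : trπ q ≫ trMap g = (star k C).map g.g₁.op ≫ trπ p :=
  cokernel.π_desc _ _ _

end Transpose

end

/-! ### The category `fp C` and the formula for `D Tr` -/

section FinitelyPresented

attribute [local instance] Abelian.hasFiniteBiproducts

variable {k : Type u} [Field k] {C : Type u} [SmallCategory C] [Preadditive C] [Linear k C]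
  [LocallyNoetherian k C]

theorem FP.exact_of_exact {M N K : FP k C} {f : M ⟶ N} {g : N ⟶ K} {w : f ≫ g = 0}
    {w' : f.hom ≫ g.hom = 0} (h : (ShortComplex.mk f.hom g.hom w').Exact) :
    (ShortComplex.mk f g w).Exact := by
  have : (fp k C).ι.PreservesHomology :=
    { preservesKernels := fun _ _ f => (fp k C).preservesKernels_ι f
      preservesCokernels := fun _ _ f => (fp k C).preservesCokernels_ι f }
  exact (ShortComplex.exact_map_iff_of_faithful (ShortComplex.mk f g w) (fp k C).ι).1 h

theorem FP.projective_of_projective {P : FP k C} (h : Projective P.obj) : Projective P where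
  factors {M N} f e _ := by
    have := (fp k C).preservesEpimorphisms_ι_of_isNormalMonoCategory
    have he : Epi ((fp k C).ι.map e) := inferInstance
    have : Epi e.hom := he
    exact ⟨ObjectProperty.homMk (Projective.factorThru f.hom e.hom),
      ObjectProperty.hom_ext _ (Projective.factorThru_comp _ _)⟩

theorem fp_of_proj {P : Mod k C} (hP : proj k C P) : fp k C P := fp_of_fg (fg_of_proj hP)

instance : EnoughProjectives (FP k C) where
  presentation M := by
    obtain ⟨P, f, hP, hf⟩ := fg_of_fp M.property
    exact ⟨{ p := ⟨P, fp_of_proj hP⟩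
             projective := FP.projective_of_projective (projective_of_proj hP)
             f := ObjectProperty.homMk f
             epi := FP.epi_of_epi hf }⟩

theorem finite_ext1 {A : Type v} [Category.{u} A] [Abelian A] [Linear k A] [EnoughProjectives A]
    (hfin : ∀ X Y : A, Module.Finite k (X ⟶ Y)) (X Y : A) : Module.Finite k (Ext1 X Y) := by
  let S : ShortComplex A := ShortComplex.mk (kernel.ι (Projective.π X)) (Projective.π X)
    (kernel.condition _)
  have hS : S.ShortExact :=
    { exact := ShortComplex.exact_of_f_is_kernel _ (kernelIsKernel _)
      mono_f := by dsimp [S]; infer_instance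
      epi_g := by dsimp [S]; infer_instance }
  have : Projective S.X₂ := inferInstanceAs (Projective (Projective.over X))
  have := hfin S.X₁ Y
  exact Module.Finite.of_surjective (conn k hS Y) (conn_surjective k hS)

/-- A Nakayama form on modules gives one on finitely presented modules. -/
theorem FP.isNakayama {P P' N : FP k C} {f : P ⟶ P'} {θ : Module.Dual k (P.obj ⟶ N.obj)}
    (h : IsNakayama f.hom θ) : IsNakayama f (θ ∘ₗ
      ({ toFun := fun f => f.hom, map_add' := fun _ _ => rfl, map_smul' := fun _ _ => rfl } :
        (P ⟶ N) →ₗ[k] (P.obj ⟶ N.obj))) where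
  vanish g := h.vanish g.hom
  exists_lift {X} l hl := by
    obtain ⟨q, hq⟩ := h.exists_lift (l ∘ₗ
      ({ toFun := fun f => ObjectProperty.homMk f, map_add' := fun _ _ => rfl,
         map_smul' := fun _ _ => rfl } : (P.obj ⟶ X.obj) →ₗ[k] (P ⟶ X)))
      fun g => hl (ObjectProperty.homMk g)
    exact ⟨ObjectProperty.homMk q, fun p => hq p.hom⟩
  hom_ext {X} q q' H := ObjectProperty.hom_ext _ (h.hom_ext fun p => H (ObjectProperty.homMk p))

/-- The data of the Auslander-Reiten formula obtained from a presentation by finitely generated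
projective modules and a dual presentation over the opposite category. -/
def nakayamaData {P₁ P₀ M N : Mod k C} {Q₁ Q₀ Z : Mod k Cᵒᵖ} {D₁ : DualPair P₁ Q₁}
    {D₀ : DualPair P₀ Q₀} {f : P₁ ⟶ P₀} {f' : Q₀ ⟶ Q₁} (hf : DualPair.Adjoint D₁ D₀ f f')
    (β : PerfectPairing N Z) {ζ : Q₁ ⟶ Z} {w : f' ≫ ζ = 0} (hζ : (ShortComplex.mk f' ζ w).Exact)
    (hζ' : Epi ζ) {f₀ : P₀ ⟶ M} {w₀ : f ≫ f₀ = 0} (h₀ : (ShortComplex.mk f f₀ w₀).Exact)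
    (h₀' : Epi f₀) (hM : fp k C M) (hN : fp k C N) :
    NakayamaData k (⟨M, hM⟩ : FP k C) ⟨N, hN⟩ where
  P₁ := ⟨P₁, fp_of_proj (proj_of_dualPair D₁)⟩
  P₀ := ⟨P₀, fp_of_proj (proj_of_dualPair D₀)⟩
  f₁ := ObjectProperty.homMk f
  f₀ := ObjectProperty.homMk f₀
  w := ObjectProperty.hom_ext _ w₀
  exact := FP.exact_of_exact h₀
  epi := FP.epi_of_epi h₀'
  projective := FP.projective_of_projective (projective_of_proj (proj_of_dualPair D₀))
  θ := _
  nakayama := FP.isNakayama (isNakayama_traceForm hf β hζ)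

theorem MinPres.proj_P₁ {M : Mod k C} (p : MinPres M) (hM : fg k C M) : proj k C p.P₁ :=
  proj_of_isProjectiveCover p.cover₁
    (LocallyNoetherian.fg_of_mono (Abelian.image.ι p.f₁) (fg_of_proj (p.proj_P₀ hM)))

/-- `Tr M` is a quotient of `P₁^*`, which is finite dimensional. -/
theorem fd_dTr (e : C ≃ ℕ) (hA : ∀ a b : C, e a < e b → ∀ f : b ⟶ a, f = 0)
    (hfin : ∀ a b : C, Module.Finite k (a ⟶ b)) {M : Mod k C} (hM : fg k C M) (p : MinPres M) :
    fd k C (dTr p) :=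
  have := epi_trπ p
  fd_unopop (fd_dual (fd_of_epi (trπ p) (fd_star e hA hfin (p.proj_P₁ hM))))

/-- The Auslander-Reiten formula for `D Tr M`. -/
def dTrData {M : FP k C} (p : MinPres M.obj) (hp : fp k C (dTr p)) :
    NakayamaData k M ⟨dTr p, hp⟩ :=
  nakayamaData (D₁ := starPair (p.proj_P₁ (fg_of_fp M.property)))
    (D₀ := starPair (p.proj_P₀ (fg_of_fp M.property))) (f := p.f₁) (f' := (star k C).map p.f₁.op)
    ((Category.comp_id _).trans (Category.id_comp _).symm) (dualPairing (tr p))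
    (exact_trπ p) (epi_trπ p) p.exact p.cover₀.epi M.property hp

/-- Moving `g₁` across the trace turns it into `g₁^*`, and `trπ_trMap` exchanges that for the
induced map of transposes, whose dual is `dTrMap g`. -/
theorem dTrData_compat {M N : FP k C} {p : MinPres M.obj} {q : MinPres N.obj} (hp : fp k C (dTr p))
    (hq : fp k C (dTr q)) {f : M ⟶ N} (g : PresHom p q f.hom) :
    FormCompat (dTrData p hp).γ (dTrData q hq).γ f (ObjectProperty.homMk (dTrMap g)) := by
  refine NakayamaData.compat (d := dTrData p hp) (d' := dTrData q hq)
    (g₀ := ObjectProperty.homMk g.g₀) (g₁ := ObjectProperty.homMk g.g₁)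
    (ObjectProperty.hom_ext _ g.comm₀) (ObjectProperty.hom_ext _ g.comm₁) fun x => ?_
  have h1 := traceForm_comp (D := starPair (p.proj_P₁ (fg_of_fp M.property)))
    (D' := starPair (q.proj_P₁ (fg_of_fp N.property))) (f := g.g₁) (f' := (star k C).map g.g₁.op)
    ((Category.comp_id _).trans (Category.id_comp _).symm) (dualPairing (tr p)) (trπ p) x.hom
  have h2 := traceForm_map (starPair (q.proj_P₁ (fg_of_fp N.property))) (β := dualPairing (tr p))
    (β' := dualPairing (tr q)) (w := dTrMap g) (u := trMap g) (fun _ _ _ => rfl) (trπ q) x.hom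
  refine h1.trans (Eq.trans ?_ h2.symm)
  exact congrArg (fun ζ => traceForm _ _ ζ x.hom) (trπ_trMap g).symm

theorem fp_of_fd {N : Mod k C} (hN : fd k C N) : fp k C N := fp_of_fg (fg_of_fd hN)

end FinitelyPresented

/-! ### The formula for `Tr D` -/

section TransposeDual

attribute [local instance] Abelian.hasFiniteBiproducts

variable {k : Type u} [Field k] {C : Type u} [SmallCategory C] [Preadditive C] [Linear k C]

/-- The projection onto `Tr D N`. -/
def trDπ {N : Mod k C} (p : MinPres ((dual k C).obj (op N))) :
    unopop.obj ((star k Cᵒᵖ).obj (op p.P₁)) ⟶ trD p :=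
  unopop.map (trπ p)

theorem epi_trDπ {N : Mod k C} (p : MinPres ((dual k C).obj (op N))) : Epi (trDπ p) :=
  Mod.epi_of_surjective fun a =>
    have := epi_trπ p
    Mod.surjective_of_epi (trπ p) (op (op a))

theorem trDπ_condition {N : Mod k C} (p : MinPres ((dual k C).obj (op N))) :
    unopop.map ((star k Cᵒᵖ).map p.f₁.op) ≫ trDπ p = 0 :=
  Mod.hom_ext fun a x =>
    congrArg (fun q : (star k Cᵒᵖ).obj (op p.P₀) ⟶ tr p => q.hom.app (op (op a)) x)
      (trπ_condition p)

theorem exact_trDπ {N : Mod k C} (p : MinPres ((dual k C).obj (op N))) :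
    (ShortComplex.mk (unopop.map ((star k Cᵒᵖ).map p.f₁.op)) (trDπ p) (trDπ_condition p)).Exact :=
  Mod.exact_of_pointwise _ fun a y hy => Mod.exists_of_exact (exact_trπ p) (op (op a)) y hy

theorem adjoint_starPairOp {Q Q' : Mod k Cᵒᵖ} (hQ : proj k Cᵒᵖ Q) (hQ' : proj k Cᵒᵖ Q')
    (f : Q' ⟶ Q) : DualPair.Adjoint (starPairOp hQ) (starPairOp hQ')
      (unopop.map ((star k Cᵒᵖ).map f.op)) f :=
  rfl

theorem unopop_map_comp {M N K : Mod k Cᵒᵖᵒᵖ} (f : M ⟶ N) (g : N ⟶ K) :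
    unopop.map (f ≫ g) = unopop.map f ≫ unopop.map g :=
  unopop.map_comp f g

theorem trDπ_trDMap {N N' : Mod k C} {p : MinPres ((dual k C).obj (op N))}
    {q : MinPres ((dual k C).obj (op N'))} {f : N ⟶ N'} (g : PresHom q p ((dual k C).map f.op)) :
    trDπ p ≫ trDMap g = unopop.map ((star k Cᵒᵖ).map g.g₁.op) ≫ trDπ q := by
  exact (unopop_map_comp (trπ p) (trMap g)).symm.trans
    ((congrArg unopop.map (trπ_trMap g)).trans (unopop_map_comp _ _))

theorem traceForm_evalPairing {P N N' : Mod k C} {Q : Mod k Cᵒᵖ} (D : DualPair P Q)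
    (hN : ∀ a, Module.Finite k (N.obj.obj a)) (hN' : ∀ a, Module.Finite k (N'.obj.obj a))
    (f : N ⟶ N') (ζ : Q ⟶ (dual k C).obj (op N')) (x : P ⟶ N) :
    traceForm D (evalPairing N' hN') ζ (x ≫ f) =
      traceForm D (evalPairing N hN) (ζ ≫ (dual k C).map f.op) x :=
  traceForm_map D (fun _ _ _ => rfl) ζ x

attribute [local irreducible] star unopop dual

variable [LocallyNoetherian k C]

theorem fp_trD {N : Mod k C} {p : MinPres ((dual k C).obj (op N))} (h₁ : proj k Cᵒᵖ p.P₁) :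
    fp k C (trD p) :=
  have := epi_trDπ p
  fp_of_fg (fg_of_epi (trDπ p) (fg_of_proj (proj_of_dualPair (starPairOp h₁))))

/-- The Auslander-Reiten formula for `Tr D N`. -/
def trDData {N : Mod k C} (hN : fd k C N) {p : MinPres ((dual k C).obj (op N))}
    (h₁ : proj k Cᵒᵖ p.P₁) (hp : fp k C (trD p)) :
    NakayamaData k (⟨trD p, hp⟩ : FP k C) ⟨N, fp_of_fd hN⟩ :=
  nakayamaData (D₁ := starPairOp (p.proj_P₀ (fg_dual hN))) (D₀ := starPairOp h₁)
    (f := unopop.map ((star k Cᵒᵖ).map p.f₁.op)) (f' := p.f₁)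
    (adjoint_starPairOp _ _ _) (evalPairing N hN.2) p.exact p.cover₀.epi (exact_trDπ p)
    (epi_trDπ p) hp (fp_of_fd hN)

theorem trDData_compat {N N' : Mod k C} (hN : fd k C N) (hN' : fd k C N')
    {p : MinPres ((dual k C).obj (op N))} {q : MinPres ((dual k C).obj (op N'))}
    (hp₁ : proj k Cᵒᵖ p.P₁) (hp : fp k C (trD p)) (hq₁ : proj k Cᵒᵖ q.P₁) (hq : fp k C (trD q))
    {f : N ⟶ N'} (g : PresHom q p ((dual k C).map f.op)) :
    FormCompat (trDData hN hp₁ hp).γ (trDData hN' hq₁ hq).γ (ObjectProperty.homMk (trDMap g))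
      (ObjectProperty.homMk f) := by
  refine NakayamaData.compat (d := trDData hN hp₁ hp) (d' := trDData hN' hq₁ hq)
    -- Dualizing reverses the presentation of `D N`: the presentation of `Tr D N` is `P₀^* ⟶ P₁^*`,
    -- so `g.g₁` and `g.g₀` swap degrees.
    (g₀ := ObjectProperty.homMk (unopop.map ((star k Cᵒᵖ).map g.g₁.op)))
    (g₁ := ObjectProperty.homMk (unopop.map ((star k Cᵒᵖ).map g.g₀.op)))
    (ObjectProperty.hom_ext _ ?_) (ObjectProperty.hom_ext _ ?_) fun x => ?_
  · exact (trDπ_trDMap g).symm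
  · have h : (star k Cᵒᵖ).map g.g₀.op ≫ (star k Cᵒᵖ).map q.f₁.op =
        (star k Cᵒᵖ).map p.f₁.op ≫ (star k Cᵒᵖ).map g.g₁.op := by
      rw [← Functor.map_comp, ← Functor.map_comp, ← op_comp, ← op_comp, g.comm₁]
    exact (unopop_map_comp _ _).symm.trans ((congrArg unopop.map h).trans (unopop_map_comp _ _))
  · have h1 := traceForm_comp (adjoint_starPairOp (p.proj_P₀ (fg_dual hN))
      (q.proj_P₀ (fg_dual hN')) g.g₀) (evalPairing N hN.2) p.f₀ x.hom
    have h2 := traceForm_evalPairing (starPairOp (q.proj_P₀ (fg_dual hN'))) hN.2 hN'.2 f q.f₀ x.hom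
    refine h1.trans (Eq.trans ?_ h2.symm)
    exact congrArg (fun ζ => traceForm _ _ ζ x.hom) g.comm₀

end TransposeDual

/-! ### Assembly and the description of `(fp C)_l` -/

section Main

attribute [local instance] Abelian.hasFiniteBiproducts

variable {k : Type u} [Field k] {C : Type u} [SmallCategory C] [Preadditive C] [Linear k C]

theorem biproduct_ext_app {J : Type} [Finite J] {X : J → Mod k C} {a : C}
    {x y : (⨁ X).obj.obj a}
    (h : ∀ j, (biproduct.π X j).hom.app a x = (biproduct.π X j).hom.app a y) : x = y :=
  elt_injective (biproduct.hom_ext _ _ fun j => by rw [elt_comp, elt_comp, h])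

theorem fd_biproduct {J : Type} [Finite J] {X : J → Mod k C} (h : ∀ j, fd k C (X j)) :
    fd k C (⨁ X) := by
  refine ⟨(Set.finite_iUnion fun j => (h j).1).subset fun a ha => ?_, fun a => ?_⟩
  · have : Nontrivial ((⨁ X).obj.obj a) := ha
    obtain ⟨x, y, hxy⟩ := exists_pair_ne ((⨁ X).obj.obj a)
    by_contra hn
    refine hxy (biproduct_ext_app fun j => ?_)
    have : Subsingleton ((X j).obj.obj a) := not_nontrivial_iff_subsingleton.1 fun h' =>
      hn (Set.mem_iUnion.2 ⟨j, h'⟩)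
    exact Subsingleton.elim _ _
  · have := fun j => (h j).2 a
    exact Module.Finite.of_injective
      (LinearMap.pi fun j => ((biproduct.π X j).hom.app a).hom : _ →ₗ[k] ∀ j, (X j).obj.obj a)
      fun x y hxy => biproduct_ext_app fun j => congrFun hxy j

theorem exists_minPres_dual (e : C ≃ ℕ) (hA : ∀ a b : C, e a < e b → ∀ f : b ⟶ a, f = 0)
    (hfin : ∀ a b : C, Module.Finite k (a ⟶ b)) {N : Mod k C} (hN : fd k C N) :
    Nonempty (MinPres ((dual k C).obj (op N))) :=
  exists_minPres (finite_hom_op hfin) (fg_dual hN) fun _ f hP =>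
    fg_of_fd (fd_of_mono (kernel.ι f) (fd_of_fg_op e hA hfin (fg_of_proj hP)))

theorem injTrivial_of_injective {A : Type v} [Category.{u} A] [Abelian A] [Linear k A] {X I : A}
    [Injective I] (f : X ⟶ I) : f ∈ injTrivial k X I :=
  fun _ => LinearMap.ext fun _ => ext1_eq_zero_of_injective _

/-- What remains of the identity after removing the terms satisfying `p` is a sum of morphisms
factoring through injectives. -/
theorem sub_mem_injTrivial {A : Type v} [Category.{u} A] [Abelian A] [Linear k A] {M F : A}
    {J : Type} [Fintype J] (p : J → Prop) [DecidablePred p] {Y : J → A} {f : ∀ j, M ⟶ Y j}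
    {g : ∀ j, Y j ⟶ M} (h : ∑ j, f j ≫ g j = 𝟙 M) (hY : ∀ j, ¬ p j → Injective (Y j))
    {i : M ⟶ F} {q : F ⟶ M} (hiq : i ≫ q = ∑ j : {j // p j}, f j.1 ≫ g j.1) :
    𝟙 M - i ≫ q ∈ injTrivial k M M := by
  rw [hiq, ← h, ← Fintype.sum_subtype_add_sum_subtype p, add_sub_cancel_left]
  refine Submodule.sum_mem _ fun j _ => ?_
  have := hY j.1 j.2
  exact injTrivial_comp_right k _ (injTrivial_of_injective _)

theorem sum_retract {A : Type v} [Category.{u} A] [Abelian A] {M : A} {J : Type} [Fintype J]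
    {X : J → A} (r : Retract M (⨁ X)) :
    ∑ j, (r.i ≫ biproduct.π X j) ≫ biproduct.ι X j ≫ r.r = 𝟙 M := by
  have h : ∀ j, (r.i ≫ biproduct.π X j) ≫ biproduct.ι X j ≫ r.r =
      r.i ≫ (biproduct.π X j ≫ biproduct.ι X j) ≫ r.r := fun j => by simp
  simp only [h, ← Preadditive.comp_sum, ← Preadditive.sum_comp]
  simp

theorem FP.sum_hom {J : Type} [Fintype J] {M N : FP k C} {Y : J → FP k C} (f : ∀ j, M ⟶ Y j)
    (g : ∀ j, Y j ⟶ N) : (∑ j, f j ≫ g j).hom = ∑ j, (f j).hom ≫ (g j).hom :=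
  map_sum (AddMonoidHom.mk' (fun f : M ⟶ N => f.hom) fun _ _ => rfl) _ _

variable [LocallyNoetherian k C]

theorem exists_minPres_of_fg (hfin : ∀ a b : C, Module.Finite k (a ⟶ b)) {M : Mod k C}
    (hM : fg k C M) : Nonempty (MinPres M) :=
  exists_minPres hfin hM fun _ f hP =>
    LocallyNoetherian.fg_of_mono (kernel.ι f) (fg_of_proj hP)

theorem FP.finite_ext1 (hfin : ∀ a b : C, Module.Finite k (a ⟶ b)) (M N : FP k C) :
    Module.Finite k (Ext1 M N) :=
  GenAR.finite_ext1 (k := k) (A := FP k C) (FP.finite_hom hfin) M N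

/-- The forms on `Ext¹(M, D Tr M)`. -/
def serre (e : C ≃ ℕ) (hA : ∀ a b : C, e a < e b → ∀ f : b ⟶ a, f = 0)
    (hfin : ∀ a b : C, Module.Finite k (a ⟶ b)) : Serre k (FP k C) :=
  let p (M : FP k C) : MinPres M.obj := (exists_minPres_of_fg hfin (fg_of_fp M.property)).some
  let hp (M : FP k C) : fp k C (dTr (p M)) := fp_of_fd (fd_dTr e hA hfin (fg_of_fp M.property) _)
  { T := fun M => ⟨dTr (p M), hp M⟩
    γ := fun M => (dTrData (p M) (hp M)).γ
    right := fun M => (dTrData (p M) (hp M)).isRightDual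
    left := fun M => (dTrData (p M) (hp M)).isRightDual.isLeftDual
      (FP.finite_ext1 hfin)
    right_of_left := fun h => h.isRightDual (FP.finite_ext1 hfin) }

theorem leftAR_dTr (hfin : ∀ a b : C, Module.Finite k (a ⟶ b)) {M : FP k C} (p : MinPres M.obj)
    (hp : fp k C (dTr p)) : leftAR k (FP k C) ⟨dTr p, hp⟩ :=
  ((dTrData p hp).isRightDual.isLeftDual (FP.finite_ext1 hfin)).leftAR

theorem leftAR_of_fd (e : C ≃ ℕ) (hA : ∀ a b : C, e a < e b → ∀ f : b ⟶ a, f = 0)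
    (hfin : ∀ a b : C, Module.Finite k (a ⟶ b)) {N : Mod k C} (hN : fd k C N)
    (hN' : fp k C N) : leftAR k (FP k C) ⟨N, hN'⟩ := by
  obtain ⟨p⟩ := exists_minPres_dual e hA hfin hN
  have h₁ := proj_P₁_dual e hA hfin p (fg_dual hN)
  exact ((trDData hN h₁ (fp_trD h₁)).isRightDual.isLeftDual
    (FP.finite_ext1 hfin)).leftAR

/-- The equivalence `τ` is induced by `D Tr`. -/
def inducedByDTr (e : C ≃ ℕ) (hA : ∀ a b : C, e a < e b → ∀ f : b ⟶ a, f = 0)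
    (hfin : ∀ a b : C, Module.Finite k (a ⟶ b)) :
    InducedByDTr (serre e hA hfin).tauEquivalence.functor where
  exists_pres M := exists_minPres_of_fg hfin (fg_of_fp M.property)
  fp_dTr M p := fp_of_fd (fd_dTr e hA hfin (fg_of_fp M.property) p)
  leftAR_dTr _ p := leftAR_dTr hfin p _
  iso _ hM p := (serre e hA hfin).tauIso hM _ (dTrData p _).isRightDual
  naturality hM hN p q _ g := (serre e hA hfin).tauIso_naturality hM _ hN _
    (dTrData p _).isRightDual (dTrData q _).isRightDual (dTrData_compat _ _ g)

/-- The quasi-inverse of `τ` is induced by `Tr D`. -/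
def inducedByTrD (e : C ≃ ℕ) (hA : ∀ a b : C, e a < e b → ∀ f : b ⟶ a, f = 0)
    (hfin : ∀ a b : C, Module.Finite k (a ⟶ b)) :
    InducedByTrD (serre e hA hfin).tauEquivalence.inverse where
  exists_pres _ hN := exists_minPres_dual e hA hfin hN
  fp_of_fd _ hN := fp_of_fd hN
  leftAR_of_fd _ hN := leftAR_of_fd e hA hfin hN _
  fp_trD _ hN p := fp_trD (proj_P₁_dual e hA hfin p (fg_dual hN))
  rightAR_trD _ _ _ := (serre e hA hfin).rightAR _
  iso _ hN p := (serre e hA hfin).tauInvIso _ _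
    (trDData hN (proj_P₁_dual e hA hfin p (fg_dual hN)) _).isRightDual
  naturality hN hN' p q _ g := (serre e hA hfin).tauInvIso_naturality _ _ _ _
    (trDData hN (proj_P₁_dual e hA hfin p (fg_dual hN)) _).isRightDual
    (trDData hN' (proj_P₁_dual e hA hfin q (fg_dual hN')) _).isRightDual
    (trDData_compat hN hN' _ _ _ _ g)

theorem fpR_eq (e : C ≃ ℕ) (hA : ∀ a b : C, e a < e b → ∀ f : b ⟶ a, f = 0)
    (hfin : ∀ a b : C, Module.Finite k (a ⟶ b)) : fpR k C = fp k C :=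
  funext fun _ => propext ⟨fun h => h.1, fun h => ⟨h, (serre e hA hfin).rightAR _⟩⟩

/-- If `Y` represents `D Ext¹(-, M)`, then `M` and `D Tr Y` both represent `D Ext¹(Y, -)`, hence are
stably isomorphic. Fitting's lemma then makes `M` a summand of `D Tr Y` plus an injective, and `D Tr
Y` is finite dimensional. -/
theorem addClosure_of_fpL (e : C ≃ ℕ) (hA : ∀ a b : C, e a < e b → ∀ f : b ⟶ a, f = 0)
    (hfin : ∀ a b : C, Module.Finite k (a ⟶ b)) {M : Mod k C} (hM : fpL k C M) :
    addClosure (fd k C ⊔ fpInj k C) M := by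
  obtain ⟨hM, Y, hY⟩ := hM
  obtain ⟨γ, hγ⟩ := exists_isLeftDual_iff.1 hY
  obtain ⟨p⟩ := exists_minPres_of_fg hfin (fg_of_fp Y.property)
  have hp := fd_dTr e hA hfin (fg_of_fp Y.property) p
  obtain ⟨w, w', -, -, h, -⟩ := IsRightDual.exists_iso
    (hγ.isRightDual (FP.finite_ext1 hfin)) (dTrData p (fp_of_fd hp)).isRightDual
  have h1 : 𝟙 (⟨M, hM⟩ : FP k C) - w ≫ w' ∈ injTrivial k _ _ :=
    (Quotient.functor_map_eq_iff (injRel k (FP k C)) _ _).1 h.symm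
  have := FP.finite_hom hfin ⟨M, hM⟩ ⟨M, hM⟩
  obtain ⟨I, a, b, c, d, hI, h2⟩ := exists_summand_of_injTrivial h1
  refine ⟨Bool, inferInstance, fun j => bif j then dTr p else I.obj, ?_,
    ⟨biproduct.lift (Bool.rec c.hom a.hom), biproduct.desc (Bool.rec d.hom b.hom), ?_⟩⟩
  · rintro (_ | _)
    · exact Or.inr ⟨I.property, hI⟩
    · exact Or.inl hp
  · rw [biproduct.lift_desc, Fintype.sum_bool]
    exact congrArg (·.hom) h2

theorem fp_biproduct {J : Type} [Finite J] {X : J → Mod k C} (h : ∀ j, fp k C (X j)) :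
    fp k C (⨁ X) :=
  (fp k C).prop_of_iso (biproduct.isoProduct X).symm ((fp k C).prop_product h)

/-- Let `F` be the sum of the finite dimensional members of the family. The others are injective, so
`M` is a retract of `F` modulo injectively trivial morphisms, and `F` already lies in `(fp C)_l`. -/
theorem fpL_of_addClosure (e : C ≃ ℕ) (hA : ∀ a b : C, e a < e b → ∀ f : b ⟶ a, f = 0)
    (hfin : ∀ a b : C, Module.Finite k (a ⟶ b)) {M : Mod k C}
    (hM : addClosure (fd k C ⊔ fpInj k C) M) : fpL k C M := by
  classical
  obtain ⟨J, hJ, X, hX, ⟨r⟩⟩ := hM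
  have := Fintype.ofFinite J
  have hfp : ∀ j, fp k C (X j) := fun j => (hX j).elim fp_of_fd fun h => h.1
  have hM : fp k C M := (fp k C).prop_of_mono r.i (fp_biproduct hfp)
  let F : Mod k C := ⨁ fun j : {j // fd k C (X j)} => X j.1
  have hF : fd k C F := fd_biproduct fun j => j.2
  let Y (j : J) : FP k C := ⟨X j, hfp j⟩
  let f (j : J) : (⟨M, hM⟩ : FP k C) ⟶ Y j := ObjectProperty.homMk (r.i ≫ biproduct.π X j)
  let g (j : J) : Y j ⟶ ⟨M, hM⟩ := ObjectProperty.homMk (biproduct.ι X j ≫ r.r)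
  let i : (⟨M, hM⟩ : FP k C) ⟶ ⟨F, fp_of_fd hF⟩ :=
    ObjectProperty.homMk (biproduct.lift fun j => r.i ≫ biproduct.π X j.1)
  let q : (⟨F, fp_of_fd hF⟩ : FP k C) ⟶ ⟨M, hM⟩ :=
    ObjectProperty.homMk (biproduct.desc fun j => biproduct.ι X j.1 ≫ r.r)
  have h1 : ∑ j, f j ≫ g j = 𝟙 _ :=
    ObjectProperty.hom_ext _ ((FP.sum_hom f g).trans (sum_retract r))
  have h2 : i.hom ≫ q.hom = ∑ j : {j // fd k C (X j)}, (f j.1).hom ≫ (g j.1).hom :=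
    biproduct.lift_desc
  have h3 : i ≫ q = ∑ j : {j // fd k C (X j)}, f j.1 ≫ g j.1 :=
    ObjectProperty.hom_ext _ (h2.trans
      (FP.sum_hom (fun j : {j // fd k C (X j)} => f j.1) fun j => g j.1).symm)
  exact ⟨hM, leftAR_of_stable_retract (fun Y => FP.finite_hom hfin Y Y)
    (leftAR_of_fd e hA hfin hF (fp_of_fd hF))
    (sub_mem_injTrivial (fun j => fd k C (X j)) h1 (fun j hj => ((hX j).resolve_left hj).2) h3)⟩

end Main

end

end GenAR

open GenAR in
theorem theorem3p9 {k : Type u} [Field k] {C : Type u} [SmallCategory C] [Preadditive C]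
    [Linear k C]
    (e : C ≃ ℕ)
    (hA : ∀ a b : C, e a < e b → ∀ f : b ⟶ a, f = 0)
    (hfin : ∀ a b : C, Module.Finite k (a ⟶ b))
    [LocallyNoetherian k C] :
    fpR k C = fp k C ∧
    fpL k C = addClosure (fd k C ⊔ fpInj k C) ∧
    ∃ τ : RStable k (FP k C) ≌ LStable k (FP k C),
      Nonempty (InducedByDTr τ.functor) ∧
      Nonempty (InducedByTrD τ.inverse) ∧
      Nonempty (TauIso k τ.functor) ∧
      Nonempty (TauInvIso k τ.inverse) := by
  refine ⟨fpR_eq e hA hfin, funext fun M => propext ⟨addClosure_of_fpL e hA hfin,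
    fpL_of_addClosure e hA hfin⟩, (serre e hA hfin).tauEquivalence, ⟨inducedByDTr e hA hfin⟩,
    ⟨inducedByTrD e hA hfin⟩, ⟨(serre e hA hfin).isoTau⟩,
    ⟨TauIso.inverse _ (serre e hA hfin).isoTau (serre e hA hfin).rightAR⟩⟩
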